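/- Let $n\ge 0$ and let $X=(X_1,\dots,X_n)$ be a random vector on a probability space $(\Omega,\mathcal F,P)$ whose components $X_k$ (measurable maps from $\Omega$ into measurable spaces $E_k$) are independent. Put $S=S_1\times\cdots\times S_n$ with $S_k=X_k(\Omega)$ (each with the trace $\sigma$-field), and let $f:S\to\mathbb C$ be measurable. For $1\le k\le n$ let $$\alpha_k=\sup|f(x^k)-f(x)|,$$ the supremum being over all $x,x^k\in S$ that differ at most in the $k$-th coordinate, and assume that every $\alpha_k$ is finite (equivalently, that $f$ is bounded). For $j\ne k$ let $$\Delta_{jk}=\sup|f(x)-f(x^j)-f(x^k)+f(x^{jk})|,$$ the supremum being over all $x,x^j,x^k,x^{jk}\in S$ such that $x,x^k$ differ at most in the $k$-th coordinate, $x,x^j$ at most in the $j$-th, $x^j,x^{jk}$ at most in the $k$-th, and $x^k,x^{jk}$ at most in the $j$-th; let $\Delta_{kk}=0$. Write $\alpha=(\alpha_1,\dots,\alpha_n)^{\mathrm T}$ and $\Delta=(\Delta_{jk})$. For a complex random variable $Z$ let $\mathbb V Z=\mathbb E\,(Z-\mathbb E Z)^2$ denote its pseudovariance, and let $\operatorname{Var}$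 denote the usual variance of a real random variable. Then $f(X)$ is square-integrable, $e^{f(X)}$ is integrable, and the following hold. (a) There is $K\in\mathbb C$ with $$\mathbb E\,e^{f(X)}=e^{\mathbb E f(X)}(1+K),\qquad |K|\le e^{\frac18\alpha^{\mathrm T}\alpha}-1 .$$ (b) There are $L,L'\in\mathbb C$ with $$\mathbb E\,e^{f(X)}=e^{\mathbb E f(X)+\frac12\mathbb V f(X)}+L\,e^{\mathbb E\,\mathrm{Re} f(X)+\frac12\operatorname{Var}\mathrm{Re} f(X)} =e^{\mathbb E f(X)+\frac12\mathbb V f(X)}\bigl(1+L'\,e^{\frac12\operatorname{Var}\mathrm{Im} f(X)}\bigr)$$ and $$|L|=|L'|\le\exp\Bigl(\tfrac16\sum_{k=1}^n\alpha_k^3+\tfrac16\alpha^{\mathrm T}\Delta\alpha+\tfrac58\sum_{k=1}^n\alpha_k^4+\tfrac5{16}\alpha^{\mathrm T}\Delta^2\alpha\Bigr)-1 .$$ -/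

import Mathlib

open MeasureTheory ProbabilityTheory Matrix

noncomputable section

/-- The values `|F(y) - F(x)|` over all points `x, y` of the product domain `S_1 × ⋯ × S_n`
that differ in no coordinate other than the `k`-th. -/
def coordDiffs {n : ℕ} {S : Fin n → Type*} (F : (∀ i, S i) → ℂ) (k : Fin n) : Set ℝ :=
  {r | ∃ x y : ∀ i, S i, (∀ i, i ≠ k → y i = x i) ∧ r = ‖F y - F x‖}

/-- The vector of one-coordinate oscillations `α_k(F, S)`; each entry is a genuine supremum
when `coordDiffs F k` is bounded above. -/
def coordOsc {n : ℕ} {S : Fin n → Type*} (F : (∀ i, S i) → ℂ) : Fin n → ℝ :=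
  fun k => sSup (coordDiffs F k)

/-- The values `|F(x) - F(x^j) - F(x^k) + F(x^{jk})|` where `x, x^j` differ only in coordinate `j`,
`x, x^k` only in coordinate `k`, `x^j, x^{jk}` only in coordinate `k`, and `x^k, x^{jk}` only in
coordinate `j`. -/
def mixedDiffs {n : ℕ} {S : Fin n → Type*} (F : (∀ i, S i) → ℂ) (j k : Fin n) : Set ℝ :=
  {r | ∃ x xj xk xjk : ∀ i, S i,
    (∀ i, i ≠ k → xk i = x i) ∧ (∀ i, i ≠ j → xj i = x i) ∧
    (∀ i, i ≠ k → xjk i = xj i) ∧ (∀ i, i ≠ j → xjk i = xk i) ∧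
    r = ‖F x - F xj - F xk + F xjk‖}

/-- The matrix `Δ(F, S)` of maximal four-point mixed differences, with zero diagonal. -/
def mixedOsc {n : ℕ} {S : Fin n → Type*} (F : (∀ i, S i) → ℂ) : Matrix (Fin n) (Fin n) ℝ :=
  Matrix.of fun j k => if j = k then 0 else sSup (mixedDiffs F j k)

/-- The pseudovariance `𝕍 Z = E (Z - E Z)²` of a complex random variable. -/
def pseudovariance {Ω : Type*} [MeasurableSpace Ω] (Z : Ω → ℂ) (P : Measure Ω) : ℂ :=
  ∫ ω, (Z ω - ∫ ω', Z ω' ∂P) ^ 2 ∂P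

/-- The random vector `X = (X_1, …, X_n)` regarded as a map into the product
`X_1(Ω) × ⋯ × X_n(Ω)` of the ranges of its components. -/
def rangeVector {n : ℕ} {Ω : Type*} {E : Fin n → Type*} (X : ∀ k, Ω → E k) (ω : Ω) :
    ∀ k, Set.range (X k) :=
  fun k => ⟨X k ω, Set.mem_range_self ω⟩

end

/-! The engine is a Hoeffding lemma for a centred complex variable `Z` whose range has diameter at
most `α`, namely `|E e^Z - 1| ≤ e^{α²/8} - 1` (`norm_integral_exp_sub_one_le`). Its proof depends on
the size of `α`.

For `α ≤ 1.57` let `c` be unimodular. On a rectangle containing the range, `Re (c e^z)` lies below a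
real affine function that touches it at the two ends of a segment of length `α` (`chordGap_nonpos`).
Integrating leaves only a two-point law on that segment. As the segment rotates, the phase of `c`
makes at least a full turn, so some direction measures `|E e^Z - 1|` itself
(`norm_integral_exp_sub_one_le_twoPointMGF`). For `α = 3`, exponential tilting gives the bound
`1.815`, well below `e^{9/8} - 1`. Between `1.57` and `3` the three lines theorem interpolates in
`log α`; above `3`, the growth in `α` is compared with that of `e^{α²/8}`.

For (a), the coordinates are integrated out one at a time. The conditional mean as a function of the
`k`-th coordinate oscillates by at most `α_k`, and the lemma, applied to it and to its real part,
multiplies `1 +` the relative error by `e^{α_k²/8}`.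

For (b), the approximating exponent also carries half the conditional pseudovariance, and total
(pseudo)variance fits successive exponents together (`crossCov_disintegrate`). As a function of
coordinate `k`, the conditional pseudovariance oscillates by at most `q_k = Σ Δ_{jk} α_j`, the sum
being over the coordinates `j` ranked after `k`. The one-variable estimate
`norm_integral_exp_quadratic_sub_one_le` then costs `α_k³/6 + α_k q_k/3 + 5α_k⁴/8 + 5q_k²/8` in the
exponent. The `q_k` depend on the order of integration. For the natural order and its reverse they
add up to `Δα`, so one of the two has `Σ α_k q_k = ½ αᵀΔα` and `Σ q_k² ≤ ½ αᵀΔ²α`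
(`exists_rank_sum_laterInfluence_le`). -/

/-! ### Elementary trigonometric inequalities -/

open Real in
/-- A function whose derivative has the sign of a cosine that is first nonnegative and then
nonpositive is at least the minimum of its values at the end points. -/
lemma min_endpoints_le_of_deriv_cos {f E : ℝ → ℝ} {B q L t : ℝ} (hq : 0 ≤ q)
    (hderiv : ∀ t, HasDerivAt f (E t * cos (B + q * t)) t) (hE : ∀ t, 0 ≤ E t)
    (hB : -(π / 2) ≤ B) (hB' : B + q * L ≤ 3 * π / 2) (ht0 : 0 ≤ t) (htL : t ≤ L) :
    min (f 0) (f L) ≤ f t := by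
  have hcont : Continuous f := continuous_iff_continuousAt.2 fun x => (hderiv x).continuousAt
  rcases le_total (B + q * t) (π / 2) with h | h
  · refine (min_le_left _ _).trans ?_
    have hm : MonotoneOn f (Set.Icc 0 t) := by
      refine monotoneOn_of_deriv_nonneg (convex_Icc 0 t) hcont.continuousOn
        (fun x _ => (hderiv x).differentiableAt.differentiableWithinAt) ?_
      intro x hx
      rw [interior_Icc] at hx
      rw [(hderiv x).deriv]
      refine mul_nonneg (hE x) (cos_nonneg_of_neg_pi_div_two_le_of_le ?_ ?_)
      · nlinarith [mul_nonneg hq hx.1.le]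
      · nlinarith [mul_le_mul_of_nonneg_left hx.2.le hq]
    exact hm (Set.left_mem_Icc.2 ht0) (Set.right_mem_Icc.2 ht0) ht0
  · refine (min_le_right _ _).trans ?_
    have hm : AntitoneOn f (Set.Icc t L) := by
      refine antitoneOn_of_deriv_nonpos (convex_Icc t L) hcont.continuousOn
        (fun x _ => (hderiv x).differentiableAt.differentiableWithinAt) ?_
      intro x hx
      rw [interior_Icc] at hx
      rw [(hderiv x).deriv]
      refine mul_nonpos_of_nonneg_of_nonpos (hE x) (cos_nonpos_of_pi_div_two_le_of_le ?_ ?_)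
      · nlinarith [mul_le_mul_of_nonneg_left hx.1.le hq]
      · nlinarith [mul_le_mul_of_nonneg_left hx.2.le hq]
    exact hm (Set.left_mem_Icc.2 htL) (Set.right_mem_Icc.2 htL) htL

/-- The product of the Taylor minorants of `cos m` and `e^m` is `1 + m (1 - m²/2 - m³/4)`, and the
bracket is still positive at `1.12`. -/
lemma exp_neg_le_cos {m : ℝ} (hm : 0 ≤ m) (hm' : m ≤ 1.12) : Real.exp (-m) ≤ Real.cos m := by
  have h1 := Real.one_sub_sq_div_two_le_cos (x := m)
  have h2 := Real.quadratic_le_exp_of_nonneg hm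
  have h3 : 1 ≤ Real.cos m * Real.exp m := by
    have hc : 0 ≤ 1 - m ^ 2 / 2 := by nlinarith
    calc (1 : ℝ) ≤ (1 - m ^ 2 / 2) * (1 + m + m ^ 2 / 2) := by
          have : 0 ≤ m * (1 - m ^ 2 / 2 - m ^ 3 / 4) := by
            refine mul_nonneg hm ?_
            have : m ^ 3 ≤ 1.12 ^ 3 := pow_le_pow_left₀ hm hm' 3
            have : m ^ 2 ≤ 1.12 ^ 2 := pow_le_pow_left₀ hm hm' 2
            norm_num at *
            linarith
          nlinarith
      _ ≤ Real.cos m * Real.exp m := mul_le_mul h1 h2 (by positivity) (hc.trans h1)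
  rw [Real.exp_neg, inv_le_iff_one_le_mul₀ (Real.exp_pos m)]
  exact h3

lemma hasDerivAt_exp_neg_mul_sin (x : ℝ) :
    HasDerivAt (fun x => Real.exp (-x) * Real.sin x)
      (Real.exp (-x) * (Real.cos x - Real.sin x)) x := by
  have := ((Real.hasDerivAt_exp (-x)).comp x (hasDerivAt_neg x)).mul (Real.hasDerivAt_sin x)
  refine this.congr_deriv ?_
  simp only [Function.comp]
  ring

lemma concaveOn_exp_neg_mul_sin :
    ConcaveOn ℝ (Set.Icc 0 (Real.pi / 2)) (fun x => Real.exp (-x) * Real.sin x) := by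
  have hd : deriv (fun x => Real.exp (-x) * Real.sin x) =
      fun x => Real.exp (-x) * (Real.cos x - Real.sin x) :=
    funext fun x => (hasDerivAt_exp_neg_mul_sin x).deriv
  have hd2 : ∀ x, HasDerivAt (fun x => Real.exp (-x) * (Real.cos x - Real.sin x))
      (-2 * Real.exp (-x) * Real.cos x) x := by
    intro x
    have := ((Real.hasDerivAt_exp (-x)).comp x (hasDerivAt_neg x)).mul
      ((Real.hasDerivAt_cos x).sub (Real.hasDerivAt_sin x))
    refine this.congr_deriv ?_
    simp only [Function.comp, Pi.sub_apply]
    ring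
  refine concaveOn_of_deriv2_nonpos (convex_Icc _ _) (by fun_prop) (by fun_prop) ?_ ?_
  · rw [hd]; fun_prop
  · intro x hx
    rw [interior_Icc] at hx
    simp only [Function.iterate_succ, Function.iterate_zero, Function.comp, id]
    rw [hd, (hd2 x).deriv]
    have := Real.cos_nonneg_of_neg_pi_div_two_le_of_le (x := x) (by linarith [hx.1, Real.pi_pos]) hx.2.le
    have := mul_nonneg (Real.exp_pos (-x)).le this
    nlinarith

/-- Midpoint concavity of `e^{-x} sin x` reduces this to `s = c = m`, where it reads `2 e^{-m} sin m
≤ 2 sin m cos m`. It supplies the corner inequality `IsPhase.left`. -/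
lemma exp_neg_mul_sin_add_le {s c : ℝ} (hs : 0 ≤ s) (hs' : s ≤ Real.pi / 2) (hc : 0 ≤ c)
    (hc' : c ≤ Real.pi / 2) (hsc : s + c ≤ 2.24) :
    Real.exp (-c) * Real.sin c + Real.exp (-s) * Real.sin s ≤ Real.sin (s + c) := by
  have h := concaveOn_exp_neg_mul_sin.2 (Set.mem_Icc.2 ⟨hs, hs'⟩)
    (Set.mem_Icc.2 ⟨hc, hc'⟩) (show (0 : ℝ) ≤ 1 / 2 by norm_num)
    (show (0 : ℝ) ≤ 1 / 2 by norm_num) (by norm_num)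
  simp only [smul_eq_mul] at h
  set m := (1 / 2 : ℝ) * s + 1 / 2 * c with hm
  have h1 := exp_neg_le_cos (m := m) (by positivity) (by rw [hm]; linarith)
  have h2 : 0 ≤ Real.sin m := Real.sin_nonneg_of_nonneg_of_le_pi (by positivity)
    (by rw [hm]; linarith [Real.pi_pos])
  have h3 : Real.sin (s + c) = 2 * Real.sin m * Real.cos m := by
    rw [← Real.sin_two_mul]; congr 1; rw [hm]; ring
  rw [h3]
  nlinarith [mul_le_mul_of_nonneg_left h1 h2]

/-! ### The phase of `exp (α e^{iθ}) - 1` -/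

section TwoPointMajorant

variable {θ α a : ℝ}

lemma hasDerivAt_exp_mul_sin (p q r A t : ℝ) :
    HasDerivAt (fun t => Real.exp (p * t + r) * Real.sin (A + q * t))
      (Real.exp (p * t + r) * (p * Real.sin (A + q * t) + q * Real.cos (A + q * t))) t := by
  have h1 : HasDerivAt (fun t => Real.exp (p * t + r)) (Real.exp (p * t + r) * p) t := by
    simpa using (((hasDerivAt_id t).const_mul p).add_const r).exp
  have h2 : HasDerivAt (fun t => Real.sin (A + q * t)) (Real.cos (A + q * t) * q) t := by
    simpa using (((hasDerivAt_id t).const_mul q).const_add A).sin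
  exact (h1.mul h2).congr_deriv (by ring)

lemma hasDerivAt_exp_mul_cos (p q r A t : ℝ) :
    HasDerivAt (fun t => Real.exp (p * t + r) * Real.cos (A + q * t))
      (Real.exp (p * t + r) * (p * Real.cos (A + q * t) - q * Real.sin (A + q * t))) t := by
  have h1 : HasDerivAt (fun t => Real.exp (p * t + r)) (Real.exp (p * t + r) * p) t := by
    simpa using (((hasDerivAt_id t).const_mul p).add_const r).exp
  have h2 : HasDerivAt (fun t => Real.cos (A + q * t)) (-Real.sin (A + q * t) * q) t := by
    simpa using (((hasDerivAt_id t).const_mul q).const_add A).cos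
  exact (h1.mul h2).congr_deriv (by ring)

/-- By Rolle's theorem the phase `a` of `exp (α e^{iθ}) - 1` lies between `θ` and `θ + α sin θ`. -/
lemma phase_mem_Icc (hθ0 : 0 < θ) (hθ : θ ≤ Real.pi / 2) (hα0 : 0 < α) (hα : α ≤ Real.pi / 2)
    (ha0 : 0 < a) (haπ : a < Real.pi)
    (hrel : Real.exp (α * Real.cos θ) * Real.sin (a - α * Real.sin θ) = Real.sin a) :
    θ ≤ a ∧ a ≤ θ + α * Real.sin θ := by
  have hS : 0 < Real.sin θ := Real.sin_pos_of_pos_of_lt_pi hθ0 (by linarith [Real.pi_pos])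
  have hS1 := Real.sin_le_one θ
  obtain ⟨v, ⟨hv0, hvα⟩, hv⟩ := exists_hasDerivAt_eq_zero (a := 0) (b := α) hα0
    (f := fun t => Real.exp (Real.cos θ * t + 0) * Real.sin (a + -Real.sin θ * t))
    (f' := fun t => Real.exp (Real.cos θ * t + 0) * (Real.cos θ * Real.sin (a + -Real.sin θ * t)
      + -Real.sin θ * Real.cos (a + -Real.sin θ * t)))
    (by fun_prop) (by
      simp only [mul_zero, add_zero, Real.exp_zero, one_mul]
      rw [← hrel]; congr 2 <;> ring)
    (fun t _ => hasDerivAt_exp_mul_sin _ _ _ _ _)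
  have h0 : Real.sin (a + -Real.sin θ * v - θ) = 0 := by
    have := (mul_eq_zero.1 hv).resolve_left (Real.exp_pos _).ne'
    rw [Real.sin_sub]; linarith
  have hsv0 : 0 ≤ Real.sin θ * v := by positivity
  have hsv : Real.sin θ * v ≤ α * Real.sin θ := by nlinarith
  have hsv1 : Real.sin θ * v < Real.pi / 2 := by nlinarith
  have := (Real.sin_eq_zero_iff_of_lt_of_lt (by linarith) (by linarith)).1 h0
  constructor <;> linarith

/-- The hypotheses on the angle `a`, which is the phase of `exp (α e^{iθ}) - 1`. -/
structure IsPhase (θ α a : ℝ) : Prop where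
  θ_pos : 0 < θ
  θ_le : θ ≤ Real.pi / 2
  α_pos : 0 < α
  α_le : α ≤ Real.pi / 2
  a_pos : 0 < a
  a_lt : a < Real.pi
  -- All three relations concern the `w`-derivative of `chordGap`: `rel` makes it vanish at both
  -- contact points `(0, 0)` and `(α, 0)`, while `left` and `right` give its sign at the corners
  -- `(0, α)` and `(α, α)`.
  rel : Real.exp (α * Real.cos θ) * Real.sin (a - α * Real.sin θ) = Real.sin a
  left : Real.sin a ≤ Real.exp (α * Real.sin θ) * Real.sin (a + α * Real.cos θ)
  right : Real.sin (a - α * Real.sin θ) ≤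
    Real.exp (α * Real.sin θ) * Real.sin (a - α * Real.sin θ + α * Real.cos θ)

lemma one_sub_cos_le_mul_sin {c : ℝ} (hc0 : 0 ≤ c) (hc : c ≤ 1.6) :
    1 - Real.cos c ≤ c * Real.sin c := by
  have hh : Real.cos c = 1 - 2 * Real.sin (c / 2) ^ 2 := by
    have := Real.cos_two_mul (c / 2)
    have h3 := Real.sin_sq_add_cos_sq (c / 2)
    rw [mul_div_cancel₀ c two_ne_zero] at this
    linarith
  have hh2 : Real.sin c = 2 * Real.sin (c / 2) * Real.cos (c / 2) := by
    rw [← Real.sin_two_mul, mul_div_cancel₀ c two_ne_zero]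
  have h3 : 0 ≤ Real.sin (c / 2) :=
    Real.sin_nonneg_of_nonneg_of_le_pi (by positivity) (by linarith [Real.pi_gt_three])
  have h4 : Real.sin (c / 2) ≤ c / 2 := Real.sin_le (by positivity)
  have h5 := Real.one_sub_sq_div_two_le_cos (x := c / 2)
  have h6 : 1 / 2 ≤ Real.cos (c / 2) := by nlinarith
  rw [hh, hh2]
  have h7 := mul_le_mul_of_nonneg_left h4 h3
  have h8 := mul_le_mul_of_nonneg_left h6 (mul_nonneg h3 hc0)
  linarith

/-- Multiplication by `‖N‖` turns the sine and cosine of the phase into the imaginary and real parts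
of `N`, and the relations become inequalities between `s = α sin θ` and `c = α cos θ`. The bound on
`α` gives `s + c ≤ √2 · 1.57 < 2.24`. -/
lemma isPhase_arg (hθ0 : 0 < θ) (hθ : θ ≤ Real.pi / 2) (hα0 : 0 < α) (hα : α ≤ 1.57) :
    IsPhase θ α (Complex.exp (α * Complex.exp (θ * Complex.I)) - 1).arg := by
  have hpi : (1.57 : ℝ) ≤ Real.pi / 2 := by linarith [Real.pi_gt_d2]
  have hS : 0 < Real.sin θ := Real.sin_pos_of_pos_of_lt_pi hθ0 (by linarith [Real.pi_pos])
  have hS1 := Real.sin_le_one θ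
  have hC : 0 ≤ Real.cos θ := Real.cos_nonneg_of_neg_pi_div_two_le_of_le (by linarith) hθ
  have hC1 := Real.cos_le_one θ
  set s := α * Real.sin θ with hs
  set c := α * Real.cos θ with hc
  have hs0 : 0 < s := by positivity
  have hc0 : 0 ≤ c := by positivity
  have hsα : s ≤ α := by nlinarith
  have hcα : c ≤ α := by nlinarith
  have hsc : s + c ≤ 2.24 := by
    have h1 : s ^ 2 + c ^ 2 = α ^ 2 := by
      rw [hs, hc]; linear_combination α ^ 2 * Real.sin_sq_add_cos_sq θ
    nlinarith [sq_nonneg (s - c)]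
  have hcorner := exp_neg_mul_sin_add_le hs0.le (hsα.trans (hα.trans hpi)) hc0
    (hcα.trans (hα.trans hpi)) hsc
  have hsins : 0 < Real.sin s := Real.sin_pos_of_pos_of_lt_pi hs0 (by linarith [Real.pi_pos])
  have hsinc : 0 ≤ Real.sin c := Real.sin_nonneg_of_nonneg_of_le_pi hc0 (by linarith [Real.pi_pos])
  have hcosc : 0 ≤ Real.cos c :=
    Real.cos_nonneg_of_neg_pi_div_two_le_of_le (by linarith) (by linarith)
  set N := Complex.exp (α * Complex.exp (θ * Complex.I)) - 1 with hN
  have hz : (α * Complex.exp (θ * Complex.I) : ℂ) = ⟨c, s⟩ := by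
    rw [Complex.exp_mul_I]
    apply Complex.ext <;> simp [hs, hc, Complex.cos_ofReal_re, Complex.sin_ofReal_re]
  have hre : N.re = Real.exp c * Real.cos s - 1 := by
    rw [hN, hz, Complex.sub_re, Complex.exp_re]; simp
  have him : N.im = Real.exp c * Real.sin s := by
    rw [hN, hz, Complex.sub_im, Complex.exp_im]; simp
  have hec : 1 + c ≤ Real.exp c := by linarith [Real.add_one_le_exp c]
  have hes : 1 ≤ Real.exp s := by linarith [Real.add_one_le_exp s]
  have himpos : 0 < N.im := by rw [him]; positivity
  have hN0 : N ≠ 0 := fun h => by simp [h] at himpos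
  have hn : 0 < ‖N‖ := norm_pos_iff.2 hN0
  have hcosa : ‖N‖ * Real.cos N.arg = Real.exp c * Real.cos s - 1 := by
    rw [Complex.norm_mul_cos_arg, hre]
  have hsina : ‖N‖ * Real.sin N.arg = Real.exp c * Real.sin s := by
    rw [Complex.norm_mul_sin_arg, him]
  have e1 : Real.exp c * Real.exp (-c) = 1 := by rw [← Real.exp_add]; simp
  have e2 : Real.exp s * Real.exp (-s) = 1 := by rw [← Real.exp_add]; simp
  have hss := Real.sin_sq_add_cos_sq s
  -- The next two identities are the parts of `e^{-is} N = e^c - e^{-is}`.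
  have hsin' : ‖N‖ * Real.sin (N.arg - s) = Real.sin s := by
    rw [Real.sin_sub]
    linear_combination Real.cos s * hsina - Real.sin s * hcosa
  have hcos' : ‖N‖ * Real.cos (N.arg - s) = Real.exp c - Real.cos s := by
    rw [Real.cos_sub]
    linear_combination Real.cos s * hcosa + Real.sin s * hsina + Real.exp c * hss
  refine ⟨hθ0, hθ, hα0, hα.trans hpi, ?_, ?_, ?_, ?_, ?_⟩
  · refine lt_of_le_of_ne (Complex.arg_nonneg_iff.2 himpos.le) fun h => ?_
    rw [← h] at hsina
    simp only [Real.sin_zero, mul_zero] at hsina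
    rw [← him] at hsina; exact himpos.ne hsina
  · exact Complex.arg_lt_pi_iff.2 (Or.inr himpos.ne')
  · refine mul_left_cancel₀ hn.ne' ?_
    linear_combination Real.exp c * hsin' - hsina
  · refine le_of_mul_le_mul_left ?_ hn
    rw [Real.sin_add]
    have : ‖N‖ * (Real.exp s * (Real.sin N.arg * Real.cos c + Real.cos N.arg * Real.sin c))
        = Real.exp s * Real.exp c * (Real.sin (s + c) - Real.exp (-c) * Real.sin c) := by
      rw [Real.sin_add]
      linear_combination Real.exp s * Real.cos c * hsina + Real.exp s * Real.sin c * hcosa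
        + Real.exp s * Real.sin c * e1
    rw [this, hsina]
    have h := mul_le_mul_of_nonneg_left hcorner (by positivity : 0 ≤ Real.exp s * Real.exp c)
    have h2 : Real.exp s * Real.exp c * (Real.exp (-s) * Real.sin s) = Real.exp c * Real.sin s := by
      linear_combination Real.exp c * Real.sin s * e2
    linarith
  · refine le_of_mul_le_mul_left ?_ hn
    rw [Real.sin_add, hsin']
    have : ‖N‖ * (Real.exp s * (Real.sin (N.arg - s) * Real.cos c
        + Real.cos (N.arg - s) * Real.sin c))
        = Real.exp s * (Real.sin s * Real.cos c + (Real.exp c - Real.cos s) * Real.sin c) := by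
      linear_combination Real.exp s * Real.cos c * hsin' + Real.exp s * Real.sin c * hcos'
    rw [this]
    have h1 : 1 - Real.cos c ≤ c * Real.sin c :=
      one_sub_cos_le_mul_sin hc0 (by linarith)
    have h2 : Real.sin s * Real.cos c + (Real.exp c - Real.cos s) * Real.sin c ≥ Real.sin s := by
      have h3 : c * Real.sin c ≤ (Real.exp c - Real.cos s) * Real.sin c :=
        mul_le_mul_of_nonneg_right (by linarith [Real.cos_le_one s]) hsinc
      have h4 := mul_nonneg (sub_nonneg.2 (Real.sin_le_one s)) (sub_nonneg.2 (Real.cos_le_one c))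
      linarith
    exact h2.trans (le_mul_of_one_le_left (hsins.le.trans h2) hes)

end TwoPointMajorant

/-! ### The affine majorant of `Re (c e^z)` on a rectangle -/

section TwoPointMajorant

variable {θ α a : ℝ}

lemma IsPhase.sin_θ_pos (h : IsPhase θ α a) : 0 < Real.sin θ :=
  Real.sin_pos_of_pos_of_lt_pi h.θ_pos (by linarith [Real.pi_pos, h.θ_le])

lemma IsPhase.cos_θ_nonneg (h : IsPhase θ α a) : 0 ≤ Real.cos θ :=
  Real.cos_nonneg_of_neg_pi_div_two_le_of_le (by linarith [Real.pi_pos, h.θ_pos]) h.θ_le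

lemma IsPhase.sin_a_pos (h : IsPhase θ α a) : 0 < Real.sin a :=
  Real.sin_pos_of_pos_of_lt_pi h.a_pos h.a_lt

lemma IsPhase.le_a (h : IsPhase θ α a) : θ ≤ a :=
  (phase_mem_Icc h.θ_pos h.θ_le h.α_pos h.α_le h.a_pos h.a_lt h.rel).1

lemma IsPhase.a_le (h : IsPhase θ α a) : a ≤ θ + α * Real.sin θ :=
  (phase_mem_Icc h.θ_pos h.θ_le h.α_pos h.α_le h.a_pos h.a_lt h.rel).2

lemma IsPhase.mul_sin_le (h : IsPhase θ α a) : α * Real.sin θ ≤ Real.pi / 2 := by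
  nlinarith [h.α_le, h.α_pos, Real.sin_le_one θ]

lemma IsPhase.mul_cos_le (h : IsPhase θ α a) : α * Real.cos θ ≤ Real.pi / 2 := by
  nlinarith [h.α_le, h.α_pos, Real.cos_le_one θ]

lemma exp_mul_sin_ge_min {A w v : ℝ} (hC : 0 ≤ Real.sin θ)
    (h1 : A - θ ≤ Real.pi) (h2 : θ + α * Real.sin θ - A ≤ Real.pi) (hv0 : 0 ≤ v) (hv : v ≤ α) :
    min (Real.exp w * Real.sin A)
      (Real.exp (Real.cos θ * α + w) * Real.sin (A - Real.sin θ * α)) ≤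
      Real.exp (Real.cos θ * v + w) * Real.sin (A - Real.sin θ * v) := by
  have := min_endpoints_le_of_deriv_cos (L := α) (t := v) (q := Real.sin θ)
    (f := fun t => Real.exp (Real.cos θ * t + w) * Real.sin (A + -Real.sin θ * t))
    (E := fun t => Real.exp (Real.cos θ * t + w)) (B := Real.pi / 2 - A + θ) hC
    (fun t => (hasDerivAt_exp_mul_sin _ _ _ _ _).congr_deriv (by
      rw [show Real.pi / 2 - A + θ + Real.sin θ * t
        = Real.pi / 2 - (A + -Real.sin θ * t - θ) by ring, Real.cos_pi_div_two_sub,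
        Real.sin_sub (A + -Real.sin θ * t)]
      ring))
    (fun t => (Real.exp_pos _).le) (by linarith) (by linarith) hv0 hv
  simpa [sub_eq_add_neg] using this

/-- In each variable separately the right side is at least its minimum at the ends, so only the four
corners matter, and there it follows from `rel`, `left` and `right`. Hence `chordGap` decreases as
`w` grows from `0`. -/
lemma IsPhase.sin_le_of_nonneg (h : IsPhase θ α a) {v w : ℝ} (hv0 : 0 ≤ v) (hv : v ≤ α)
    (hw0 : 0 ≤ w) (hw : w ≤ α) :
    Real.sin a ≤ Real.exp (Real.cos θ * v + Real.sin θ * w) *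
      Real.sin (a - Real.sin θ * v + Real.cos θ * w) := by
  have hS := h.sin_θ_pos
  have hC := h.cos_θ_nonneg
  have h1 := h.le_a
  have h2 := h.a_le
  have h3 := h.mul_sin_le
  have h4 := h.mul_cos_le
  have hSv : Real.sin θ * v ≤ α * Real.sin θ := by nlinarith
  have hSv0 : 0 ≤ Real.sin θ * v := by positivity
  have hc0 : 0 ≤ α * Real.cos θ := mul_nonneg h.α_pos.le hC
  have hpi := Real.pi_pos
  have key := min_endpoints_le_of_deriv_cos (L := α) (t := w) (q := Real.cos θ)
    (f := fun t => Real.exp (Real.sin θ * t + Real.cos θ * v) *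
      Real.sin (a - Real.sin θ * v + Real.cos θ * t))
    (E := fun t => Real.exp (Real.sin θ * t + Real.cos θ * v)) (B := a - Real.sin θ * v - θ) hC
    (fun t => (hasDerivAt_exp_mul_sin _ _ _ _ _).congr_deriv (by
      rw [show a - Real.sin θ * v - θ + Real.cos θ * t
        = a - Real.sin θ * v + Real.cos θ * t - θ by ring, Real.cos_sub _ θ]
      ring))
    (fun t => (Real.exp_pos _).le) (by linarith) (by linarith) hw0 hw
  have e0 := exp_mul_sin_ge_min (θ := θ) (α := α) (A := a) (w := 0) hS.le (by linarith)
    (by linarith) hv0 hv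
  have eα := exp_mul_sin_ge_min (θ := θ) (α := α) (A := a + Real.cos θ * α)
    (w := Real.sin θ * α) hS.le (by linarith) (by linarith) hv0 hv
  have c0 : Real.sin a ≤ min (Real.exp 0 * Real.sin a)
      (Real.exp (Real.cos θ * α + 0) * Real.sin (a - Real.sin θ * α)) := by
    refine le_min (by simp) ?_
    rw [← h.rel, add_zero, mul_comm α, mul_comm α]
  have cα : Real.sin a ≤ min (Real.exp (Real.sin θ * α) * Real.sin (a + Real.cos θ * α))
      (Real.exp (Real.cos θ * α + Real.sin θ * α) *
        Real.sin (a + Real.cos θ * α - Real.sin θ * α)) := by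
    refine le_min ?_ ?_
    · have := h.left
      rwa [mul_comm α, mul_comm α] at this
    · rw [Real.exp_add, mul_assoc]
      have hr := h.rel
      rw [← hr, mul_comm α (Real.cos θ)]
      refine mul_le_mul_of_nonneg_left ?_ (Real.exp_pos _).le
      have := h.right
      rwa [show a + Real.cos θ * α - Real.sin θ * α = a - α * Real.sin θ + α * Real.cos θ by ring,
        mul_comm (Real.sin θ) α]
  rw [add_comm (Real.cos θ * v)]
  refine (le_min ?_ ?_).trans key
  · simpa using c0.trans e0
  · refine (cα.trans eα).trans (le_of_eq ?_)
    congr 2 <;> ring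

/-- While the phase `A + w cos θ` is nonnegative, the `w`-derivative is a positive multiple of the
cosine of that phase minus `θ`, an angle in `[-π/2, π/2]`. For a negative phase the left side is
nonpositive. -/
lemma exp_mul_sin_le_of_nonpos {A w : ℝ} (hθ : 0 ≤ θ) (hθ' : θ ≤ Real.pi / 2)
    (hA : 0 ≤ Real.sin A)
    (h1 : A - θ ≤ Real.pi / 2) (hw : w ≤ 0) (h2 : -Real.pi ≤ A + Real.cos θ * w) :
    Real.exp (Real.sin θ * w) * Real.sin (A + Real.cos θ * w) ≤ Real.sin A := by
  have hC := Real.cos_nonneg_of_neg_pi_div_two_le_of_le (by linarith [Real.pi_pos]) hθ'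
  rcases le_total (A + Real.cos θ * w) 0 with h | h
  · exact (mul_nonpos_of_nonneg_of_nonpos (Real.exp_pos _).le
      (Real.sin_nonpos_of_nonpos_of_neg_pi_le h h2)).trans hA
  · have hd : ∀ t, HasDerivAt (fun t => Real.exp (Real.sin θ * t + 0) *
        Real.sin (A + Real.cos θ * t)) (Real.exp (Real.sin θ * t + 0) *
          Real.cos (A + Real.cos θ * t - θ)) t := fun t =>
      (hasDerivAt_exp_mul_sin _ _ _ _ _).congr_deriv (by rw [Real.cos_sub _ θ]; ring)
    have hm : MonotoneOn (fun t => Real.exp (Real.sin θ * t + 0) *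
        Real.sin (A + Real.cos θ * t)) (Set.Icc w 0) := by
      refine monotoneOn_of_deriv_nonneg (convex_Icc w 0) (by fun_prop)
        (fun x _ => (hd x).differentiableAt.differentiableWithinAt) ?_
      intro t ht
      rw [interior_Icc] at ht
      rw [(hd t).deriv]
      refine mul_nonneg (Real.exp_pos _).le (Real.cos_nonneg_of_neg_pi_div_two_le_of_le ?_ ?_)
      · nlinarith [ht.1]
      · nlinarith [ht.2]
    simpa using hm (Set.left_mem_Icc.2 hw) (Set.right_mem_Icc.2 hw) hw

lemma hasDerivAt_slice_vertical (v w : ℝ) :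
    HasDerivAt (fun w => Real.exp (Real.cos θ * v + Real.sin θ * w) *
        Real.cos (a + θ - Real.sin θ * v + Real.cos θ * w) + Real.sin a * w)
      (Real.sin a - Real.exp (Real.cos θ * v + Real.sin θ * w) *
        Real.sin (a - Real.sin θ * v + Real.cos θ * w)) w := by
  have h1 := hasDerivAt_exp_mul_cos (Real.sin θ) (Real.cos θ) (Real.cos θ * v)
    (a + θ - Real.sin θ * v) w
  have h2 := h1.add ((hasDerivAt_id w).const_mul (Real.sin a))
  simp only [add_comm (Real.sin θ * _)] at h2
  refine h2.congr_deriv ?_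
  rw [show a - Real.sin θ * v + Real.cos θ * w
    = a + θ - Real.sin θ * v + Real.cos θ * w - θ by ring,
    Real.sin_sub (a + θ - Real.sin θ * v + Real.cos θ * w)]
  ring

/-- Each `v`-derivative turns the phase by `-θ`, so the second one carries the factor `cos (a - θ +
w cos θ - v sin θ)`, whose angle the hypotheses keep in `[-π/2, π/2]`. -/
lemma convexOn_slice_horizontal {v₁ w : ℝ} (hS : 0 ≤ Real.sin θ)
    (h0 : a - θ + Real.cos θ * w ≤ Real.pi / 2)
    (h1 : -(Real.pi / 2) ≤ a - θ + Real.cos θ * w - Real.sin θ * v₁) :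
    ConvexOn ℝ (Set.Icc 0 v₁) (fun v => Real.exp (Real.cos θ * v + Real.sin θ * w) *
        Real.cos (a + θ - Real.sin θ * v + Real.cos θ * w)) := by
  have hd : ∀ v, HasDerivAt (fun v => Real.exp (Real.cos θ * v + Real.sin θ * w) *
        Real.cos (a + θ - Real.sin θ * v + Real.cos θ * w))
      (Real.exp (Real.cos θ * v + Real.sin θ * w) *
        Real.cos (a - Real.sin θ * v + Real.cos θ * w)) v := by
    intro v
    have := hasDerivAt_exp_mul_cos (Real.cos θ) (-Real.sin θ) (Real.sin θ * w)
      (a + θ + Real.cos θ * w) v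
    convert this using 1
    · ext t; congr 2; ring
    · rw [show a - Real.sin θ * v + Real.cos θ * w
        = a + θ + Real.cos θ * w + -Real.sin θ * v - θ by ring,
        Real.cos_sub (a + θ + Real.cos θ * w + -Real.sin θ * v)]
      ring
  have hd2 : ∀ v, HasDerivAt (fun v => Real.exp (Real.cos θ * v + Real.sin θ * w) *
        Real.cos (a - Real.sin θ * v + Real.cos θ * w))
      (Real.exp (Real.cos θ * v + Real.sin θ * w) *
        Real.cos (a - θ + Real.cos θ * w - Real.sin θ * v)) v := by
    intro v
    have := hasDerivAt_exp_mul_cos (Real.cos θ) (-Real.sin θ) (Real.sin θ * w)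
      (a + Real.cos θ * w) v
    convert this using 1
    · ext t; congr 2; ring
    · rw [show a - θ + Real.cos θ * w - Real.sin θ * v
        = a + Real.cos θ * w + -Real.sin θ * v - θ by ring,
        Real.cos_sub (a + Real.cos θ * w + -Real.sin θ * v)]
      ring
  have e1 := funext fun v => (hd v).deriv
  refine convexOn_of_deriv2_nonneg (convex_Icc _ _) (by fun_prop) (by fun_prop) ?_ ?_
  · rw [e1]; fun_prop
  · intro x hx
    rw [interior_Icc] at hx
    simp only [Function.iterate_succ, Function.iterate_zero, Function.comp, id]
    rw [e1, (hd2 x).deriv]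
    refine mul_nonneg (Real.exp_pos _).le (Real.cos_nonneg_of_neg_pi_div_two_le_of_le ?_ ?_)
    · nlinarith [hx.2]
    · nlinarith [hx.1]

end TwoPointMajorant

section TwoPointMajorant

variable {θ α a : ℝ}

/-- The deviation of `Re (c e^z) + w sin a` from its chord, in the rotated coordinates `v, w`. -/
noncomputable def chordGap (θ α a v w : ℝ) : ℝ :=
  Real.exp (Real.cos θ * v + Real.sin θ * w) *
    Real.cos (a + θ - Real.sin θ * v + Real.cos θ * w) + Real.sin a * w
  - ((1 - v / α) * Real.cos (a + θ)
    + v / α * (Real.exp (Real.cos θ * α) * Real.cos (a + θ - Real.sin θ * α)))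

lemma hasDerivAt_chordGap (v w : ℝ) : HasDerivAt (chordGap θ α a v)
    (Real.sin a - Real.exp (Real.cos θ * v + Real.sin θ * w) *
        Real.sin (a - Real.sin θ * v + Real.cos θ * w)) w :=
  (hasDerivAt_slice_vertical v w).sub_const _

lemma chordGap_zero_zero : chordGap θ α a 0 0 = 0 := by simp [chordGap]

lemma chordGap_self_zero (hα : α ≠ 0) : chordGap θ α a α 0 = 0 := by
  simp [chordGap, div_self hα]

lemma continuous_chordGap : Continuous fun p : ℝ × ℝ => chordGap θ α a p.1 p.2 := by
  unfold chordGap; fun_prop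

lemma convexOn_chordGap {v₁ w : ℝ} (hS : 0 ≤ Real.sin θ)
    (h0 : a - θ + Real.cos θ * w ≤ Real.pi / 2)
    (h1 : -(Real.pi / 2) ≤ a - θ + Real.cos θ * w - Real.sin θ * v₁) :
    ConvexOn ℝ (Set.Icc 0 v₁) (fun v => chordGap θ α a v w) := by
  have h := convexOn_slice_horizontal hS h0 h1
  refine ⟨convex_Icc _ _, fun x hx y hy p q hp hq hpq => ?_⟩
  have := h.2 hx hy hp hq hpq
  simp only [smul_eq_mul, chordGap] at this ⊢
  have hp' : p = 1 - q := by linarith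
  subst hp'
  linear_combination this

lemma chordGap_antitone (h : IsPhase θ α a) {v w : ℝ} (hv0 : 0 ≤ v) (hv : v ≤ α)
    (hw0 : 0 ≤ w) (hw : w ≤ α) : chordGap θ α a v w ≤ chordGap θ α a v 0 := by
  have hm : AntitoneOn (chordGap θ α a v) (Set.Icc 0 α) := by
    refine antitoneOn_of_deriv_nonpos (convex_Icc _ _)
      (fun x _ => (hasDerivAt_chordGap v x).continuousAt.continuousWithinAt)
      (fun x _ => (hasDerivAt_chordGap v x).differentiableAt.differentiableWithinAt) ?_
    intro x hx
    rw [interior_Icc] at hx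
    rw [(hasDerivAt_chordGap v x).deriv]
    linarith [h.sin_le_of_nonneg hv0 hv hx.1.le hx.2.le]
  exact hm ⟨le_rfl, h.α_pos.le⟩ ⟨hw0, hw⟩ hw0

lemma chordGap_edge {v : ℝ} (hedge : ∀ w, w ≤ 0 → -α ≤ w →
      Real.exp (Real.cos θ * v + Real.sin θ * w) *
        Real.sin (a - Real.sin θ * v + Real.cos θ * w) ≤ Real.sin a)
    {w : ℝ} (hw : w ≤ 0) (hw' : -α ≤ w) : chordGap θ α a v w ≤ chordGap θ α a v 0 := by
  have hm : MonotoneOn (chordGap θ α a v) (Set.Icc w 0) := by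
    refine monotoneOn_of_deriv_nonneg (convex_Icc _ _)
      (fun x _ => (hasDerivAt_chordGap v x).continuousAt.continuousWithinAt)
      (fun x _ => (hasDerivAt_chordGap v x).differentiableAt.differentiableWithinAt) ?_
    intro x hx
    rw [interior_Icc] at hx
    rw [(hasDerivAt_chordGap v x).deriv]
    linarith [hedge x hx.2.le (hw'.trans hx.1.le)]
  exact hm ⟨le_rfl, hw⟩ ⟨hw, le_rfl⟩ hw

lemma chordGap_left_nonpos (h : IsPhase θ α a) {w : ℝ} (hw : w ≤ 0) (hw' : -α ≤ w) :
    chordGap θ α a 0 w ≤ 0 := by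
  have hc := h.mul_cos_le
  have hC := h.cos_θ_nonneg
  refine (chordGap_edge (fun w hw hw' => ?_) hw hw').trans_eq chordGap_zero_zero
  have := exp_mul_sin_le_of_nonpos (A := a) (w := w) h.θ_pos.le h.θ_le h.sin_a_pos.le
    (by linarith [h.a_le, h.mul_sin_le]) hw (by nlinarith [h.a_pos, Real.pi_pos])
  simpa using this

lemma chordGap_right_nonpos (h : IsPhase θ α a) {w : ℝ} (hw : w ≤ 0) (hw' : -α ≤ w) :
    chordGap θ α a α w ≤ 0 := by
  have hc := h.mul_cos_le
  have hs := h.mul_sin_le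
  have hC := h.cos_θ_nonneg
  refine (chordGap_edge (fun w hw hw' => ?_) hw hw').trans_eq (chordGap_self_zero h.α_pos.ne')
  have hr := h.rel
  have hsin : 0 ≤ Real.sin (a - α * Real.sin θ) := by
    have := h.sin_a_pos
    rw [← hr] at this
    exact (pos_of_mul_pos_right this (Real.exp_pos _).le).le
  have := exp_mul_sin_le_of_nonpos (A := a - α * Real.sin θ) (w := w) h.θ_pos.le h.θ_le hsin
    (by nlinarith [h.a_le, Real.pi_pos]) hw (by nlinarith [h.a_pos, Real.pi_pos])
  rw [Real.exp_add, mul_assoc, ← hr, mul_comm (Real.sin θ) α, mul_comm (Real.cos θ) α]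
  exact mul_le_mul_of_nonneg_left this (Real.exp_pos _).le

/-- The maximum principle for the lower half of the rectangle. -/
lemma chordGap_nonpos_of_nonpos (h : IsPhase θ α a) {v w : ℝ} (hv0 : 0 ≤ v) (hv : v ≤ α)
    (hw : w ≤ 0) (hw' : -α ≤ w) : chordGap θ α a v w ≤ 0 := by
  have hα := h.α_pos
  have hS := h.sin_θ_pos
  have hC := h.cos_θ_nonneg
  have hs := h.mul_sin_le
  have hc := h.mul_cos_le
  have hpi := Real.pi_pos
  have hle := h.le_a
  have ha := h.a_le
  obtain ⟨⟨v₀, w₀⟩, ⟨⟨hv₀, hv₀'⟩, hw₀, hw₀'⟩, hmax⟩ :=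
    (isCompact_Icc.prod isCompact_Icc).exists_isMaxOn (s := Set.Icc 0 α ×ˢ Set.Icc (-α) 0)
      ⟨(v, w), ⟨hv0, hv⟩, hw', hw⟩ (continuous_chordGap (θ := θ) (α := α) (a := a)).continuousOn
  simp only at hv₀ hv₀' hw₀ hw₀'
  have hmax' : ∀ x y, 0 ≤ x → x ≤ α → -α ≤ y → y ≤ 0 →
      chordGap θ α a x y ≤ chordGap θ α a v₀ w₀ := fun x y h1 h2 h3 h4 =>
    isMaxOn_iff.1 hmax (x, y) ⟨⟨h1, h2⟩, h3, h4⟩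
  refine (hmax' v w hv0 hv hw' hw).trans ?_
  by_contra! hpos
  have hw₀0 : w₀ ≠ 0 → w₀ < 0 := fun hne => lt_of_le_of_ne hw₀' hne
  -- Where the angle `a - θ - v sin θ + w cos θ` is at most `-π/2`, the sine in the `w`-derivative
  -- is nonpositive. The gap then strictly increases with `w`, so a point with `w < 0` cannot be a
  -- maximum.
  have hbot : ∀ x, 0 ≤ x → x ≤ α → a - θ - Real.sin θ * x + Real.cos θ * w₀ ≤ -(Real.pi / 2) →
      w₀ < 0 → chordGap θ α a x w₀ < chordGap θ α a v₀ w₀ := by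
    intro x hx hx' hY hw0
    refine lt_of_le_of_ne (hmax' x w₀ hx hx' hw₀ hw₀') fun heq => ?_
    have hd := hasDerivAt_chordGap (θ := θ) (α := α) (a := a) x w₀
    have hneg : Real.sin (a - Real.sin θ * x + Real.cos θ * w₀) ≤ 0 := by
      refine Real.sin_nonpos_of_nonpos_of_neg_pi_le (by linarith [h.θ_le]) ?_
      have h1 : Real.sin θ * x ≤ Real.sin θ * α := mul_le_mul_of_nonneg_left hx' hS.le
      have h2 : Real.cos θ * (-α) ≤ Real.cos θ * w₀ := mul_le_mul_of_nonneg_left hw₀ hC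
      linarith [h.a_pos]
    have hdpos : 0 < Real.sin a - Real.exp (Real.cos θ * x + Real.sin θ * w₀) *
        Real.sin (a - Real.sin θ * x + Real.cos θ * w₀) := by
      have := mul_nonpos_of_nonneg_of_nonpos
        (Real.exp_pos (Real.cos θ * x + Real.sin θ * w₀)).le hneg
      linarith [h.sin_a_pos]
    have hev := (hasDerivAt_iff_tendsto_slope.1 hd).eventually (lt_mem_nhds hdpos)
    have hev2 : ∀ᶠ y in nhdsWithin w₀ (Set.Ioi w₀), 0 < slope (chordGap θ α a x) w₀ y :=
      hev.filter_mono (nhdsWithin_mono _ fun y (hy : w₀ < y) => hy.ne')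
    obtain ⟨y, hy1, hy2⟩ := (hev2.and (Ioo_mem_nhdsGT hw0)).exists
    have := hmax' x y hx hx' (hw₀.trans hy2.1.le) hy2.2.le
    rw [slope_def_field] at hy1
    have h3 := (div_pos_iff_of_pos_right (sub_pos.2 hy2.1)).1 hy1
    linarith
  have hcw : Real.cos θ * w₀ ≤ 0 := mul_nonpos_of_nonneg_of_nonpos hC hw₀'
  have key : ∀ v₁, v₀ ≤ v₁ → v₁ ≤ α →
      -(Real.pi / 2) ≤ a - θ + Real.cos θ * w₀ - Real.sin θ * v₁ →
      chordGap θ α a v₀ w₀ ≤ chordGap θ α a v₁ w₀ := by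
    -- Up to `v₁` the slice is convex, so its value is at most that at one of the ends; the end `v =
    -- 0` is excluded because the gap there is nonpositive.
    intro v₁ h1 h2 h3
    have hconv := convexOn_chordGap (α := α) hS.le (w := w₀) (v₁ := v₁) (by linarith) h3
    have := hconv.le_max_of_mem_Icc ⟨le_rfl, hv₀.trans h1⟩ ⟨hv₀.trans h1, le_rfl⟩ ⟨hv₀, h1⟩
    exact (le_max_iff.1 this).resolve_left
      (not_le.2 ((chordGap_left_nonpos h hw₀' hw₀).trans_lt hpos))
  have hend : a - θ + Real.cos θ * w₀ - Real.sin θ * α < -(Real.pi / 2) := by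
    by_contra! hcon
    exact absurd ((key α hv₀' le_rfl hcon).trans (chordGap_right_nonpos h hw₀' hw₀)) (not_le.2 hpos)
  have hw0 : w₀ < 0 := by
    refine hw₀0 fun h0 => ?_
    rw [h0] at hend
    linarith
  have hY : -(Real.pi / 2) < a - θ - Real.sin θ * v₀ + Real.cos θ * w₀ := by
    by_contra! hcon
    exact (hbot v₀ hv₀ hv₀' hcon hw0).false
  -- At this point of the slice the angle equals `-π/2`, so `key` and `hbot` both apply and
  -- contradict each other.
  set v₁ := (a - θ + Real.cos θ * w₀ + Real.pi / 2) / Real.sin θ with hv₁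
  have hSv₁ : Real.sin θ * v₁ = a - θ + Real.cos θ * w₀ + Real.pi / 2 := by
    rw [hv₁]; field_simp
  have h1 : v₀ ≤ v₁ := by
    by_contra! hcon; nlinarith
  have h2 : v₁ ≤ α := by
    by_contra! hcon; nlinarith
  have h3 := key v₁ h1 h2 (by linarith)
  exact absurd h3 (not_le.2 (hbot v₁ (hv₀.trans h1) h2 (by linarith) hw0))

/-- This is the affine majorant: `Re (c e^z)` lies below a real affine function of `z`, with
equality at `(0, 0)` and `(α, 0)`. -/
theorem chordGap_nonpos (h : IsPhase θ α a) {v w : ℝ} (hv0 : 0 ≤ v) (hv : v ≤ α)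
    (hw : |w| ≤ α) : chordGap θ α a v w ≤ 0 := by
  rw [abs_le] at hw
  rcases le_total w 0 with h0 | h0
  · exact chordGap_nonpos_of_nonpos h hv0 hv h0 hw.1
  · exact (chordGap_antitone h hv0 hv h0 hw.2).trans
      (chordGap_nonpos_of_nonpos h hv0 hv le_rfl (by linarith [h.α_pos]))

end TwoPointMajorant

/-! ### Exponential moments of two-point laws -/

/-- The moment generating function at `1` of the centred two-point law with atoms `-P r` and
`(1 - P) r`, of masses `1 - P` and `P`. -/
noncomputable def twoPointMGF (P r : ℝ) : ℝ := Real.exp (-P * r) * (1 + P * (Real.exp r - 1))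

lemma twoPointMGF_eq (P r : ℝ) :
    twoPointMGF P r = (1 - P) * Real.exp (-P * r) + P * Real.exp ((1 - P) * r) := by
  rw [twoPointMGF, show (1 - P) * r = -P * r + r by ring, Real.exp_add]; ring

lemma twoPoint_moment_nonneg {P r : ℝ} (hP0 : 0 ≤ P) (hP : P ≤ 1 / 2) (hr : 0 ≤ r) (k : ℕ) :
    0 ≤ (1 - P) * (-P * r) ^ k + P * ((1 - P) * r) ^ k := by
  cases k with
  | zero => simp
  | succ k =>
    have e : (1 - P) * (-P * r) ^ (k + 1) + P * ((1 - P) * r) ^ (k + 1)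
        = P * (1 - P) * r ^ (k + 1) * ((1 - P) ^ k - (-P) ^ k) := by
      rw [mul_pow, mul_pow]; ring
    rw [e]
    have h1 : (-P) ^ k ≤ (1 - P) ^ k := by
      calc (-P) ^ k ≤ |(-P) ^ k| := le_abs_self _
        _ = P ^ k := by rw [abs_pow, abs_neg, abs_of_nonneg hP0]
        _ ≤ (1 - P) ^ k := pow_le_pow_left₀ hP0 (by linarith) k
    have : 0 ≤ 1 - P := by linarith
    have := sub_nonneg.2 h1
    positivity

/-- With at least half of the mass on the negative atom, all moments are nonnegative, so the power
series in `η` is dominated term by term by its value at `η = 1`. -/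
lemma norm_twoPoint_sub_one_le_of_le_half {P r : ℝ} (hP0 : 0 ≤ P) (hP : P ≤ 1 / 2) (hr : 0 ≤ r)
    {η : ℂ} (hη : ‖η‖ = 1) :
    ‖(1 - P) * Complex.exp (η * (-P * r : ℝ)) + P * Complex.exp (η * ((1 - P) * r : ℝ)) - 1‖ ≤
      twoPointMGF P r - 1 := by
  set m : ℕ → ℝ := fun k => (1 - P) * (-P * r) ^ k + P * ((1 - P) * r) ^ k with hm
  have hC : HasSum (fun k : ℕ => η ^ k * (m k : ℂ) / k.factorial)
      ((1 - P) * Complex.exp (η * (-P * r : ℝ)) + P * Complex.exp (η * ((1 - P) * r : ℝ))) := by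
    have h1 := (NormedSpace.expSeries_div_hasSum_exp (η * ((-P * r : ℝ) : ℂ))).mul_left
      ((1 - P : ℝ) : ℂ)
    have h2 := (NormedSpace.expSeries_div_hasSum_exp (η * (((1 - P) * r : ℝ) : ℂ))).mul_left
      (P : ℂ)
    have h3 := h1.add h2
    rw [← Complex.exp_eq_exp_ℂ] at h3
    convert! h3 using 1
    · funext k; rw [hm]; push_cast; rw [mul_pow η, mul_pow η]; ring
    · push_cast; ring
  have hR : HasSum (fun k : ℕ => m k / k.factorial) (twoPointMGF P r) := by
    have h1 := (NormedSpace.expSeries_div_hasSum_exp (-P * r)).mul_left (1 - P)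
    have h2 := (NormedSpace.expSeries_div_hasSum_exp ((1 - P) * r)).mul_left P
    have h3 := h1.add h2
    rw [← Real.exp_eq_exp_ℝ] at h3
    rw [twoPointMGF_eq]
    convert! h3 using 1
    funext k; rw [hm]; ring
  have hC' := (hasSum_nat_add_iff' 1).2 hC
  have hR' := (hasSum_nat_add_iff' 1).2 hR
  have hm0 : m 0 = 1 := by simp [hm]
  simp only [Finset.range_one, Finset.sum_singleton, pow_zero, hm0, Nat.factorial_zero,
    Nat.cast_one, div_one, Complex.ofReal_one, mul_one] at hC' hR'
  refine hC'.norm_le_of_bounded hR' fun k => ?_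
  rw [norm_div, norm_mul, norm_pow, hη, one_pow, one_mul, Complex.norm_real, Complex.norm_natCast,
    Real.norm_of_nonneg (twoPoint_moment_nonneg hP0 hP hr _)]

/-- Among two-point laws with real direction `η`, the exponential moment deviates most from `1`
for `η = ± 1`. -/
theorem norm_twoPoint_sub_one_le {P r : ℝ} (hP0 : 0 ≤ P) (hP1 : P ≤ 1) (hr : 0 ≤ r)
    {η : ℂ} (hη : ‖η‖ = 1) : ∃ Q : ℝ, 0 ≤ Q ∧ Q ≤ 1 ∧
    ‖(1 - P) * Complex.exp (η * (-P * r : ℝ)) + P * Complex.exp (η * ((1 - P) * r : ℝ)) - 1‖ ≤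
      twoPointMGF Q r - 1 := by
  rcases le_total P (1 / 2) with h | h
  · exact ⟨P, hP0, hP1, norm_twoPoint_sub_one_le_of_le_half hP0 h hr hη⟩
  -- Reflecting the law exchanges `P` with `1 - P` and `η` with `-η`.
  · refine ⟨1 - P, by linarith, by linarith, ?_⟩
    have := norm_twoPoint_sub_one_le_of_le_half (P := 1 - P) (by linarith) (by linarith) hr
      (η := -η) (by rwa [norm_neg])
    convert this using 2
    push_cast
    ring_nf

lemma chordGap_neg (θ α a v w : ℝ) : chordGap (-θ) α (-a) v w = chordGap θ α a v (-w) := by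
  simp only [chordGap, Real.cos_neg, Real.sin_neg]
  rw [← Real.cos_neg (-a + -θ - _ * v + _), ← Real.cos_neg (-a + -θ),
    ← Real.cos_neg (-a + -θ - _)]
  ring_nf

lemma chordGap_zero_le {α v w : ℝ} (hα : 0 < α) (hv0 : 0 ≤ v) (hv : v ≤ α) :
    chordGap 0 α 0 v w ≤ 0 := by
  simp only [chordGap, Real.cos_zero, Real.sin_zero]
  have h := convexOn_exp.2 (Set.mem_univ (0 : ℝ)) (Set.mem_univ α)
    (sub_nonneg.2 ((div_le_one hα).2 hv)) (div_nonneg hv0 hα.le) (by ring)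
  simp only [smul_eq_mul, mul_zero, zero_add, Real.exp_zero, div_mul_cancel₀ v hα.ne'] at h
  have h2 : Real.exp v * Real.cos w ≤ Real.exp v :=
    mul_le_of_le_one_right (Real.exp_pos v).le (Real.cos_le_one w)
  simp
  linarith

/-- `IsPhase` covers `θ > 0`. Complex conjugation gives `θ < 0`, and at `θ = 0` the majorant is the
chord of the convex function `exp`. -/
lemma chordGap_arg_nonpos {θ α v w : ℝ} (hθ : |θ| ≤ Real.pi / 2) (hα0 : 0 < α) (hα : α ≤ 1.57)
    (hv0 : 0 ≤ v) (hv : v ≤ α) (hw : |w| ≤ α) :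
    chordGap θ α (Complex.exp (α * Complex.exp (θ * Complex.I)) - 1).arg v w ≤ 0 := by
  rw [abs_le] at hθ
  rcases lt_trichotomy θ 0 with h | rfl | h
  · have hp := isPhase_arg (θ := -θ) (by linarith) (by linarith) hα0 hα
    have := chordGap_nonpos hp hv0 hv (w := -w) (by rwa [abs_neg])
    rw [← chordGap_neg, neg_neg] at this
    convert this using 2
    have hne := hp.a_lt.ne
    rw [show Complex.exp (α * Complex.exp ((-θ : ℝ) * Complex.I)) - 1
      = (starRingEnd ℂ) (Complex.exp (α * Complex.exp (θ * Complex.I)) - 1) by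
        simp [← Complex.exp_conj]] at hne ⊢
    rw [Complex.arg_conj] at hne ⊢
    split_ifs with h1
    · simp [h1] at hne
    · ring
  · have : (Complex.exp (α * Complex.exp ((0 : ℝ) * Complex.I)) - 1).arg = 0 := by
      rw [Complex.ofReal_zero, zero_mul, Complex.exp_zero, mul_one, ← Complex.ofReal_exp,
        ← Complex.ofReal_one, ← Complex.ofReal_sub]
      exact Complex.arg_ofReal_of_nonneg (by linarith [Real.add_one_le_exp α])
    rw [this]
    exact chordGap_zero_le hα0 hv0 hv
  · exact chordGap_nonpos (isPhase_arg h hθ.2 hα0 hα) hv0 hv hw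

/-! ### Complex Hoeffding lemma for small diameter -/

section ComplexHoeffding

variable {Ω : Type*} [MeasurableSpace Ω] {μ : Measure Ω} [IsProbabilityMeasure μ] {Z : Ω → ℂ}
  {α : ℝ}

lemma norm_le_of_integral_eq_zero (h0 : ∫ ω, Z ω ∂μ = 0) (hd : ∀ ω ω', ‖Z ω - Z ω'‖ ≤ α)
    (hi : Integrable Z μ) (ω : Ω) : ‖Z ω‖ ≤ α := by
  have h : Z ω = ∫ ω', (Z ω - Z ω') ∂μ := by
    rw [integral_sub (integrable_const _) hi, h0, integral_const]; simp
  rw [h]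
  simpa using norm_integral_le_of_norm_le_const (μ := μ) (Filter.Eventually.of_forall (hd ω))

lemma integrable_of_diam_le (hZ : Measurable Z) (hd : ∀ ω ω', ‖Z ω - Z ω'‖ ≤ α) :
    Integrable Z μ := by
  obtain ⟨ω₀⟩ := nonempty_of_isProbabilityMeasure μ
  refine Integrable.of_bound hZ.aestronglyMeasurable (‖Z ω₀‖ + α)
    (Filter.Eventually.of_forall fun ω => ?_)
  calc ‖Z ω‖ = ‖Z ω₀ + (Z ω - Z ω₀)‖ := by ring_nf
    _ ≤ _ := (norm_add_le _ _).trans (by linarith [hd ω ω₀])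

lemma integrable_exp_of_norm_le (hZ : Measurable Z) {C : ℝ} (hC : ∀ ω, ‖Z ω‖ ≤ C) :
    Integrable (fun ω => Complex.exp (Z ω)) μ := by
  refine Integrable.of_bound (Complex.continuous_exp.measurable.comp hZ).aestronglyMeasurable
    (Real.exp C) (Filter.Eventually.of_forall fun ω => ?_)
  rw [Complex.norm_exp]
  exact Real.exp_le_exp.2 ((Complex.re_le_norm _).trans (hC ω))

lemma rotated_re (θ : ℝ) (z : ℂ) :
    (Complex.exp (θ * Complex.I) * z).re = Real.cos θ * z.re - Real.sin θ * z.im := by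
  rw [Complex.mul_re, Complex.exp_ofReal_mul_I_re, Complex.exp_ofReal_mul_I_im]

lemma rotated_im (θ : ℝ) (z : ℂ) :
    (Complex.exp (θ * Complex.I) * z).im = Real.cos θ * z.im + Real.sin θ * z.re := by
  rw [Complex.mul_im, Complex.exp_ofReal_mul_I_re, Complex.exp_ofReal_mul_I_im]

lemma re_exp_mul_I_mul_exp (t : ℝ) (z : ℂ) :
    (Complex.exp (t * Complex.I) * Complex.exp z).re = Real.exp z.re * Real.cos (t + z.im) := by
  rw [← Complex.exp_add, Complex.exp_re]
  simp

lemma integral_affine_eq {x y : Ω → ℝ} (hx : Integrable x μ) (hy : Integrable y μ)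
    (hx0 : ∫ ω, x ω ∂μ = 0) (hy0 : ∫ ω, y ω ∂μ = 0) (A B C : ℝ) :
    ∫ ω, (A + x ω * B - C * y ω) ∂μ = A := by
  have h1 : Integrable (fun ω => A + x ω * B) μ := (integrable_const A).add (hx.mul_const B)
  rw [integral_sub h1 (hy.const_mul C), integral_add (integrable_const A) (hx.mul_const B),
    integral_mul_const, integral_const_mul, hx0, hy0]
  simp

/-- The two-point comparison in the direction `θ`. -/
lemma re_mul_integral_exp_le {θ p a : ℝ} (hα : 0 < α) (hZ : Measurable Z)
    (h0 : ∫ ω, Z ω ∂μ = 0) (hb : ∀ ω, ‖Z ω‖ ≤ α)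
    (hp : ∀ ω, p ≤ (Complex.exp (θ * Complex.I) * Z ω).re)
    (hp' : ∀ ω, (Complex.exp (θ * Complex.I) * Z ω).re ≤ p + α)
    (hgap : ∀ v w, 0 ≤ v → v ≤ α → |w| ≤ α → chordGap θ α a v w ≤ 0) :
    (Complex.exp ((a + θ + p * Real.sin θ : ℝ) * Complex.I) * ∫ ω, Complex.exp (Z ω) ∂μ).re ≤
      (Complex.exp ((a + θ + p * Real.sin θ : ℝ) * Complex.I) *
        ((1 - (-p / α : ℝ)) * Complex.exp (Complex.exp (-θ * Complex.I) * (-(-p / α) * α : ℝ)) +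
          (-p / α : ℝ) * Complex.exp (Complex.exp (-θ * Complex.I) *
            ((1 - -p / α) * α : ℝ)))).re := by
  have hi : Integrable Z μ := Integrable.of_bound hZ.aestronglyMeasurable α
    (Filter.Eventually.of_forall hb)
  have hie := integrable_exp_of_norm_le (μ := μ) hZ hb
  set c := Complex.exp ((a + θ + p * Real.sin θ : ℝ) * Complex.I) with hc
  set X : Ω → ℂ := fun ω => Complex.exp (θ * Complex.I) * Z ω with hX
  have hXi : Integrable X μ := hi.const_mul _
  have hX0 : ∫ ω, X ω ∂μ = 0 := by rw [hX, integral_const_mul, h0, mul_zero]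
  have hre0 : ∫ ω, (X ω).re ∂μ = 0 := by
    have := integral_re hXi
    simp only [RCLike.re_eq_complex_re] at this
    rw [this, hX0, Complex.zero_re]
  have him0 : ∫ ω, (X ω).im ∂μ = 0 := by
    have := integral_im hXi
    simp only [RCLike.im_eq_complex_im] at this
    rw [this, hX0, Complex.zero_im]
  have hrei : Integrable (fun ω => (X ω).re) μ := hXi.re
  have himi : Integrable (fun ω => (X ω).im) μ := hXi.im
  set G₀ := Real.cos (a + θ)
  set G₁ := Real.exp (Real.cos θ * α) * Real.cos (a + θ - Real.sin θ * α)
  -- This is `chordGap ≤ 0` at `v = Re X - p`, `w = Im X`. The right side is affine in `X`, so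
  -- integration leaves only its constant term, which is the value for the two-point law with `Re X`
  -- at `p` and `p + α`.
  have hpt : ∀ ω, (c * Complex.exp (Z ω)).re ≤ Real.exp (Real.cos θ * p) *
      ((1 + p / α) * G₀ - p / α * G₁ + (X ω).re * ((G₁ - G₀) / α) - Real.sin a * (X ω).im) := by
    intro ω
    have hw : |(X ω).im| ≤ α := by
      refine (Complex.abs_im_le_norm _).trans ?_
      rw [hX, norm_mul, Complex.norm_exp_ofReal_mul_I, one_mul]; exact hb ω
    have h := hgap ((X ω).re - p) (X ω).im (by linarith [hp ω]) (by linarith [hp' ω]) hw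
    have hzre : (Z ω).re = Real.cos θ * (X ω).re + Real.sin θ * (X ω).im := by
      simp only [hX, rotated_re, rotated_im]
      linear_combination -(Z ω).re * Real.sin_sq_add_cos_sq θ
    have hzim : (Z ω).im = Real.cos θ * (X ω).im - Real.sin θ * (X ω).re := by
      simp only [hX, rotated_re, rotated_im]
      linear_combination -(Z ω).im * Real.sin_sq_add_cos_sq θ
    have e1 : (c * Complex.exp (Z ω)).re = Real.exp (Real.cos θ * p) *
        (Real.exp (Real.cos θ * ((X ω).re - p) + Real.sin θ * (X ω).im) *
          Real.cos (a + θ - Real.sin θ * ((X ω).re - p) + Real.cos θ * (X ω).im)) := by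
      rw [hc, re_exp_mul_I_mul_exp, hzre, hzim, ← mul_assoc, ← Real.exp_add]
      congr 2 <;> ring
    rw [e1]
    refine mul_le_mul_of_nonneg_left ?_ (Real.exp_pos _).le
    rw [chordGap] at h
    have e2 : (1 + p / α) * G₀ - p / α * G₁ + (X ω).re * ((G₁ - G₀) / α)
        = (1 - ((X ω).re - p) / α) * G₀ + ((X ω).re - p) / α * G₁ := by
      field_simp; ring
    linarith
  have hint : ∫ ω, (c * Complex.exp (Z ω)).re ∂μ = (c * ∫ ω, Complex.exp (Z ω) ∂μ).re := by
    have := integral_re (hie.const_mul c)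
    simp only [RCLike.re_eq_complex_re] at this
    rw [this, integral_const_mul]
  rw [← hint]
  refine (integral_mono (hie.const_mul c).re ?_ hpt).trans (le_of_eq ?_)
  · exact (((integrable_const _).add (hrei.mul_const _)).sub (himi.const_mul _)).const_mul _
  rw [integral_const_mul, integral_affine_eq hrei himi hre0 him0]
  have hη : ∀ x : ℝ, (Complex.exp (-θ * Complex.I) * (x : ℂ)) =
      ⟨Real.cos θ * x, -(Real.sin θ * x)⟩ := by
    intro x
    have := rotated_re (-θ) x
    have h2 := rotated_im (-θ) x
    push_cast at this h2
    apply Complex.ext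
    · rw [this]; simp
    · rw [h2]; simp
  rw [mul_add, mul_left_comm c (1 - ((-p / α : ℝ) : ℂ)), mul_left_comm c ((-p / α : ℝ) : ℂ), hη, hη, Complex.add_re,
    show (1 - ((-p / α : ℝ) : ℂ)) = ((1 - -p / α : ℝ) : ℂ) by push_cast; ring,
    Complex.re_ofReal_mul, Complex.re_ofReal_mul, hc, re_exp_mul_I_mul_exp, re_exp_mul_I_mul_exp]
  have e3 : -(-p / α) * α = p := by field_simp
  have e4 : (1 - -p / α) * α = p + α := by field_simp; ring
  simp only [e3, e4, G₀, G₁]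
  rw [show a + θ + p * Real.sin θ + -(Real.sin θ * p) = a + θ by ring,
    show a + θ + p * Real.sin θ + -(Real.sin θ * (p + α)) = a + θ - Real.sin θ * α by ring,
    mul_add (Real.cos θ), Real.exp_add]
  ring

end ComplexHoeffding

section LowerSupport

variable {Ω : Type*} {Z : Ω → ℂ} {α : ℝ}

/-- The lower support function of the range of `Z` in the direction `e^{-iθ}`. -/
noncomputable def lowerSupport (Z : Ω → ℂ) (θ : ℝ) : ℝ :=
  ⨅ ω, (Complex.exp (θ * Complex.I) * Z ω).re

lemma bddBelow_rotated (hb : ∀ ω, ‖Z ω‖ ≤ α) (θ : ℝ) :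
    BddBelow (Set.range fun ω => (Complex.exp (θ * Complex.I) * Z ω).re) := by
  refine ⟨-α, ?_⟩
  rintro _ ⟨ω, rfl⟩
  have := Complex.abs_re_le_norm (Complex.exp (θ * Complex.I) * Z ω)
  rw [norm_mul, Complex.norm_exp_ofReal_mul_I, one_mul] at this
  exact (abs_le.1 (this.trans (hb ω))).1

lemma lowerSupport_le (hb : ∀ ω, ‖Z ω‖ ≤ α) (θ : ℝ) (ω : Ω) :
    lowerSupport Z θ ≤ (Complex.exp (θ * Complex.I) * Z ω).re :=
  ciInf_le (bddBelow_rotated hb θ) ω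

lemma le_lowerSupport_add [Nonempty Ω] (hd : ∀ ω ω', ‖Z ω - Z ω'‖ ≤ α) (θ : ℝ) (ω : Ω) :
    (Complex.exp (θ * Complex.I) * Z ω).re ≤ lowerSupport Z θ + α := by
  rw [← sub_le_iff_le_add]
  refine le_ciInf fun ω' => ?_
  have := (Complex.re_le_norm (Complex.exp (θ * Complex.I) * (Z ω - Z ω'))).trans
    ((by rw [norm_mul, Complex.norm_exp_ofReal_mul_I, one_mul] : _ = ‖Z ω - Z ω'‖).trans_le
      (hd ω ω'))
  rw [mul_sub, Complex.sub_re] at this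
  linarith

lemma continuous_lowerSupport [Nonempty Ω] (hb : ∀ ω, ‖Z ω‖ ≤ α) :
    Continuous (lowerSupport Z) := by
  have hα : 0 ≤ α := (norm_nonneg _).trans (hb (Classical.arbitrary Ω))
  refine (LipschitzWith.of_le_add_mul (2 * α.toNNReal) fun x y => ?_).continuous
  rw [← sub_le_iff_le_add]
  refine le_ciInf fun ω => ?_
  have h1 := lowerSupport_le hb x ω
  rw [rotated_re] at h1 ⊢
  have h2 := Real.abs_cos_sub_cos_le x y
  have h3 := Real.abs_sin_sub_sin_le x y
  have h4 : (Real.cos x - Real.cos y) * (Z ω).re ≤ |x - y| * α := by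
    refine (le_abs_self _).trans ?_
    rw [abs_mul]
    exact mul_le_mul h2 ((Complex.abs_re_le_norm _).trans (hb ω)) (abs_nonneg _) (abs_nonneg _)
  have h5 : -((Real.sin x - Real.sin y) * (Z ω).im) ≤ |x - y| * α := by
    refine (neg_le_abs _).trans ?_
    rw [abs_mul]
    exact mul_le_mul h3 ((Complex.abs_im_le_norm _).trans (hb ω)) (abs_nonneg _) (abs_nonneg _)
  rw [Real.dist_eq]
  push_cast
  rw [Real.coe_toNNReal α hα]
  linarith

/-- The phase of the functional for which the two-point comparison holds in the direction `θ`. -/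
noncomputable def directionPhase (Z : Ω → ℂ) (α θ : ℝ) : ℝ :=
  (Complex.exp (α * Complex.exp (θ * Complex.I)) - 1).arg + θ + lowerSupport Z θ * Real.sin θ

lemma continuousOn_directionPhase [Nonempty Ω] (hb : ∀ ω, ‖Z ω‖ ≤ α) (hα0 : 0 < α)
    (hα : α ≤ 1.57) :
    ContinuousOn (directionPhase Z α) (Set.Icc (-(Real.pi / 2)) (Real.pi / 2)) := by
  have hs := continuous_lowerSupport hb
  unfold directionPhase
  refine ContinuousOn.add (ContinuousOn.add ?_ continuousOn_id) (by fun_prop)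
  intro θ hθ
  have hc : ContinuousAt (fun θ : ℝ => Complex.exp (α * Complex.exp (θ * Complex.I)) - 1) θ := by
    fun_prop
  refine ContinuousAt.continuousWithinAt (ContinuousAt.comp (g := Complex.arg) ?_ hc)
  refine Complex.continuousAt_arg (Complex.mem_slitPlane_iff.2 ?_)
  have hz : (α * Complex.exp (θ * Complex.I) : ℂ) = ⟨α * Real.cos θ, α * Real.sin θ⟩ := by
    rw [Complex.exp_mul_I]
    apply Complex.ext <;> simp [Complex.cos_ofReal_re, Complex.sin_ofReal_re]
  rw [hz, Complex.sub_re, Complex.sub_im, Complex.exp_re, Complex.exp_im]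
  simp only [Complex.one_re, Complex.one_im, sub_zero]
  rcases eq_or_ne θ 0 with rfl | hne
  · left
    simp [hα0]
  · right
    refine mul_ne_zero (Real.exp_pos _).ne' ?_
    have hpi : (1.57 : ℝ) < Real.pi := by linarith [Real.pi_gt_three]
    have hS : Real.sin θ ≠ 0 := fun h => hne
      ((Real.sin_eq_zero_iff_of_lt_of_lt (by linarith [hθ.1, Real.pi_pos])
        (by linarith [hθ.2, Real.pi_pos])).1 h)
    have h1 := abs_le.1 (Real.abs_sin_le_one θ)
    intro h
    have := (Real.sin_eq_zero_iff_of_lt_of_lt (by nlinarith) (by nlinarith)).1 h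
    exact (mul_ne_zero hα0.ne' hS) this

/-- At `θ = ±π/2` the argument is `±(π/2 + α/2)`, so the end values differ by `2π + α` plus the two
lower supports. These add up to minus the width of the imaginary part, hence to at least `-α`. -/
lemma directionPhase_sub_ge [Nonempty Ω]
    (hd : ∀ ω ω', ‖Z ω - Z ω'‖ ≤ α) (hα0 : 0 < α) (hα : α ≤ 1.57) :
    directionPhase Z α (-(Real.pi / 2)) + 2 * Real.pi ≤ directionPhase Z α (Real.pi / 2) := by
  have hpi := Real.pi_pos
  have hp := isPhase_arg (θ := Real.pi / 2) (by linarith) le_rfl hα0 hα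
  unfold directionPhase
  set a := (Complex.exp (α * Complex.exp ((Real.pi / 2 : ℝ) * Complex.I)) - 1).arg with ha
  have ha' : (Complex.exp (α * Complex.exp ((-(Real.pi / 2) : ℝ) * Complex.I)) - 1).arg = -a := by
    rw [show Complex.exp (α * Complex.exp ((-(Real.pi / 2) : ℝ) * Complex.I)) - 1
      = (starRingEnd ℂ) (Complex.exp (α * Complex.exp ((Real.pi / 2 : ℝ) * Complex.I)) - 1) by
        rw [map_sub, ← Complex.exp_conj, map_mul, ← Complex.exp_conj, map_mul, Complex.conj_ofReal,
          Complex.conj_ofReal, Complex.conj_I, map_one]; push_cast; ring_nf]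
    rw [Complex.arg_conj, if_neg hp.a_lt.ne]
  have hhalf : a = Real.pi / 2 + α / 2 := by
    have h1 := hp.rel
    rw [Real.cos_pi_div_two, Real.sin_pi_div_two, mul_zero, Real.exp_zero, one_mul, mul_one] at h1
    have h2 := hp.le_a
    have h3 := hp.a_le
    rw [Real.sin_pi_div_two, mul_one] at h3
    have h4 : Real.cos (a - α / 2) = 0 := by
      have e1 : Real.sin a = Real.sin (a - α / 2) * Real.cos (α / 2)
          + Real.cos (a - α / 2) * Real.sin (α / 2) := by
        rw [← Real.sin_add]; congr 1; ring
      have e2 : Real.sin (a - α) = Real.sin (a - α / 2) * Real.cos (α / 2)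
          - Real.cos (a - α / 2) * Real.sin (α / 2) := by
        rw [← Real.sin_sub]; congr 1; ring
      have hs : Real.sin (α / 2) ≠ 0 :=
        (Real.sin_pos_of_pos_of_lt_pi (by positivity) (by linarith [hp.α_le])).ne'
      have : Real.cos (a - α / 2) * Real.sin (α / 2) = 0 := by linarith
      exact (mul_eq_zero.1 this).resolve_right hs
    have h5 := Real.arccos_cos (x := a - α / 2) (by linarith [hp.α_le]) (by linarith [hp.α_le])
    rw [h4, Real.arccos_zero] at h5
    linarith
  have hsum : -α ≤ lowerSupport Z (Real.pi / 2) + lowerSupport Z (-(Real.pi / 2)) := by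
    rw [← sub_le_iff_le_add]
    refine le_ciInf fun ω => ?_
    rw [sub_le_iff_le_add, ← sub_le_iff_le_add']
    refine le_ciInf fun ω' => ?_
    rw [rotated_re, rotated_re]
    simp only [Real.cos_neg, Real.cos_pi_div_two, Real.sin_neg, Real.sin_pi_div_two]
    have := (Complex.abs_im_le_norm (Z ω - Z ω')).trans (hd ω ω')
    rw [Complex.sub_im] at this
    linarith [(abs_le.1 this).2]
  rw [ha', hhalf, Real.sin_neg, Real.sin_pi_div_two]
  linarith

end LowerSupport

section ComplexHoeffding

variable {Ω : Type*} [MeasurableSpace Ω] {μ : Measure Ω} [IsProbabilityMeasure μ] {Z : Ω → ℂ}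
  {α : ℝ}

/-- The complex Hoeffding bound for small diameter, with the sharp two-point function. -/
theorem norm_integral_exp_sub_one_le_twoPointMGF (hZ : Measurable Z) (h0 : ∫ ω, Z ω ∂μ = 0)
    (hd : ∀ ω ω', ‖Z ω - Z ω'‖ ≤ α) (hα0 : 0 < α) (hα : α ≤ 1.57) :
    ∃ Q : ℝ, 0 ≤ Q ∧ Q ≤ 1 ∧ ‖∫ ω, Complex.exp (Z ω) ∂μ - 1‖ ≤ twoPointMGF Q α - 1 := by
  have : Nonempty Ω := nonempty_of_isProbabilityMeasure μ
  have hi := integrable_of_diam_le (μ := μ) hZ hd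
  have hb := norm_le_of_integral_eq_zero h0 hd hi
  set ζ := ∫ ω, Complex.exp (Z ω) ∂μ - 1 with hζ
  have hIcc : -(Real.pi / 2) ≤ Real.pi / 2 := by linarith [Real.pi_pos]
  -- Since the continuous phase covers a full turn, some direction `θ` cancels the argument of `ζ`.
  obtain ⟨θ, hθ, hψ⟩ : ∃ θ ∈ Set.Icc (-(Real.pi / 2)) (Real.pi / 2),
      directionPhase Z α θ =
        toIcoMod Real.two_pi_pos (directionPhase Z α (-(Real.pi / 2))) (-ζ.arg) := by
    have hmem := toIcoMod_mem_Ico Real.two_pi_pos (directionPhase Z α (-(Real.pi / 2))) (-ζ.arg)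
    exact intermediate_value_Icc hIcc (continuousOn_directionPhase hb hα0 hα)
      ⟨hmem.1, hmem.2.le.trans (directionPhase_sub_ge hd hα0 hα)⟩
  set c := Complex.exp (directionPhase Z α θ * Complex.I) with hc
  have hc' : c = Complex.exp (-ζ.arg * Complex.I) := by
    rw [hc, hψ, toIcoMod, Complex.exp_eq_exp_iff_exists_int]
    refine ⟨-toIcoDiv Real.two_pi_pos (directionPhase Z α (-(Real.pi / 2))) (-ζ.arg), ?_⟩
    push_cast
    rw [zsmul_eq_mul]
    ring
  have hcζ : c * ζ = ‖ζ‖ := by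
    conv_lhs => rw [← Complex.norm_mul_exp_arg_mul_I ζ]
    rw [hc', mul_left_comm, ← Complex.exp_add]
    simp
  have hcn : ‖c‖ = 1 := Complex.norm_exp_ofReal_mul_I _
  set p := lowerSupport Z θ with hp
  have hplow : ∀ ω, p ≤ (Complex.exp (θ * Complex.I) * Z ω).re := lowerSupport_le hb θ
  have hpup : ∀ ω, (Complex.exp (θ * Complex.I) * Z ω).re ≤ p + α := le_lowerSupport_add hd θ
  have hX : Integrable (fun ω => Complex.exp (θ * Complex.I) * Z ω) μ := hi.const_mul _
  have hre0 : ∫ ω, (Complex.exp (θ * Complex.I) * Z ω).re ∂μ = 0 := by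
    have := integral_re hX
    simp only [RCLike.re_eq_complex_re] at this
    rw [this, integral_const_mul, h0, mul_zero, Complex.zero_re]
  have hp0 : p ≤ 0 := by
    have := integral_mono (integrable_const p) hX.re hplow
    rw [integral_const, probReal_univ, one_smul] at this
    exact this.trans_eq hre0
  have hpα : 0 ≤ p + α := by
    have := integral_mono hX.re (integrable_const (p + α)) hpup
    rw [integral_const, probReal_univ, one_smul] at this
    exact hre0.symm.trans_le this
  have hP0 : 0 ≤ -p / α := div_nonneg (by linarith) hα0.le
  have hP1 : -p / α ≤ 1 := (div_le_one hα0).2 (by linarith)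
  have key := re_mul_integral_exp_le (μ := μ) hα0 hZ h0 hb hplow hpup
    (fun v w hv0 hv hw => chordGap_arg_nonpos (abs_le.2 hθ) hα0 hα hv0 hv hw)
  obtain ⟨Q, hQ0, hQ1, hQ⟩ := norm_twoPoint_sub_one_le hP0 hP1 hα0.le
    (η := Complex.exp (-θ * Complex.I)) (by
      have := Complex.norm_exp_ofReal_mul_I (-θ); push_cast at this; exact this)
  refine ⟨Q, hQ0, hQ1, le_trans ?_ hQ⟩
  change (c * _).re ≤ (c * _).re at key
  have h1 : ‖ζ‖ = (c * ∫ ω, Complex.exp (Z ω) ∂μ).re - c.re := by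
    rw [← Complex.sub_re, ← mul_sub_one, ← hζ, hcζ, Complex.ofReal_re]
  rw [h1]
  refine (sub_le_sub_right key _).trans ?_
  rw [← Complex.sub_re, ← mul_sub_one]
  refine (Complex.re_le_norm _).trans ?_
  rw [norm_mul, hcn, one_mul]

end ComplexHoeffding

/-! ### Real two-point bounds and Hoeffding's lemma -/

/-- Apply `x ≤ e^{x-1}` to `x = κ (1 + P (U - 1))`; since `κ (U - 1) = r`, the dependence on `P`
cancels. An upper bound `U` for `e^r` makes the result numerically usable. -/
lemma twoPointMGF_le_of_exp_le {P r U : ℝ} (hP0 : 0 ≤ P) (hr : 0 < r)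
    (hU : Real.exp r ≤ U) :
    twoPointMGF P r ≤ Real.exp (r / (U - 1) - 1) / (r / (U - 1)) := by
  have hU1 : 0 < U - 1 := by linarith [Real.add_one_le_exp r]
  set κ := r / (U - 1) with hκ
  have hκ0 : 0 < κ := by positivity
  rw [le_div_iff₀ hκ0, twoPointMGF]
  have h1 : 1 + P * (Real.exp r - 1) ≤ 1 + P * (U - 1) := by
    gcongr
  have h2 : κ * (1 + P * (U - 1)) ≤ Real.exp (κ * (1 + P * (U - 1)) - 1) := by
    linarith [Real.add_one_le_exp (κ * (1 + P * (U - 1)) - 1)]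
  calc Real.exp (-P * r) * (1 + P * (Real.exp r - 1)) * κ
      ≤ Real.exp (-P * r) * (κ * (1 + P * (U - 1))) := by
        rw [mul_assoc, mul_comm _ κ]; gcongr
    _ ≤ Real.exp (-P * r) * Real.exp (κ * (1 + P * (U - 1)) - 1) := by gcongr
    _ = Real.exp (κ - 1) := by
        rw [← Real.exp_add]; congr 1
        rw [hκ]; field_simp; ring

section

variable {Ω : Type*} [MeasurableSpace Ω] {μ : Measure Ω} [IsProbabilityMeasure μ] {X : Ω → ℝ}
  {β : ℝ}

lemma integral_exp_le_twoPointMGF (hX : Measurable X) (h0 : ∫ ω, X ω ∂μ = 0) (hβ : 0 < β)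
    (hd : ∀ ω ω', X ω - X ω' ≤ β) :
    Integrable (fun ω => Real.exp (X ω)) μ ∧
      ∃ P, 0 ≤ P ∧ P ≤ 1 ∧ ∫ ω, Real.exp (X ω) ∂μ ≤ twoPointMGF P β := by
  have hne : Nonempty Ω := nonempty_of_isProbabilityMeasure μ
  obtain ⟨ω₀⟩ := hne
  have hbdd : BddBelow (Set.range X) := ⟨X ω₀ - β, by
    rintro _ ⟨ω, rfl⟩; linarith [hd ω₀ ω]⟩
  set p := ⨅ ω, X ω with hp
  have hlow : ∀ ω, p ≤ X ω := fun ω => ciInf_le hbdd ω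
  have hup : ∀ ω, X ω ≤ p + β := by
    intro ω
    rw [← sub_le_iff_le_add]
    have : Nonempty Ω := ⟨ω₀⟩
    exact le_ciInf fun ω' => by linarith [hd ω ω']
  have hXi : Integrable X μ := Integrable.of_bound hX.aestronglyMeasurable (|p| + β)
    (Filter.Eventually.of_forall fun ω => by
      rw [Real.norm_eq_abs, abs_le]
      constructor
      · linarith [hlow ω, neg_abs_le p]
      · linarith [hup ω, le_abs_self p])
  have hei : Integrable (fun ω => Real.exp (X ω)) μ :=
    Integrable.of_bound (Real.measurable_exp.comp hX).aestronglyMeasurable (Real.exp (p + β))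
      (Filter.Eventually.of_forall fun ω => by
        rw [Real.norm_eq_abs, Real.abs_exp]; exact Real.exp_le_exp.2 (hup ω))
  refine ⟨hei, -p / β, ?_, ?_, ?_⟩
  · have := integral_mono (integrable_const p) hXi hlow
    rw [integral_const, probReal_univ, one_smul, h0] at this
    exact div_nonneg (by linarith) hβ.le
  · have := integral_mono hXi (integrable_const (p + β)) hup
    rw [integral_const, probReal_univ, one_smul, h0] at this
    exact (div_le_one hβ).2 (by linarith)
  · have hpt : ∀ ω, Real.exp (X ω) ≤ (1 + p / β) * Real.exp p - p / β * Real.exp (p + β)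
        + X ω * ((Real.exp (p + β) - Real.exp p) / β) - 0 * X ω := by
      intro ω
      have h := convexOn_exp.2 (Set.mem_univ p) (Set.mem_univ (p + β))
        (show 0 ≤ 1 - (X ω - p) / β from sub_nonneg.2 ((div_le_one hβ).2 (by linarith [hup ω])))
        (div_nonneg (by linarith [hlow ω]) hβ.le : 0 ≤ (X ω - p) / β) (by ring)
      simp only [smul_eq_mul] at h
      rw [show (1 - (X ω - p) / β) * p + (X ω - p) / β * (p + β) = X ω by field_simp; ring] at h
      refine h.trans (le_of_eq ?_)
      field_simp
      ring
    have hA : Integrable (fun ω => (1 + p / β) * Real.exp p - p / β * Real.exp (p + β)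
        + X ω * ((Real.exp (p + β) - Real.exp p) / β) - 0 * X ω) μ :=
      ((integrable_const _).add (hXi.mul_const _)).sub (hXi.const_mul _)
    refine (integral_mono hei hA hpt).trans (le_of_eq ?_)
    rw [integral_affine_eq hXi hXi h0 h0, twoPointMGF_eq]
    have e1 : -(-p / β) * β = p := by field_simp
    have e2 : (1 - -p / β) * β = p + β := by field_simp; ring
    rw [e1, e2]
    ring

end

/-- This bounds the logarithmic `r`-derivative of `twoPointMGF P r` by `r/4`. With `m = e^{r/2}` it
combines `tanh (r/4) ≤ r/4` with `1 + P (m² - 1) - P (1 - P)(m + 1)² = (1 - P - P m)² ≥ 0`. -/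
lemma logistic_sub_le {P r : ℝ} (hP0 : 0 ≤ P) (hr : 0 ≤ r) :
    P * (1 - P) * (Real.exp r - 1) ≤ r / 4 * (1 + P * (Real.exp r - 1)) := by
  set m := Real.exp (r / 2) with hm
  have hm1 : 1 ≤ m := by linarith [Real.add_one_le_exp (r / 2)]
  have hr2 : Real.exp r = m ^ 2 := by rw [hm, ← Real.exp_nat_mul]; congr 1; push_cast; ring
  have htanh : m - 1 ≤ r / 4 * (m + 1) := by
    have hd : ∀ t, HasDerivAt (fun t => t / 4 * (Real.exp (t / 2) + 1) - (Real.exp (t / 2) - 1))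
        (1 / 4 * (Real.exp (t / 2) + 1) + t / 4 * (Real.exp (t / 2) * (1 / 2)) -
          Real.exp (t / 2) * (1 / 2)) t := by
      intro t
      have h1 : HasDerivAt (fun t => Real.exp (t / 2)) (Real.exp (t / 2) * (1 / 2)) t :=
        ((hasDerivAt_id t).div_const 2).exp
      exact (((hasDerivAt_id t).div_const 4).mul (h1.add_const 1)).sub (h1.sub_const 1)
    have hmono : MonotoneOn (fun t => t / 4 * (Real.exp (t / 2) + 1) - (Real.exp (t / 2) - 1))
        (Set.Icc 0 r) := by
      refine monotoneOn_of_deriv_nonneg (convex_Icc _ _)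
        (fun x _ => (hd x).continuousAt.continuousWithinAt)
        (fun x _ => (hd x).differentiableAt.differentiableWithinAt) fun t ht => ?_
      rw [(hd t).deriv]
      have h2 := Real.add_one_le_exp (-(t / 2))
      have h3 : Real.exp (t / 2) * Real.exp (-(t / 2)) = 1 := by rw [← Real.exp_add]; simp
      have h4 := mul_le_mul_of_nonneg_left h2 (Real.exp_pos (t / 2)).le
      rw [h3] at h4
      linarith
    have := hmono ⟨le_rfl, hr⟩ ⟨hr, le_rfl⟩ hr
    simp only [zero_div, zero_mul, Real.exp_zero, sub_self] at this
    rw [hm]; linarith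
  rw [hr2]
  have hD : 0 ≤ (1 + P * (m ^ 2 - 1)) - P * (1 - P) * (m + 1) ^ 2 := by
    have : (1 + P * (m ^ 2 - 1)) - P * (1 - P) * (m + 1) ^ 2 = ((1 - P) - P * m) ^ 2 := by ring
    rw [this]; positivity
  have h1 : P * (1 - P) * (m ^ 2 - 1) * (m + 1) ≤ (m - 1) * (1 + P * (m ^ 2 - 1)) := by
    nlinarith [mul_nonneg (sub_nonneg.2 hm1) hD]
  have hpos : 0 ≤ 1 + P * (m ^ 2 - 1) := by
    have := mul_nonneg hP0 (by nlinarith : 0 ≤ m ^ 2 - 1)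
    linarith
  have h2 := mul_le_mul_of_nonneg_right htanh hpos
  have hm0 : 0 < m + 1 := by linarith
  refine le_of_mul_le_mul_right ?_ hm0
  linarith

/-- Monotonicity says more than the bound by `e^{r²/8}`: a strict gain at `r = 3` persists for all
larger `r`. -/
lemma antitoneOn_twoPointMGF_mul_exp {P : ℝ} (hP0 : 0 ≤ P) :
    AntitoneOn (fun r => twoPointMGF P r * Real.exp (-r ^ 2 / 8)) (Set.Ici 0) := by
  have hd : ∀ r, HasDerivAt (fun r => twoPointMGF P r * Real.exp (-r ^ 2 / 8))
      (Real.exp (-P * r) * Real.exp (-r ^ 2 / 8) * (P * (1 - P) * (Real.exp r - 1)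
        - r / 4 * (1 + P * (Real.exp r - 1)))) r := by
    intro r
    have h1 : HasDerivAt (fun r => Real.exp (-P * r)) (Real.exp (-P * r) * (-P)) r := by
      simpa using ((hasDerivAt_id r).const_mul (-P)).exp
    have h2 : HasDerivAt (fun r => Real.exp (-r ^ 2 / 8)) (Real.exp (-r ^ 2 / 8) * (-(r / 4))) r := by
      have : HasDerivAt (fun r : ℝ => -r ^ 2 / 8) (-(r / 4)) r :=
        (((hasDerivAt_pow 2 r).neg).div_const 8).congr_deriv (by norm_num; ring)
      exact this.exp
    have h3 : HasDerivAt (fun r => 1 + P * (Real.exp r - 1)) (P * Real.exp r) r :=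
      (((Real.hasDerivAt_exp r).sub_const 1).const_mul P).const_add 1
    exact ((h1.mul h3).mul h2).congr_deriv (by simp only [Pi.mul_apply]; ring)
  refine antitoneOn_of_deriv_nonpos (convex_Ici 0)
    (fun x _ => (hd x).continuousAt.continuousWithinAt)
    (fun x _ => (hd x).differentiableAt.differentiableWithinAt) fun r hr => ?_
  rw [interior_Ici] at hr
  rw [(hd r).deriv]
  exact mul_nonpos_of_nonneg_of_nonpos (by positivity)
    (sub_nonpos.2 (logistic_sub_le hP0 (le_of_lt hr)))

lemma twoPointMGF_le_exp_sq {P r : ℝ} (hP0 : 0 ≤ P) (hr : 0 ≤ r) :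
    twoPointMGF P r ≤ Real.exp (r ^ 2 / 8) := by
  have h := antitoneOn_twoPointMGF_mul_exp hP0 (Set.mem_Ici.2 le_rfl) (Set.mem_Ici.2 hr) hr
  simp only [twoPointMGF] at h ⊢
  simp only [mul_zero, Real.exp_zero, sub_self, add_zero, ne_eq, OfNat.ofNat_ne_zero,
    not_false_eq_true, zero_pow, neg_zero, zero_div, mul_one] at h
  rw [show -r ^ 2 / 8 = -(r ^ 2 / 8) by ring, Real.exp_neg] at h
  rwa [← div_eq_mul_inv, div_le_one (Real.exp_pos _)] at h

/-! ### Diameter `3` by exponential tilting -/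

lemma cos_le_exp_neg_sq_div_two {t : ℝ} (ht : |t| ≤ Real.pi / 2) :
    Real.cos t ≤ Real.exp (-(t ^ 2 / 2)) := by
  rw [← Real.cos_abs, ← sq_abs]
  set x := |t| with hx
  have hd : ∀ x, HasDerivAt (fun x => Real.cos x * Real.exp (x ^ 2 / 2))
      (Real.exp (x ^ 2 / 2) * (x * Real.cos x - Real.sin x)) x := by
    intro x
    have h1 : HasDerivAt (fun x : ℝ => x ^ 2 / 2) x x :=
      ((hasDerivAt_pow 2 x).div_const 2).congr_deriv (by norm_num)
    exact ((Real.hasDerivAt_cos x).mul h1.exp).congr_deriv (by ring)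
  have hm : AntitoneOn (fun x => Real.cos x * Real.exp (x ^ 2 / 2)) (Set.Icc 0 (Real.pi / 2)) := by
    refine antitoneOn_of_deriv_nonpos (convex_Icc _ _)
      (fun x _ => (hd x).continuousAt.continuousWithinAt)
      (fun x _ => (hd x).differentiableAt.differentiableWithinAt) fun y hy => ?_
    rw [interior_Icc] at hy
    rw [(hd y).deriv]
    have hc := Real.cos_pos_of_mem_Ioo ⟨by linarith [hy.1, Real.pi_pos], hy.2⟩
    have := Real.lt_tan hy.1 hy.2
    rw [Real.tan_eq_sin_div_cos, lt_div_iff₀ hc] at this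
    exact mul_nonpos_of_nonneg_of_nonpos (Real.exp_pos _).le (by linarith)
  have := hm ⟨le_rfl, by positivity⟩ ⟨abs_nonneg t, ht⟩ (abs_nonneg t)
  simp only [Real.cos_zero, ne_eq, OfNat.ofNat_ne_zero, not_false_eq_true, zero_pow, zero_div,
    Real.exp_zero, mul_one] at this
  rw [Real.exp_neg, ← one_div, le_div_iff₀ (Real.exp_pos _)]
  exact this

/-- Where `|t| ≤ π/2`, complete the square in `-t²/2 ≤ τ²/2 - τ t`; elsewhere the cosine is
nonpositive. The linear exponent merges with `Re Z` into a real functional of `Z`, to which the real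
lemma applies. -/
lemma cos_le_exp_linear {t : ℝ} (τ : ℝ) (ht : -(3 * Real.pi / 2) ≤ t) (ht' : t ≤ 3 * Real.pi / 2) :
    Real.cos t ≤ Real.exp (τ ^ 2 / 2 - τ * t) := by
  rcases le_or_gt |t| (Real.pi / 2) with h | h
  · refine (cos_le_exp_neg_sq_div_two h).trans (Real.exp_le_exp.2 ?_)
    nlinarith [sq_nonneg (τ - t)]
  · refine le_trans ?_ (Real.exp_pos _).le
    rw [← Real.cos_abs]
    refine Real.cos_nonpos_of_pi_div_two_le_of_le h.le ?_
    have : |t| ≤ 3 * Real.pi / 2 := abs_le.2 ⟨by linarith, ht'⟩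
    linarith

section

variable {Ω : Type*} [MeasurableSpace Ω] {μ : Measure Ω} [IsProbabilityMeasure μ] {Z : Ω → ℂ}
  {α : ℝ}

lemma integral_re_eq_zero (h0 : ∫ ω, Z ω ∂μ = 0) (hi : Integrable Z μ) :
    ∫ ω, (Z ω).re ∂μ = 0 := by
  have := integral_re hi
  simp only [RCLike.re_eq_complex_re] at this
  rw [this, h0, Complex.zero_re]

lemma integral_im_eq_zero (h0 : ∫ ω, Z ω ∂μ = 0) (hi : Integrable Z μ) :
    ∫ ω, (Z ω).im ∂μ = 0 := by
  have := integral_im hi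
  simp only [RCLike.im_eq_complex_im] at this
  rw [this, h0, Complex.zero_im]

/-- Hoeffding's lemma for the real linear functional `x - τ y` of a complex variable `x + i y`. -/
lemma integral_exp_re_sub_le {β τ B : ℝ} (hZ : Measurable Z) (h0 : ∫ ω, Z ω ∂μ = 0)
    (hd : ∀ ω ω', ‖Z ω - Z ω'‖ ≤ α) (hβ : 0 < β) (hαβ : α ^ 2 * (1 + τ ^ 2) ≤ β ^ 2)
    (hB : ∀ P, 0 ≤ P → P ≤ 1 → twoPointMGF P β ≤ B) :
    Integrable (fun ω => Real.exp ((Z ω).re - τ * (Z ω).im)) μ ∧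
      ∫ ω, Real.exp ((Z ω).re - τ * (Z ω).im) ∂μ ≤ B := by
  have hi := integrable_of_diam_le (μ := μ) hZ hd
  obtain ⟨h1, P, hP0, hP1, hP⟩ := integral_exp_le_twoPointMGF (μ := μ) (β := β)
    (X := fun ω => (Z ω).re - τ * (Z ω).im)
    ((Complex.measurable_re.comp hZ).sub ((Complex.measurable_im.comp hZ).const_mul τ))
    (by
      have h1 : Integrable (fun ω => (Z ω).re) μ := hi.re
      have h2 : Integrable (fun ω => (Z ω).im) μ := hi.im
      rw [integral_sub h1 (h2.const_mul τ), integral_const_mul, integral_re_eq_zero h0 hi,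
        integral_im_eq_zero h0 hi]
      ring) hβ
    (fun ω ω' => by
      have h := hd ω ω'
      have h2 : ((Z ω).re - (Z ω').re) ^ 2 + ((Z ω).im - (Z ω').im) ^ 2 ≤ α ^ 2 := by
        have h3 : ‖Z ω - Z ω'‖ ^ 2 ≤ α ^ 2 := pow_le_pow_left₀ (norm_nonneg _) h 2
        rw [← Complex.normSq_eq_norm_sq, Complex.normSq_apply, Complex.sub_re, Complex.sub_im] at h3
        linarith
      refine le_of_sq_le_sq ?_ hβ.le
      refine le_trans ?_ hαβ
      have h4 : ((Z ω).re - τ * (Z ω).im - ((Z ω').re - τ * (Z ω').im)) ^ 2 ≤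
          (((Z ω).re - (Z ω').re) ^ 2 + ((Z ω).im - (Z ω').im) ^ 2) * (1 + τ ^ 2) := by
        nlinarith [sq_nonneg (τ * ((Z ω).re - (Z ω').re) + ((Z ω).im - (Z ω').im))]
      exact h4.trans (mul_le_mul_of_nonneg_right h2 (by positivity)))
  exact ⟨h1, hP.trans (hB P hP0 hP1)⟩

/-- The exponential tilting bound for one direction of `∫ exp Z`. -/
lemma re_exp_mul_integral_exp_le {β τ B ψ : ℝ} (hZ : Measurable Z) (h0 : ∫ ω, Z ω ∂μ = 0)
    (hd : ∀ ω ω', ‖Z ω - Z ω'‖ ≤ α) (hα : α ≤ 3) (hβ : 0 < β)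
    (hαβ : α ^ 2 * (1 + τ ^ 2) ≤ β ^ 2)
    (hB : ∀ P, 0 ≤ P → P ≤ 1 → twoPointMGF P β ≤ B) (hτ : 0 ≤ τ) (hψ0 : 0 ≤ ψ)
    (hψ : ψ ≤ Real.pi) :
    (Complex.exp (ψ * Complex.I) * ∫ ω, Complex.exp (Z ω) ∂μ).re ≤
      Real.exp (τ ^ 2 / 2 - τ * ψ) * B := by
  have hpi := Real.pi_gt_three
  have hi := integrable_of_diam_le (μ := μ) hZ hd
  have hb := norm_le_of_integral_eq_zero h0 hd hi
  have hie := integrable_exp_of_norm_le (μ := μ) hZ hb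
  have hB0 : 0 ≤ B := by
    have := hB 0 le_rfl zero_le_one
    simp only [twoPointMGF] at this
    norm_num at this
    linarith
  have hint : (Complex.exp (ψ * Complex.I) * ∫ ω, Complex.exp (Z ω) ∂μ).re =
      ∫ ω, Real.exp (Z ω).re * Real.cos (ψ + (Z ω).im) ∂μ := by
    have := integral_re (hie.const_mul (Complex.exp (ψ * Complex.I)))
    simp only [RCLike.re_eq_complex_re] at this
    rw [← integral_const_mul, ← this]
    exact integral_congr_ae (Filter.Eventually.of_forall fun ω => re_exp_mul_I_mul_exp _ _)
  have hli : Integrable (fun ω => Real.exp (Z ω).re * Real.cos (ψ + (Z ω).im)) μ := by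
    refine (hie.const_mul (Complex.exp (ψ * Complex.I))).re.congr
      (Filter.Eventually.of_forall fun ω => re_exp_mul_I_mul_exp _ _)
  have hy : ∀ ω, |(Z ω).im| ≤ 3 := fun ω =>
    (Complex.abs_im_le_norm _).trans ((hb ω).trans hα)
  rw [hint]
  -- The cosine majorant needs `ψ + Im Z ≤ 3π/2`. If this fails somewhere, then diameter `3 ≤ π`
  -- keeps `2π - (ψ + Im Z) ≤ 3π/2` everywhere, and the opposite tilt works; the bound is no larger
  -- because `2π - ψ ≥ ψ`.
  by_cases hcase : ∀ ω, (Z ω).im ≤ 3 * Real.pi / 2 - ψ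
  · obtain ⟨h1, h2⟩ := integral_exp_re_sub_le (μ := μ) (τ := τ) hZ h0 hd hβ hαβ hB
    refine (integral_mono hli (h1.const_mul (Real.exp (τ ^ 2 / 2 - τ * ψ))) fun ω => ?_).trans ?_
    · have := cos_le_exp_linear (t := ψ + (Z ω).im) τ
        (by linarith [(abs_le.1 (hy ω)).1]) (by linarith [hcase ω])
      calc _ ≤ Real.exp (Z ω).re * Real.exp (τ ^ 2 / 2 - τ * (ψ + (Z ω).im)) := by gcongr
        _ = _ := by simp only [← Real.exp_add]; congr 1; ring
    · rw [integral_const_mul]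
      gcongr
  · push Not at hcase
    obtain ⟨ω₀, hω₀⟩ := hcase
    obtain ⟨h1, h2⟩ := integral_exp_re_sub_le (μ := μ) (τ := -τ) hZ h0 hd hβ
      (by rwa [neg_sq]) hB
    refine (integral_mono hli
      (h1.const_mul (Real.exp (τ ^ 2 / 2 - τ * (2 * Real.pi - ψ)))) fun ω => ?_).trans ?_
    · have hdi : (Z ω₀).im - (Z ω).im ≤ 3 := by
        rw [← Complex.sub_im]
        exact (Complex.im_le_norm _).trans ((hd _ _).trans hα)
      have := cos_le_exp_linear (t := 2 * Real.pi - ψ - (Z ω).im) τ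
        (by linarith [(abs_le.1 (hy ω)).2]) (by linarith)
      rw [show 2 * Real.pi - ψ - (Z ω).im = 2 * Real.pi - (ψ + (Z ω).im) by ring,
        Real.cos_two_pi_sub] at this
      calc _ ≤ Real.exp (Z ω).re * Real.exp (τ ^ 2 / 2 - τ * (2 * Real.pi - (ψ + (Z ω).im))) := by
            gcongr
        _ = _ := by simp only [← Real.exp_add]; congr 1; ring
    · rw [integral_const_mul]
      have : Real.exp (τ ^ 2 / 2 - τ * (2 * Real.pi - ψ)) ≤ Real.exp (τ ^ 2 / 2 - τ * ψ) :=
        Real.exp_le_exp.2 (by nlinarith)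
      exact mul_le_mul this h2 (integral_nonneg fun ω => (Real.exp_pos _).le) (Real.exp_pos _).le

end

/-- The last coefficient is the remainder factor `8 / (7 · 7!) = 1/4410`. -/
lemma exp_le_taylor {x : ℝ} (h0 : 0 ≤ x) (h1 : x ≤ 1) :
    Real.exp x ≤ 1 + x + x ^ 2 / 2 + x ^ 3 / 6 + x ^ 4 / 24 + x ^ 5 / 120 + x ^ 6 / 720
      + x ^ 7 / 4410 := by
  have := Real.exp_bound' h0 h1 (n := 7) (by norm_num)
  simp only [Finset.sum_range_succ, Finset.sum_range_zero] at this
  norm_num [Nat.factorial] at this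
  linarith

lemma taylor_le_exp {x : ℝ} (h0 : 0 ≤ x) :
    1 + x + x ^ 2 / 2 + x ^ 3 / 6 + x ^ 4 / 24 + x ^ 5 / 120 + x ^ 6 / 720 ≤ Real.exp x := by
  have := Real.sum_le_exp_of_nonneg h0 7
  simp only [Finset.sum_range_succ, Finset.sum_range_zero] at this
  norm_num [Nat.factorial] at this
  linarith

lemma exp_neg_le_taylor {x : ℝ} (h0 : 0 ≤ x) :
    Real.exp (-x) ≤
      1 / (1 + x + x ^ 2 / 2 + x ^ 3 / 6 + x ^ 4 / 24 + x ^ 5 / 120 + x ^ 6 / 720) := by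
  rw [Real.exp_neg, ← one_div]
  exact one_div_le_one_div_of_le (by positivity) (taylor_le_exp h0)

lemma exp_four_mul_le {x : ℝ} (h0 : 0 ≤ x) (h1 : x ≤ 1) :
    Real.exp (4 * x) ≤ (1 + x + x ^ 2 / 2 + x ^ 3 / 6 + x ^ 4 / 24 + x ^ 5 / 120 + x ^ 6 / 720
      + x ^ 7 / 4410) ^ 4 := by
  have : Real.exp (4 * x) = Real.exp x ^ 4 := by rw [← Real.exp_nat_mul]; norm_num
  rw [this]
  exact pow_le_pow_left₀ (Real.exp_pos x).le (exp_le_taylor h0 h1) 4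

lemma convexOn_exp_affine (c τ : ℝ) : ConvexOn ℝ Set.univ (fun s => Real.exp (c - τ * s)) := by
  refine ⟨convex_univ, fun x _ y _ p q hp hq hpq => ?_⟩
  have h := convexOn_exp.2 (Set.mem_univ (c - τ * x)) (Set.mem_univ (c - τ * y)) hp hq hpq
  simp only [smul_eq_mul] at h ⊢
  have e : p * (c - τ * x) + q * (c - τ * y) = c - τ * (p * x + q * y) := by
    linear_combination c * hpq
  rwa [e] at h

/-- Two angle doublings start from `cos (x/4) ≥ 1 - (x/4)²/2`. Squaring in the second one needs a
nonnegative minorant of `cos (x/2)`, hence the alternative. -/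
lemma cos_three_step (x : ℝ) (hx : x ^ 2 ≤ 16) :
    2 * (2 * (1 - (x / 4) ^ 2 / 2) ^ 2 - 1) ^ 2 - 1 ≤ Real.cos x ∨
      2 * (1 - (x / 4) ^ 2 / 2) ^ 2 - 1 < 0 := by
  by_cases h : 0 ≤ 2 * (1 - (x / 4) ^ 2 / 2) ^ 2 - 1
  · left
    have h1 := Real.one_sub_sq_div_two_le_cos (x := x / 4)
    have h2 : Real.cos (x / 2) = 2 * Real.cos (x / 4) ^ 2 - 1 := by
      rw [← Real.cos_two_mul]; congr 1; ring
    have h3 : Real.cos x = 2 * Real.cos (x / 2) ^ 2 - 1 := by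
      rw [← Real.cos_two_mul]; congr 1; ring
    have h4 : (1 - (x / 4) ^ 2 / 2) ^ 2 ≤ Real.cos (x / 4) ^ 2 :=
      pow_le_pow_left₀ (by nlinarith) h1 2
    have h5 : (2 * (1 - (x / 4) ^ 2 / 2) ^ 2 - 1) ^ 2 ≤ Real.cos (x / 2) ^ 2 :=
      pow_le_pow_left₀ h (by rw [h2]; linarith) 2
    rw [h3]; linarith
  · exact Or.inr (not_le.1 h)

/-- The arguments `3.026`, `3.232` and `3.579` in this and the next two lemmas slightly exceed `3
√(1 + τ²)` for the tilts `τ = 0.13`, `0.4`, `0.65`. -/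
lemma twoPointMGF_le_2784 {P : ℝ} (hP0 : 0 ≤ P) : twoPointMGF P 3.026 ≤ 2.784 := by
  have hU : Real.exp 3.026 ≤ 20.62 := by
    have := exp_four_mul_le (x := 0.7565) (by norm_num) (by norm_num)
    norm_num at this ⊢
    linarith
  refine (twoPointMGF_le_of_exp_le hP0 (by norm_num) hU).trans ?_
  have := exp_neg_le_taylor (x := 1 - 3.026 / (20.62 - 1)) (by norm_num)
  rw [div_le_iff₀ (by norm_num), ← neg_sub]
  refine this.trans ?_
  norm_num

lemma twoPointMGF_le_3166 {P : ℝ} (hP0 : 0 ≤ P) : twoPointMGF P 3.232 ≤ 3.166 := by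
  have hU : Real.exp 3.232 ≤ 25.34 := by
    have := exp_four_mul_le (x := 0.808) (by norm_num) (by norm_num)
    norm_num at this ⊢
    linarith
  refine (twoPointMGF_le_of_exp_le hP0 (by norm_num) hU).trans ?_
  have := exp_neg_le_taylor (x := 1 - 3.232 / (25.34 - 1)) (by norm_num)
  rw [div_le_iff₀ (by norm_num), ← neg_sub]
  refine this.trans ?_
  norm_num

lemma twoPointMGF_le_3972 {P : ℝ} (hP0 : 0 ≤ P) : twoPointMGF P 3.579 ≤ 3.972 := by
  have hU : Real.exp 3.579 ≤ 35.86 := by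
    have := exp_four_mul_le (x := 0.89475) (by norm_num) (by norm_num)
    norm_num at this ⊢
    linarith
  refine (twoPointMGF_le_of_exp_le hP0 (by norm_num) hU).trans ?_
  have := exp_neg_le_taylor (x := 1 - 3.579 / (35.86 - 1)) (by norm_num)
  rw [div_le_iff₀ (by norm_num), ← neg_sub]
  refine this.trans ?_
  norm_num

/-- On `[a, b] ⊆ [0, π/2]` it is enough to check the end points. -/
lemma tilted_bound_of_endpoints {c τ B M a b ψ : ℝ} (hB : 0 ≤ B) (ha : 0 ≤ a)
    (hb : b ≤ Real.pi / 2) (haψ : a ≤ ψ) (hψb : ψ ≤ b)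
    (h1 : Real.exp (c - τ * a) * B - Real.cos a ≤ M)
    (h2 : Real.exp (c - τ * b) * B - Real.cos b ≤ M) :
    Real.exp (c - τ * ψ) * B - Real.cos ψ ≤ M := by
  have hsub : Set.Icc a b ⊆ Set.Icc (-(Real.pi / 2)) (Real.pi / 2) :=
    Set.Icc_subset_Icc (by linarith [Real.pi_pos]) hb
  have hconv : ConvexOn ℝ (Set.Icc a b) (fun s => B * Real.exp (c - τ * s) - Real.cos s) :=
    (((convexOn_exp_affine c τ).subset (Set.subset_univ _) (convex_Icc a b)).smul hB).sub
      (strictConcaveOn_cos_Icc.concaveOn.subset hsub (convex_Icc a b))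
  have hab := haψ.trans hψb
  have := hconv.le_max_of_mem_Icc ⟨le_rfl, hab⟩ ⟨hab, le_rfl⟩ ⟨haψ, hψb⟩
  simp only [mul_comm B] at this
  exact this.trans (max_le h1 h2)

lemma tilted_bound_low {ψ : ℝ} (h0 : 0 ≤ ψ) (h1 : ψ ≤ 0.74) :
    Real.exp (0.13 ^ 2 / 2 - 0.13 * ψ) * 2.784 - Real.cos ψ ≤ 1.815 := by
  refine tilted_bound_of_endpoints (by norm_num) le_rfl (by linarith [Real.pi_gt_three]) h0 h1 ?_ ?_
  · have := exp_le_taylor (x := 0.00845) (by norm_num) (by norm_num)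
    norm_num at this ⊢
    linarith
  · have h2 := exp_neg_le_taylor (x := 0.08775) (by norm_num)
    have h3 := (cos_three_step 0.74 (by norm_num)).resolve_right (by norm_num)
    norm_num at h2 h3 ⊢
    linarith

lemma cos_three_halves_ge : 0.07 ≤ Real.cos 1.5 := by
  rw [← Real.sin_pi_div_two_sub]
  have h1 := Real.pi_gt_d4
  have h2 := Real.pi_lt_d4
  have := Real.sin_gt_sub_cube (x := Real.pi / 2 - 1.5) (by linarith)
  have h3 : (Real.pi / 2 - 1.5) ^ 3 ≤ 0.071 ^ 3 :=
    pow_le_pow_left₀ (by linarith) (by linarith) 3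
  norm_num at h1 h2 h3 this ⊢
  linarith

lemma tilted_bound_mid {ψ : ℝ} (h0 : 0.74 ≤ ψ) (h1 : ψ ≤ 1.5) :
    Real.exp (0.4 ^ 2 / 2 - 0.4 * ψ) * 3.166 - Real.cos ψ ≤ 1.815 := by
  refine tilted_bound_of_endpoints (by norm_num) (by norm_num) (by linarith [Real.pi_gt_three])
    h0 h1 ?_ ?_
  · have h2 := exp_neg_le_taylor (x := 0.216) (by norm_num)
    have h3 := (cos_three_step 0.74 (by norm_num)).resolve_right (by norm_num)
    norm_num at h2 h3 ⊢
    linarith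
  · have h2 := exp_neg_le_taylor (x := 0.52) (by norm_num)
    have h3 := cos_three_halves_ge
    norm_num at h2 h3 ⊢
    linarith

lemma exp_tilt_half_pi_le :
    Real.exp (0.65 ^ 2 / 2 - 0.65 * (Real.pi / 2)) * 3.972 ≤ 1.769 := by
  have h1 : Real.exp (0.65 ^ 2 / 2 - 0.65 * (Real.pi / 2)) ≤ Real.exp (-0.8095) :=
    Real.exp_le_exp.2 (by linarith [Real.pi_gt_d2.le, Real.pi_gt_d4])
  have h2 := h1.trans (exp_neg_le_taylor (x := 0.8095) (by norm_num))
  refine (mul_le_mul_of_nonneg_right h2 (by norm_num)).trans ?_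
  norm_num

/-- The line is the tangent at `π/4`, with `√2/2` rounded up to `0.7072` and `1 - π/4` to `0.2147`.
With `h = s - π/4`, the tangent bound amounts to `1 + sin (2h) ≤ (1 + h)²`. -/
lemma sin_le_sqrt_two_line {s : ℝ} (h0 : 0.65 ≤ s) (h1 : s ≤ 1.2) :
    Real.sin s ≤ 0.7072 * (0.2147 + s) := by
  have hp1 := Real.pi_gt_d4
  have hp2 := Real.pi_lt_d4
  set h := s - Real.pi / 4 with hh
  have e : Real.sin s = √2 / 2 * (Real.cos h + Real.sin h) := by
    rw [show s = h + Real.pi / 4 by rw [hh]; ring, Real.sin_add, Real.cos_pi_div_four,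
      Real.sin_pi_div_four]
    ring
  have hs : √2 / 2 ≤ 0.7072 := by
    have : √2 ≤ 1.4144 := Real.sqrt_le_iff.2 (by norm_num)
    linarith
  have hsum : Real.cos h + Real.sin h ≤ 1 + h := by
    refine le_of_sq_le_sq ?_ (by linarith)
    have h2 : (Real.cos h + Real.sin h) ^ 2 = 1 + Real.sin (2 * h) := by
      rw [Real.sin_two_mul]; linear_combination Real.sin_sq_add_cos_sq h
    rw [h2]
    rcases le_total 0 h with hpos | hneg
    · nlinarith [Real.sin_le (x := 2 * h) (by linarith)]
    · rcases eq_or_lt_of_le hneg with h0 | hlt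
      · rw [h0]; simp
      have h3 := Real.sin_gt_sub_cube (x := -(2 * h)) (by linarith)
      rw [Real.sin_neg] at h3
      have h4 : (-(2 * h)) ^ 3 / 6 ≤ h ^ 2 := by nlinarith [sq_nonneg h]
      linarith
  rw [e]
  calc √2 / 2 * (Real.cos h + Real.sin h) ≤ √2 / 2 * (1 + h) := by gcongr
    _ ≤ 0.7072 * (1 + h) := mul_le_mul_of_nonneg_right hs (by linarith)
    _ ≤ _ := by rw [hh]; linarith

lemma exp_affine_add_le {A τ p q M a b s : ℝ} (hA : 0 ≤ A) (has : a ≤ s) (hsb : s ≤ b)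
    (h1 : A * Real.exp (-(τ * a)) + (p + q * a) ≤ M)
    (h2 : A * Real.exp (-(τ * b)) + (p + q * b) ≤ M) :
    A * Real.exp (-(τ * s)) + (p + q * s) ≤ M := by
  have hconv : ConvexOn ℝ (Set.univ) (fun s => A * Real.exp (0 - τ * s) + (p + q * s)) := by
    refine ((convexOn_exp_affine 0 τ).smul hA).add ⟨convex_univ, fun x _ y _ u v _ _ huv => ?_⟩
    simp only [smul_eq_mul]
    refine le_of_eq ?_
    linear_combination -p * huv
  have hab := has.trans hsb
  have := (hconv.subset (Set.subset_univ (Set.Icc a b)) (convex_Icc a b)).le_max_of_mem_Icc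
    ⟨le_rfl, hab⟩ ⟨hab, le_rfl⟩ ⟨has, hsb⟩
  simp only [zero_sub] at this
  exact this.trans (max_le h1 h2)

/-- Here `s = ψ - π/2`, so that `sin s = -cos ψ`. The sine is replaced by `s`, by its tangent at
`π/4`, and by `1` on the three ranges; on the first two this leaves a convex function to be checked
at the ends. -/
lemma exp_add_sin_le {s : ℝ} (h0 : 0 ≤ s) :
    1.769 * Real.exp (-(0.65 * s)) + Real.sin s ≤ 1.815 := by
  rcases le_total s 0.65 with h1 | h1
  · have := exp_affine_add_le (A := 1.769) (τ := 0.65) (p := 0) (q := 1) (M := 1.815) (by norm_num)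
      h0 h1 (by norm_num) (by
        have := exp_neg_le_taylor (x := 0.4225) (by norm_num)
        norm_num at this ⊢; linarith)
    linarith [Real.sin_le h0]
  rcases le_total s 1.2 with h2 | h2
  · have := exp_affine_add_le (A := 1.769) (τ := 0.65) (p := 0.7072 * 0.2147) (q := 0.7072)
      (M := 1.815) (by norm_num) h1 h2 (by
        have := exp_neg_le_taylor (x := 0.4225) (by norm_num)
        norm_num at this ⊢; linarith) (by
        have := exp_neg_le_taylor (x := 0.78) (by norm_num)
        norm_num at this ⊢; linarith)
    linarith [sin_le_sqrt_two_line h1 h2]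
  · have h3 : Real.exp (-(0.65 * s)) ≤ Real.exp (-0.78) := Real.exp_le_exp.2 (by linarith)
    have h4 := h3.trans (exp_neg_le_taylor (x := 0.78) (by norm_num))
    have h5 := Real.sin_le_one s
    refine (add_le_add (mul_le_mul_of_nonneg_left h4 (by norm_num)) h5).trans ?_
    norm_num

lemma tilted_bound_high {ψ : ℝ} (h0 : 1.5 ≤ ψ) :
    Real.exp (0.65 ^ 2 / 2 - 0.65 * ψ) * 3.972 - Real.cos ψ ≤ 1.815 := by
  rcases le_total ψ (Real.pi / 2) with h1 | h1
  · refine tilted_bound_of_endpoints (by norm_num) (by norm_num) le_rfl h0 h1 ?_ ?_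
    · have h2 := exp_neg_le_taylor (x := 0.76375) (by norm_num)
      have h3 := cos_three_halves_ge
      norm_num at h2 h3 ⊢
      linarith
    · rw [Real.cos_pi_div_two]
      linarith [exp_tilt_half_pi_le]
  · have h2 := exp_add_sin_le (s := ψ - Real.pi / 2) (by linarith)
    rw [Real.sin_sub_pi_div_two] at h2
    have h3 : Real.exp (0.65 ^ 2 / 2 - 0.65 * ψ) * 3.972 =
        (Real.exp (0.65 ^ 2 / 2 - 0.65 * (Real.pi / 2)) * 3.972) *
          Real.exp (-(0.65 * (ψ - Real.pi / 2))) := by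
      rw [mul_right_comm, ← Real.exp_add]; congr 2; ring
    rw [h3]
    have h4 := mul_le_mul_of_nonneg_right exp_tilt_half_pi_le
      (Real.exp_pos (-(0.65 * (ψ - Real.pi / 2)))).le
    linarith

section

variable {Ω : Type*} [MeasurableSpace Ω] {μ : Measure Ω} [IsProbabilityMeasure μ] {Z : Ω → ℂ}

/-- A single tilt is not good enough for all phases; a small one serves `ψ` near `0`, where `-cos ψ`
helps, and larger ones serve larger `ψ`. -/
lemma re_exp_mul_integral_exp_sub_one_le {ψ : ℝ} (hZ : Measurable Z) (h0 : ∫ ω, Z ω ∂μ = 0)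
    (hd : ∀ ω ω', ‖Z ω - Z ω'‖ ≤ 3) (hψ0 : 0 ≤ ψ) (hψ : ψ ≤ Real.pi) :
    (Complex.exp (ψ * Complex.I) * (∫ ω, Complex.exp (Z ω) ∂μ - 1)).re ≤ 1.815 := by
  rw [mul_sub, mul_one, Complex.sub_re, Complex.exp_ofReal_mul_I_re]
  rcases le_total ψ 0.74 with h1 | h1
  · have := re_exp_mul_integral_exp_le (μ := μ) (β := 3.026) (τ := 0.13) (B := 2.784) hZ h0 hd
      le_rfl (by norm_num) (by norm_num) (fun P hP _ => twoPointMGF_le_2784 hP) (by norm_num) hψ0 hψ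
    linarith [tilted_bound_low hψ0 h1]
  rcases le_total ψ 1.5 with h2 | h2
  · have := re_exp_mul_integral_exp_le (μ := μ) (β := 3.232) (τ := 0.4) (B := 3.166) hZ h0 hd
      le_rfl (by norm_num) (by norm_num) (fun P hP _ => twoPointMGF_le_3166 hP) (by norm_num) hψ0 hψ
    linarith [tilted_bound_mid h1 h2]
  · have := re_exp_mul_integral_exp_le (μ := μ) (β := 3.579) (τ := 0.65) (B := 3.972) hZ h0 hd
      le_rfl (by norm_num) (by norm_num) (fun P hP _ => twoPointMGF_le_3972 hP) (by norm_num) hψ0 hψ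
    linarith [tilted_bound_high h2]

theorem norm_integral_exp_sub_one_le_of_diam_le_three (hZ : Measurable Z)
    (h0 : ∫ ω, Z ω ∂μ = 0) (hd : ∀ ω ω', ‖Z ω - Z ω'‖ ≤ 3) :
    ‖∫ ω, Complex.exp (Z ω) ∂μ - 1‖ ≤ 1.815 := by
  have hrot : ∀ ζ : ℂ, (Complex.exp ((-ζ.arg : ℝ) * Complex.I) * ζ).re = ‖ζ‖ := by
    intro ζ
    conv_lhs => rw [← Complex.norm_mul_exp_arg_mul_I ζ]
    rw [Complex.norm_mul_exp_arg_mul_I ζ]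
    nth_rewrite 2 [← Complex.norm_mul_exp_arg_mul_I ζ]
    rw [mul_left_comm, ← Complex.exp_add]
    simp
  set ζ := ∫ ω, Complex.exp (Z ω) ∂μ - 1 with hζ
  -- Passing to the conjugate of `Z` changes the sign of the argument, so only phases in `[0, π]`
  -- are needed.
  rcases le_total ζ.arg 0 with h | h
  · rw [← hrot ζ]
    exact re_exp_mul_integral_exp_sub_one_le hZ h0 hd (by linarith)
      (by linarith [Complex.neg_pi_lt_arg ζ])
  · have hc : ∫ ω, Complex.exp ((starRingEnd ℂ) (Z ω)) ∂μ - 1 = (starRingEnd ℂ) ζ := by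
      rw [hζ, map_sub, map_one, ← integral_conj]
      congr 2
      funext ω
      rw [Complex.exp_conj]
    have := re_exp_mul_integral_exp_sub_one_le (μ := μ) (Z := fun ω => (starRingEnd ℂ) (Z ω))
      (ψ := ζ.arg) (Complex.continuous_conj.measurable.comp hZ)
      (by rw [integral_conj, h0, map_zero])
      (fun ω ω' => by rw [← map_sub, Complex.norm_conj]; exact hd ω ω') h (Complex.arg_le_pi ζ)
    rw [hc] at this
    refine le_trans (le_of_eq ?_) this
    rw [← hrot ζ, ← Complex.conj_re, map_mul, ← Complex.exp_conj]
    simp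

end

/-! ### Diameters between `1.57` and `3` by the three lines theorem -/

lemma one_sub_exp_neg_div_antitone {x y : ℝ} (hx : 0 < x) (hxy : x ≤ y) :
    (1 - Real.exp (-y)) / y ≤ (1 - Real.exp (-x)) / x := by
  have h := (convexOn_exp_affine 0 1).secant_mono (a := 0) (x := x) (y := y) (Set.mem_univ _)
    (Set.mem_univ _) (Set.mem_univ _) hx.ne' (hx.trans_le hxy).ne' hxy
  simp only [zero_sub, one_mul, sub_zero, Real.exp_zero] at h
  have e : ∀ t : ℝ, (1 - Real.exp (-t)) / t = -((Real.exp (-t) - 1) / t) := fun t => by ring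
  rw [e, e]
  linarith

/-- The power of `x` tangent to `exp x - 1` at `x₀` lies below it. -/
lemma tangent_power_le_exp_sub_one {x₀ x : ℝ} (h0 : 0 < x₀) (hx : 0 < x) :
    Real.exp (x₀ / (1 - Real.exp (-x₀)) * (Real.log x - Real.log x₀)) * (Real.exp x₀ - 1) ≤
      Real.exp x - 1 := by
  -- This is the slope of `log (e^x - 1)` with respect to `log x` at `x₀`. The slope `x / (1 -
  -- e^{-x})` increases with `x`, so `log (e^x - 1) - σ log x` is least at `x₀`.
  set σ := x₀ / (1 - Real.exp (-x₀)) with hσ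
  have hpos : ∀ t : ℝ, 0 < t → 0 < Real.exp t - 1 := fun t ht => by
    linarith [Real.add_one_le_exp t]
  have hneg : ∀ t : ℝ, 0 < t → 0 < 1 - Real.exp (-t) := fun t ht => by
    have : Real.exp (-t) < 1 := Real.exp_lt_one_iff.2 (by linarith)
    linarith
  have hd : ∀ t : ℝ, 0 < t → HasDerivAt (fun t => Real.log (Real.exp t - 1) - σ * Real.log t)
      (1 / (1 - Real.exp (-t)) - σ / t) t := by
    intro t ht
    have h1 := (((Real.hasDerivAt_exp t).sub_const 1).log (hpos t ht).ne').sub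
      ((Real.hasDerivAt_log ht.ne').const_mul σ)
    refine h1.congr_deriv ?_
    have h2 : Real.exp t ≠ 0 := (Real.exp_pos t).ne'
    have h3 := (hpos t ht).ne'
    have h4 : 1 / (1 - Real.exp (-t)) = Real.exp t / (Real.exp t - 1) := by
      rw [div_eq_div_iff (hneg t ht).ne' h3, Real.exp_neg]
      field_simp
    rw [h4, div_eq_mul_inv σ t]
  have hσle : ∀ t : ℝ, 0 < t → t ≤ x₀ → 1 / (1 - Real.exp (-t)) - σ / t ≤ 0 := by
    intro t ht htx
    have h1 := one_sub_exp_neg_div_antitone ht htx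
    have h2 := hneg t ht
    have h3 := hneg x₀ h0
    rw [div_le_div_iff₀ h0 ht] at h1
    rw [sub_nonpos, hσ, div_div, div_le_div_iff₀ h2 (by positivity)]
    linarith
  have hσge : ∀ t : ℝ, x₀ ≤ t → 0 ≤ 1 / (1 - Real.exp (-t)) - σ / t := by
    intro t htx
    have ht := h0.trans_le htx
    have h1 := one_sub_exp_neg_div_antitone h0 htx
    have h2 := hneg t ht
    have h3 := hneg x₀ h0
    rw [div_le_div_iff₀ ht h0] at h1
    rw [sub_nonneg, hσ, div_div, div_le_div_iff₀ (by positivity) h2]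
    linarith
  have key : Real.log (Real.exp x₀ - 1) - σ * Real.log x₀ ≤
      Real.log (Real.exp x - 1) - σ * Real.log x := by
    rcases le_total x x₀ with h | h
    · have hanti := antitoneOn_of_deriv_nonpos (convex_Icc x x₀)
        (fun t ht => (hd t (hx.trans_le ht.1)).continuousAt.continuousWithinAt)
        (fun t ht => (hd t (hx.trans_le (interior_subset ht).1)).differentiableAt.differentiableWithinAt)
        (fun t ht => by
          have ht := interior_subset ht
          rw [(hd t (hx.trans_le ht.1)).deriv]
          exact hσle t (hx.trans_le ht.1) ht.2)
      exact hanti ⟨le_rfl, h⟩ ⟨h, le_rfl⟩ h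
    · have hmono := monotoneOn_of_deriv_nonneg (convex_Icc x₀ x)
        (fun t ht => (hd t (h0.trans_le ht.1)).continuousAt.continuousWithinAt)
        (fun t ht => (hd t (h0.trans_le (interior_subset ht).1)).differentiableAt.differentiableWithinAt)
        (fun t ht => by
          have ht := interior_subset ht
          rw [(hd t (h0.trans_le ht.1)).deriv]
          exact hσge t ht.1)
      exact hmono ⟨le_rfl, h⟩ ⟨h, le_rfl⟩ h
  rw [← Real.exp_log (hpos x hx)]
  rw [← Real.exp_log (hpos x₀ h0)]
  rw [← Real.exp_add]
  exact Real.exp_le_exp.2 (by linarith)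

section

variable {Ω : Type*} [MeasurableSpace Ω] {μ : Measure Ω} [IsProbabilityMeasure μ] {W : Ω → ℂ}

lemma hasDerivAt_integral_exp_mul {C : ℝ} (hW : Measurable W) (hC : ∀ ω, ‖W ω‖ ≤ C) (l : ℂ) :
    HasDerivAt (fun l => ∫ ω, Complex.exp (l * W ω) ∂μ)
      (∫ ω, W ω * Complex.exp (l * W ω) ∂μ) l := by
  obtain ⟨ω₀⟩ := nonempty_of_isProbabilityMeasure μ
  have hC0 : 0 ≤ C := (norm_nonneg _).trans (hC ω₀)
  have hm : ∀ l : ℂ, Measurable fun ω => Complex.exp (l * W ω) := fun l =>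
    Complex.continuous_exp.measurable.comp (hW.const_mul l)
  have hexp : ∀ l : ℂ, ∀ ω, ‖Complex.exp (l * W ω)‖ ≤ Real.exp (‖l‖ * C) := fun l ω => by
    rw [Complex.norm_exp]
    refine Real.exp_le_exp.2 ((Complex.re_le_norm _).trans ?_)
    rw [norm_mul]
    exact mul_le_mul_of_nonneg_left (hC ω) (norm_nonneg _)
  refine (hasDerivAt_integral_of_dominated_loc_of_deriv_le
    (F := fun l ω => Complex.exp (l * W ω)) (F' := fun l ω => W ω * Complex.exp (l * W ω))
    (bound := fun _ => C * Real.exp ((‖l‖ + 1) * C))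
    (Metric.ball_mem_nhds l one_pos) (Filter.Eventually.of_forall fun l => (hm l).aestronglyMeasurable)
    (Integrable.of_bound (hm l).aestronglyMeasurable _ (Filter.Eventually.of_forall (hexp l)))
    (hW.mul (hm l)).aestronglyMeasurable (Filter.Eventually.of_forall fun ω x hx => ?_)
    (integrable_const _) (Filter.Eventually.of_forall fun ω x _ => ?_)).2
  · rw [norm_mul]
    refine mul_le_mul (hC ω) ((hexp x ω).trans (Real.exp_le_exp.2 ?_)) (norm_nonneg _) hC0
    have : ‖x‖ ≤ ‖l‖ + 1 := by
      have h1 : ‖x - l‖ < 1 := by simpa [dist_eq_norm] using hx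
      calc ‖x‖ = ‖l + (x - l)‖ := by ring_nf
        _ ≤ _ := (norm_add_le _ _).trans (by linarith)
    exact mul_le_mul_of_nonneg_right this hC0
  · have h := ((hasDerivAt_id x).mul_const (W ω)).cexp
    simp only [id, one_mul] at h
    rwa [mul_comm] at h

lemma norm_integral_exp_sub_one_le_of_diam_eq (hW : Measurable W) (h0 : ∫ ω, W ω ∂μ = 0)
    (hd : ∀ ω ω', ‖W ω - W ω'‖ ≤ 1.57) :
    ‖∫ ω, Complex.exp (W ω) ∂μ - 1‖ ≤ 0.34732 := by
  obtain ⟨Q, hQ0, _, hQ⟩ := norm_integral_exp_sub_one_le_twoPointMGF (μ := μ) hW h0 hd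
    (by norm_num) le_rfl
  have hU : Real.exp 1.57 ≤ 4.80666 := by
    have := exp_four_mul_le (x := 0.3925) (by norm_num) (by norm_num)
    norm_num at this ⊢
    linarith
  have h1 := twoPointMGF_le_of_exp_le hQ0 (by norm_num) hU
  have h2 := exp_neg_le_taylor (x := 1 - 1.57 / (4.80666 - 1)) (by norm_num)
  rw [neg_sub] at h2
  have h3 : Real.exp (1.57 / (4.80666 - 1) - 1) / (1.57 / (4.80666 - 1)) ≤ 1.34732 := by
    rw [div_le_iff₀ (by norm_num)]
    refine h2.trans ?_
    norm_num
  linarith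

/-- The function `s ↦ E exp (e^s W) - 1` is entire, and on the line `Re s = log t` the variable `e^s
W` has diameter at most `t`. The bounds at `t = 1.57` and `t = 3` lie below a power law in `t`,
which is log-linear in `Re s` and hence holds in between. The power law is tangent to `e^{t²/8} - 1`
at `t = 2`, where `t²/8 = 1/2`, and stays below it. -/
lemma norm_integral_exp_mul_sub_one_le_of_mem_Icc {r : ℝ} (hW : Measurable W)
    (h0 : ∫ ω, W ω ∂μ = 0) (hd : ∀ ω ω', ‖W ω - W ω'‖ ≤ 1) (h1 : 1.57 ≤ r) (h2 : r ≤ 3) :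
    ‖∫ ω, Complex.exp (r * W ω) ∂μ - 1‖ ≤ Real.exp (r ^ 2 / 8) - 1 := by
  have hr : 0 < r := by linarith
  have hC := norm_le_of_integral_eq_zero h0 hd (integrable_of_diam_le hW hd)
  set σ : ℝ := (1 / 2) / (1 - Real.exp (-(1 / 2))) with hσ
  set A : ℝ := Real.log (Real.exp (1 / 2) - 1) - σ * Real.log 4 with hA
  have hE1 : (1.6487 : ℝ) ≤ Real.exp (1 / 2) := by
    refine le_trans ?_ (taylor_le_exp (by norm_num)); norm_num
  have hE2 : Real.exp (1 / 2) ≤ (1.648722 : ℝ) := by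
    refine (exp_le_taylor (by norm_num) (by norm_num)).trans ?_; norm_num
  have hpos : 0 < Real.exp (1 / 2) - 1 := by linarith
  have hσE : σ = (1 / 2) * Real.exp (1 / 2) / (Real.exp (1 / 2) - 1) := by
    rw [hσ, Real.exp_neg]
    have := (Real.exp_pos (1 / 2)).ne'
    field_simp
  have hσ1 : 1.2707 ≤ σ := by rw [hσE, le_div_iff₀ hpos]; linarith
  have hσ2 : σ ≤ 1.2708 := by rw [hσE, div_le_iff₀ hpos]; linarith
  have hform : ∀ t : ℝ, 0 < t → Real.exp (A + 2 * σ * Real.log t) =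
      Real.exp (σ * (Real.log (t ^ 2 / 8) - Real.log (1 / 2))) * (Real.exp (1 / 2) - 1) := by
    intro t ht
    rw [← Real.exp_log hpos]
    rw [← Real.exp_add, hA, ← Real.log_div (by positivity) (by norm_num),
      show t ^ 2 / 8 / (1 / 2) = t ^ 2 / 4 by ring, Real.log_div (by positivity) (by norm_num),
      Real.log_pow]
    congr 1
    push_cast
    ring
  have hdiff : Differentiable ℂ fun s : ℂ => ∫ ω, Complex.exp (Complex.exp s * W ω) ∂μ - 1 := by
    intro s
    exact (((hasDerivAt_integral_exp_mul hW hC (Complex.exp s)).comp s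
      (Complex.hasDerivAt_exp s)).sub_const 1).differentiableAt
  have hmean : ∀ s : ℂ, ∫ ω, Complex.exp s * W ω ∂μ = 0 := fun s => by
    rw [integral_const_mul, h0, mul_zero]
  have hdiam : ∀ (s : ℂ) (c : ℝ), 0 < c → s.re = Real.log c → ∀ ω ω',
      ‖Complex.exp s * W ω - Complex.exp s * W ω'‖ ≤ c := fun s c hc hs ω ω' => by
    rw [← mul_sub, norm_mul, Complex.norm_exp, hs, Real.exp_log hc]
    nlinarith [hd ω ω']
  have hlog : Real.log 1.57 < Real.log 3 := Real.log_lt_log (by norm_num) (by norm_num)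
  have hrl : Real.log 1.57 ≤ Real.log r := Real.log_le_log (by norm_num) h1
  have hru : Real.log r ≤ Real.log 3 := Real.log_le_log hr h2
  have h3 := Complex.HadamardThreeLines.norm_le_interp_of_mem_verticalClosedStrip'
    (f := fun s : ℂ => ∫ ω, Complex.exp (Complex.exp s * W ω) ∂μ - 1) (z := (Real.log r : ℂ))
    (a := Real.exp (A + 2 * σ * Real.log 1.57)) (b := Real.exp (A + 2 * σ * Real.log 3)) hlog
    (by simpa [Complex.HadamardThreeLines.verticalClosedStrip] using And.intro hrl hru)
    hdiff.diffContOnCl ?_ ?_ ?_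
  · rw [← Real.exp_mul, ← Real.exp_mul, ← Real.exp_add, Complex.ofReal_re] at h3
    simp only [← Complex.ofReal_exp, Real.exp_log hr] at h3
    refine h3.trans (le_trans (le_of_eq ?_) (tangent_power_le_exp_sub_one (x₀ := 1 / 2)
      (x := r ^ 2 / 8) (by norm_num) (by positivity)))
    rw [← hform r hr]
    congr 1
    have : Real.log 3 - Real.log 1.57 ≠ 0 := by linarith
    field_simp
    ring
  · refine ⟨Real.exp 3 + 1, ?_⟩
    rintro _ ⟨s, hs, rfl⟩
    have hs2 : s.re ≤ Real.log 3 := hs.2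
    refine (norm_sub_le _ _).trans (add_le_add ?_ (by simp))
    have := norm_integral_le_of_norm_le_const (μ := μ) (C := Real.exp 3)
      (f := fun ω => Complex.exp (Complex.exp s * W ω)) (Filter.Eventually.of_forall fun ω => by
        rw [Complex.norm_exp]
        refine Real.exp_le_exp.2 ((Complex.re_le_norm _).trans ?_)
        rw [norm_mul, Complex.norm_exp]
        have h4 : Real.exp s.re ≤ 3 := by
          rw [← Real.exp_log (show (0 : ℝ) < 3 by norm_num)]; exact Real.exp_le_exp.2 hs2
        nlinarith [hC ω, norm_nonneg (W ω)])
    simpa using this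
  · intro s hs
    refine (norm_integral_exp_sub_one_le_of_diam_eq (hW.const_mul _) (hmean s)
      (hdiam s 1.57 (by norm_num) hs)).trans ?_
    rw [hform 1.57 (by norm_num), ← Real.log_div (by norm_num) (by norm_num)]
    have h4 : -0.4842 ≤ Real.log (1.57 ^ 2 / 8 / (1 / 2)) := by
      rw [Real.le_log_iff_exp_le (by norm_num)]
      refine (exp_neg_le_taylor (by norm_num)).trans ?_
      norm_num
    have h5 : Real.log (1.57 ^ 2 / 8 / (1 / 2)) ≤ 0 := Real.log_nonpos (by norm_num) (by norm_num)
    have h6 : Real.exp (-0.61533) ≤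
        Real.exp (σ * Real.log (1.57 ^ 2 / 8 / (1 / 2))) := Real.exp_le_exp.2 (by nlinarith)
    have h7 : 0.5404 ≤ Real.exp (-0.61533) := by
      rw [Real.exp_neg, ← one_div, le_div_iff₀ (Real.exp_pos _)]
      have := exp_le_taylor (x := 0.61533) (by norm_num) (by norm_num)
      norm_num at this ⊢
      linarith
    calc (0.34732 : ℝ) ≤ 0.5404 * 0.6487 := by norm_num
      _ ≤ _ := mul_le_mul (h7.trans h6) (by linarith) (by norm_num) (Real.exp_pos _).le
  · intro s hs
    refine (norm_integral_exp_sub_one_le_of_diam_le_three (hW.const_mul _) (hmean s)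
      (hdiam s 3 (by norm_num) hs)).trans ?_
    rw [hform 3 (by norm_num), ← Real.log_div (by norm_num) (by norm_num)]
    have h4 : 0.8109 ≤ Real.log (3 ^ 2 / 8 / (1 / 2)) := by
      rw [Real.le_log_iff_exp_le (by norm_num)]
      refine (exp_le_taylor (by norm_num) (by norm_num)).trans ?_
      norm_num
    have h6 : Real.exp 1.0304 ≤
        Real.exp (σ * Real.log (3 ^ 2 / 8 / (1 / 2))) := Real.exp_le_exp.2 (by nlinarith)
    have h7 := taylor_le_exp (x := 1.0304) (by norm_num)
    have h8 : 2.8015 ≤ Real.exp 1.0304 := by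
      refine le_trans ?_ h7; norm_num
    calc (1.815 : ℝ) ≤ 2.8015 * 0.6487 := by norm_num
      _ ≤ _ := mul_le_mul (h8.trans h6) (by linarith) (by norm_num) (Real.exp_pos _).le

end

/-! ### Diameters above `3` by a differential inequality, and the full complex lemma -/

section

variable {Ω : Type*} [MeasurableSpace Ω] {μ : Measure Ω} [IsProbabilityMeasure μ] {W : Ω → ℂ}

lemma exp_neg_nine_eighths_bounds :
    0.3246 ≤ Real.exp (-(9 / 8)) ∧ Real.exp (-(9 / 8)) ≤ 0.32467 := by
  constructor
  · have h1 := exp_le_taylor (x := 9 / 16) (by norm_num) (by norm_num)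
    have h2 : Real.exp (9 / 8) = Real.exp (9 / 16) ^ 2 := by
      rw [← Real.exp_nat_mul]; norm_num
    rw [Real.exp_neg, h2, ← one_div, le_div_iff₀ (by positivity)]
    have h3 := pow_le_pow_left₀ (Real.exp_pos _).le h1 2
    refine (mul_le_mul_of_nonneg_left h3 (by norm_num)).trans ?_
    norm_num
  · have h1 := exp_neg_le_taylor (x := 9 / 16) (by norm_num)
    have h2 : Real.exp (-(9 / 8)) = Real.exp (-(9 / 16)) ^ 2 := by
      rw [← Real.exp_nat_mul]; norm_num
    rw [h2]
    refine (pow_le_pow_left₀ (Real.exp_pos _).le h1 2).trans ?_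
    norm_num

lemma twoPointMGF_three_le {P : ℝ} (hP0 : 0 ≤ P) : twoPointMGF P 3 ≤ 2.739 := by
  have hU : Real.exp 3 ≤ 20.0856 := by
    have := exp_four_mul_le (x := 0.75) (by norm_num) (by norm_num)
    norm_num at this ⊢
    linarith
  refine (twoPointMGF_le_of_exp_le hP0 (by norm_num) hU).trans ?_
  have := exp_neg_le_taylor (x := 1 - 3 / (20.0856 - 1)) (by norm_num)
  rw [div_le_iff₀ (by norm_num), ← neg_sub]
  refine this.trans ?_
  norm_num

lemma twoPointMGF_le_mul_exp_of_three_le {P r : ℝ} (hP0 : 0 ≤ P) (hr : 3 ≤ r) :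
    twoPointMGF P r ≤ 0.8893 * Real.exp (r ^ 2 / 8) := by
  have h := antitoneOn_twoPointMGF_mul_exp hP0 (show (3 : ℝ) ∈ Set.Ici 0 by norm_num)
    (show r ∈ Set.Ici 0 by simp; linarith) hr
  simp only at h
  rw [show -(3 : ℝ) ^ 2 / 8 = -(9 / 8) by norm_num] at h
  have h1 : twoPointMGF P 3 * Real.exp (-(9 / 8)) ≤ 2.739 * 0.32467 :=
    mul_le_mul (twoPointMGF_three_le hP0) exp_neg_nine_eighths_bounds.2 (Real.exp_pos _).le
      (by norm_num)
  have h2 : twoPointMGF P r =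
      twoPointMGF P r * Real.exp (-r ^ 2 / 8) * Real.exp (r ^ 2 / 8) := by
    rw [mul_assoc, ← Real.exp_add, show -r ^ 2 / 8 + r ^ 2 / 8 = 0 by ring, Real.exp_zero, mul_one]
  rw [h2]
  exact mul_le_mul_of_nonneg_right (by linarith) (Real.exp_pos _).le

lemma norm_integral_mul_exp_le {r : ℝ} (hW : Measurable W)
    (h0 : ∫ ω, W ω ∂μ = 0) (hd : ∀ ω ω', ‖W ω - W ω'‖ ≤ 1) (hr : 3 ≤ r) :
    ‖∫ ω, W ω * Complex.exp (r * W ω) ∂μ‖ ≤ 0.8893 * Real.exp (r ^ 2 / 8) := by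
  have hi := integrable_of_diam_le (μ := μ) hW hd
  have hC := norm_le_of_integral_eq_zero h0 hd hi
  obtain ⟨hint, P, hP0, _, hP⟩ := integral_exp_le_twoPointMGF (μ := μ) (β := r)
    (X := fun ω => r * (W ω).re) ((Complex.measurable_re.comp hW).const_mul r)
    (by rw [integral_const_mul, integral_re_eq_zero h0 hi, mul_zero]) (by linarith)
    (fun ω ω' => by
      rw [← mul_sub, ← Complex.sub_re]
      have := (Complex.re_le_norm _).trans (hd ω ω')
      nlinarith)
  refine le_trans ?_ (hP.trans (twoPointMGF_le_mul_exp_of_three_le hP0 hr))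
  refine norm_integral_le_of_norm_le hint (Filter.Eventually.of_forall fun ω => ?_)
  rw [norm_mul, Complex.norm_exp]
  simp only [Complex.mul_re, Complex.ofReal_re, Complex.ofReal_im, zero_mul, sub_zero]
  exact mul_le_of_le_one_left (Real.exp_pos _).le (hC ω)

/-- The derivative of `E e^{rW}` is at most `0.8893 e^{r²/8}`, whereas `e^{r²/8}` grows at rate
`(r/4) e^{r²/8}`. Here `c` is the initial slack and `m` bounds the rate at which it may be used up.
-/
lemma norm_integral_exp_mul_sub_one_step {a b c m : ℝ} (hW : Measurable W)
    (h0 : ∫ ω, W ω ∂μ = 0) (hd : ∀ ω ω', ‖W ω - W ω'‖ ≤ 1) (ha : 3 ≤ a) (hab : a ≤ b)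
    (hstart : ‖∫ ω, Complex.exp (a * W ω) ∂μ - 1‖ ≤ Real.exp (a ^ 2 / 8) - 1 - c)
    (hm : ∀ r, a ≤ r → r ≤ b →
      0.8893 * Real.exp (r ^ 2 / 8) ≤ r / 4 * Real.exp (r ^ 2 / 8) + m) :
    ‖∫ ω, Complex.exp (b * W ω) ∂μ - 1‖ ≤ Real.exp (b ^ 2 / 8) - 1 - c + m * (b - a) := by
  have hC := norm_le_of_integral_eq_zero h0 hd (integrable_of_diam_le hW hd)
  have hg : ∀ r : ℝ, HasDerivAt (fun r : ℝ => ∫ ω, Complex.exp (r * W ω) ∂μ - 1)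
      (∫ ω, W ω * Complex.exp (r * W ω) ∂μ) r := fun r =>
    (hasDerivAt_integral_exp_mul hW hC (r : ℂ)).comp_ofReal.sub_const 1
  refine image_norm_le_of_norm_deriv_right_le_deriv_boundary
    (f := fun r : ℝ => ∫ ω, Complex.exp (r * W ω) ∂μ - 1)
    (f' := fun r : ℝ => ∫ ω, W ω * Complex.exp (r * W ω) ∂μ)
    (B := fun r => Real.exp (r ^ 2 / 8) - 1 - c + m * (r - a))
    (B' := fun r => r / 4 * Real.exp (r ^ 2 / 8) + m)
    (fun r _ => (hg r).continuousAt.continuousWithinAt) (fun r _ => (hg r).hasDerivWithinAt)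
    (by simpa using hstart) (fun r => ?_) (fun r hr => ?_) ⟨hab, le_rfl⟩
  · have h1 := ((((((hasDerivAt_id r).pow 2).div_const 8).exp).sub_const 1).sub_const c).add
      (((hasDerivAt_id r).sub_const a).const_mul m)
    refine h1.congr_deriv ?_
    simp
    ring
  · exact (norm_integral_mul_exp_le hW h0 hd (ha.trans hr.1)).trans (hm r hr.1 hr.2.le)

lemma norm_integral_exp_mul_sub_one_le_of_three_le {r : ℝ} (hW : Measurable W)
    (h0 : ∫ ω, W ω ∂μ = 0) (hd : ∀ ω ω', ‖W ω - W ω'‖ ≤ 1) (hr : 3 ≤ r) :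
    ‖∫ ω, Complex.exp (r * W ω) ∂μ - 1‖ ≤ Real.exp (r ^ 2 / 8) - 1 := by
  obtain ⟨hE1, hE2⟩ := exp_neg_nine_eighths_bounds
  have hE3 : 3.0801 ≤ Real.exp ((3 : ℝ) ^ 2 / 8) := by
    have h1 : Real.exp ((3 : ℝ) ^ 2 / 8) = Real.exp (9 / 16) ^ 2 := by
      rw [← Real.exp_nat_mul]; norm_num
    rw [h1]
    refine le_trans ?_ (pow_le_pow_left₀ (by norm_num) (taylor_le_exp (x := 9 / 16)
      (by norm_num)) 2)
    norm_num
  have h3 : ‖∫ ω, Complex.exp ((3 : ℝ) * W ω) ∂μ - 1‖ ≤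
      Real.exp ((3 : ℝ) ^ 2 / 8) - 1 - 0.265 := by
    refine (norm_integral_exp_sub_one_le_of_diam_le_three (hW.const_mul _)
      (by rw [integral_const_mul, h0, mul_zero]) (fun ω ω' => ?_)).trans (by linarith)
    rw [← mul_sub, norm_mul]
    simp only [Complex.norm_real, Real.norm_eq_abs]
    rw [abs_of_pos (by norm_num)]
    linarith [hd ω ω']
  -- Up to `3.6` the slack is used at rate at most `0.43`, and `0.43 · 0.6 = 0.258 < 0.265`. Beyond
  -- `3.6` one has `r/4 ≥ 0.9 > 0.8893`, so no slack is needed.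
  have hlow : ∀ b : ℝ, 3 ≤ b → b ≤ 3.6 → ‖∫ ω, Complex.exp (b * W ω) ∂μ - 1‖ ≤
      Real.exp (b ^ 2 / 8) - 1 := by
    intro b hb hb'
    have := norm_integral_exp_mul_sub_one_step (m := 0.43) hW h0 hd le_rfl hb h3 (fun r h1 h2 => by
      have h4 : Real.exp (-(9 / 8)) * (1 - (r ^ 2 - 9) / 8) ≤ Real.exp (-(r ^ 2 / 8)) := by
        rw [show -(r ^ 2 / 8) = -(9 / 8) + -((r ^ 2 - 9) / 8) by ring, Real.exp_add]
        refine mul_le_mul_of_nonneg_left ?_ (Real.exp_pos _).le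
        linarith [Real.add_one_le_exp (-((r ^ 2 - 9) / 8))]
      have h5 : 0.8893 - r / 4 ≤ 0.43 * Real.exp (-(r ^ 2 / 8)) := by
        have h7 : 0 ≤ 1 - (r ^ 2 - 9) / 8 := by nlinarith
        have h8 := mul_le_mul_of_nonneg_right hE1 h7
        nlinarith
      have h6 := mul_le_mul_of_nonneg_right h5 (Real.exp_pos (r ^ 2 / 8)).le
      rw [mul_assoc, ← Real.exp_add, neg_add_cancel, Real.exp_zero] at h6
      linarith)
    linarith
  rcases le_total r 3.6 with h | h
  · exact hlow r hr h
  · have := norm_integral_exp_mul_sub_one_step (a := 3.6) (b := r) (c := 0) (m := 0) hW h0 hd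
      (by norm_num) h (by simpa using hlow 3.6 (by norm_num) le_rfl) (fun s h1 h2 => by
        have := Real.exp_pos (s ^ 2 / 8)
        nlinarith)
    simpa using this

/-- **Hoeffding's lemma for complex random variables.** -/
theorem norm_integral_exp_sub_one_le {Z : Ω → ℂ} {α : ℝ} (hZ : Measurable Z)
    (h0 : ∫ ω, Z ω ∂μ = 0) (hd : ∀ ω ω', ‖Z ω - Z ω'‖ ≤ α) :
    ‖∫ ω, Complex.exp (Z ω) ∂μ - 1‖ ≤ Real.exp (α ^ 2 / 8) - 1 := by
  obtain ⟨ω₀⟩ := nonempty_of_isProbabilityMeasure μ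
  have hα : 0 ≤ α := (norm_nonneg _).trans (hd ω₀ ω₀)
  rcases eq_or_lt_of_le hα with rfl | hpos
  · have hC := norm_le_of_integral_eq_zero h0 hd (integrable_of_diam_le hZ hd)
    have : ∀ ω, Z ω = 0 := fun ω => norm_le_zero_iff.1 (hC ω)
    simp [this]
  rcases le_total α 1.57 with h1 | h1
  · obtain ⟨Q, hQ0, _, hQ⟩ := norm_integral_exp_sub_one_le_twoPointMGF hZ h0 hd hpos h1
    exact hQ.trans (by linarith [twoPointMGF_le_exp_sq hQ0 hα])
  have hW : Measurable fun ω => (α : ℂ)⁻¹ * Z ω := hZ.const_mul _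
  have hW0 : ∫ ω, (α : ℂ)⁻¹ * Z ω ∂μ = 0 := by rw [integral_const_mul, h0, mul_zero]
  have hWd : ∀ ω ω', ‖(α : ℂ)⁻¹ * Z ω - (α : ℂ)⁻¹ * Z ω'‖ ≤ 1 := fun ω ω' => by
    rw [← mul_sub, norm_mul, norm_inv, Complex.norm_real, Real.norm_eq_abs, abs_of_pos hpos,
      inv_mul_le_iff₀ hpos, mul_one]
    exact hd ω ω'
  have hα' : (α : ℂ) ≠ 0 := Complex.ofReal_ne_zero.2 hpos.ne'
  have e : ∀ ω, Z ω = α * ((α : ℂ)⁻¹ * Z ω) := fun ω => by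
    rw [← mul_assoc, mul_inv_cancel₀ hα', one_mul]
  have : ∫ ω, Complex.exp (Z ω) ∂μ = ∫ ω, Complex.exp (α * ((α : ℂ)⁻¹ * Z ω)) ∂μ := by
    simp_rw [← e]
  rw [this]
  rcases le_total α 3 with h2 | h2
  · exact norm_integral_exp_mul_sub_one_le_of_mem_Icc hW hW0 hWd h1 h2
  · exact norm_integral_exp_mul_sub_one_le_of_three_le hW hW0 hWd h2

end

/-! ### Bilinear covariance -/

section CrossCov

variable {𝕜 : Type*} [RCLike 𝕜]

lemma exists_norm_le_of_diam_le {Ω : Type*} {f : Ω → 𝕜} {a : ℝ} (hd : ∀ x y, ‖f x - f y‖ ≤ a) :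
    ∃ C, ∀ x, ‖f x‖ ≤ C := by
  rcases isEmpty_or_nonempty Ω with h | ⟨⟨x₀⟩⟩
  · exact ⟨0, fun x => (h.false x).elim⟩
  · refine ⟨‖f x₀‖ + a, fun x => ?_⟩
    calc ‖f x‖ = ‖f x₀ + (f x - f x₀)‖ := by ring_nf
      _ ≤ _ := (norm_add_le _ _).trans (by linarith [hd x x₀])

variable {Ω : Type*} [MeasurableSpace Ω] {μ : Measure Ω}

/-- The bilinear covariance `E f g - E f E g`. -/
noncomputable def crossCov (f g : Ω → 𝕜) (μ : Measure Ω) : 𝕜 :=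
  ∫ x, f x * g x ∂μ - (∫ x, f x ∂μ) * ∫ x, g x ∂μ

variable [IsProbabilityMeasure μ]

lemma integrable_of_forall_norm_sub_le {f : Ω → 𝕜} {a : ℝ} (hf : StronglyMeasurable f)
    (hd : ∀ x y, ‖f x - f y‖ ≤ a) : Integrable f μ := by
  obtain ⟨C, hC⟩ := exists_norm_le_of_diam_le hd
  exact Integrable.of_bound hf.aestronglyMeasurable C (Filter.Eventually.of_forall hC)

lemma integrable_mul_of_forall_norm_sub_le {f g : Ω → 𝕜} {a b : ℝ} (hf : StronglyMeasurable f)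
    (hg : StronglyMeasurable g) (hfd : ∀ x y, ‖f x - f y‖ ≤ a) (hgd : ∀ x y, ‖g x - g y‖ ≤ b) :
    Integrable (fun x => f x * g x) μ := by
  obtain ⟨C, hC⟩ := exists_norm_le_of_diam_le hfd
  exact (integrable_of_forall_norm_sub_le hg hgd).bdd_mul hf.aestronglyMeasurable
    (Filter.Eventually.of_forall hC)

/-- Comparison with an independent copy expresses the covariance through differences only, so that
oscillation bounds apply directly. -/
lemma two_mul_crossCov_eq {f g : Ω → 𝕜} (hf : Integrable f μ) (hg : Integrable g μ)
    (hfg : Integrable (fun x => f x * g x) μ) :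
    2 * crossCov f g μ = ∫ x, ∫ y, (f x - f y) * (g x - g y) ∂μ ∂μ := by
  have h1 : ∀ x, ∫ y, (f x - f y) * (g x - g y) ∂μ =
      f x * g x - f x * (∫ y, g y ∂μ) - (∫ y, f y ∂μ) * g x + ∫ y, f y * g y ∂μ := by
    intro x
    have e : ∀ y, (f x - f y) * (g x - g y) = f x * g x - f x * g y - f y * g x + f y * g y :=
      fun y => by ring
    simp_rw [e]
    rw [integral_add, integral_sub, integral_sub, integral_const_mul, integral_mul_const,
      integral_const]
    · simp only [probReal_univ, one_smul]
      rw [integral_const_mul]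
    · exact integrable_const _
    · exact hg.const_mul _
    · exact (integrable_const _).sub (hg.const_mul _)
    · exact hf.mul_const _
    · exact ((integrable_const _).sub (hg.const_mul _)).sub (hf.mul_const _)
    · exact hfg
  simp_rw [h1]
  rw [integral_add, integral_sub, integral_sub, integral_const_mul, integral_mul_const,
    integral_const, crossCov]
  · simp; ring
  · exact hfg
  · exact hf.mul_const _
  · exact hfg.sub (hf.mul_const _)
  · exact hg.const_mul _
  · exact (hfg.sub (hf.mul_const _)).sub (hg.const_mul _)
  · exact integrable_const _

lemma norm_crossCov_le {f g : Ω → 𝕜} {a b : ℝ} (hf : StronglyMeasurable f)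
    (hg : StronglyMeasurable g) (hfd : ∀ x y, ‖f x - f y‖ ≤ a) (hgd : ∀ x y, ‖g x - g y‖ ≤ b) :
    ‖crossCov f g μ‖ ≤ 1 / 2 * (a * b) := by
  obtain ⟨x₀⟩ := nonempty_of_isProbabilityMeasure μ
  have ha : 0 ≤ a := (norm_nonneg _).trans (hfd x₀ x₀)
  have h := two_mul_crossCov_eq (integrable_of_forall_norm_sub_le (μ := μ) hf hfd)
    (integrable_of_forall_norm_sub_le hg hgd) (integrable_mul_of_forall_norm_sub_le hf hg hfd hgd)
  have h2 : ‖(2 : 𝕜) * crossCov f g μ‖ ≤ a * b := by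
    rw [h]
    have h3 : ∀ x, ‖∫ y, (f x - f y) * (g x - g y) ∂μ‖ ≤ a * b := fun x => by
      simpa using norm_integral_le_of_norm_le_const (μ := μ) (Filter.Eventually.of_forall fun y =>
        (norm_mul_le (f x - f y) (g x - g y)).trans
          (mul_le_mul (hfd x y) (hgd x y) (norm_nonneg _) ha))
    simpa using norm_integral_le_of_norm_le_const (μ := μ) (Filter.Eventually.of_forall h3)
  rw [norm_mul, RCLike.norm_ofNat] at h2
  linarith

/-- From `f² - g² = (f - g)(f + g)`. For two slices of one function, the factor `f - g` brings in
the mixed differences. -/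
lemma crossCov_sub_crossCov {f g : Ω → 𝕜} {a b : ℝ} (hf : StronglyMeasurable f)
    (hg : StronglyMeasurable g) (hfd : ∀ x y, ‖f x - f y‖ ≤ a) (hgd : ∀ x y, ‖g x - g y‖ ≤ b) :
    crossCov f f μ - crossCov g g μ =
      crossCov (fun x => f x - g x) (fun x => f x + g x) μ := by
  have h1 := integrable_of_forall_norm_sub_le (μ := μ) hf hfd
  have h2 := integrable_of_forall_norm_sub_le (μ := μ) hg hgd
  have h3 := integrable_mul_of_forall_norm_sub_le (μ := μ) hf hf hfd hfd
  have h4 := integrable_mul_of_forall_norm_sub_le (μ := μ) hg hg hgd hgd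
  have e : ∀ x, (f x - g x) * (f x + g x) = f x * f x - g x * g x := fun x => by ring
  simp only [crossCov, e]
  rw [integral_sub h3 h4, integral_sub h1 h2, integral_add h1 h2]
  ring

end CrossCov

/-! ### Second order estimate for a single coordinate -/

section Step

variable {Ω : Type*} [MeasurableSpace Ω] {μ : Measure Ω} [IsProbabilityMeasure μ]

lemma integral_sq_le_of_diam_le {X : Ω → ℝ} {a : ℝ} (hX : Measurable X) (h0 : ∫ ω, X ω ∂μ = 0)
    (hd : ∀ ω ω', |X ω - X ω'| ≤ a) : ∫ ω, X ω ^ 2 ∂μ ≤ a ^ 2 / 4 := by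
  have hne : Nonempty Ω := nonempty_of_isProbabilityMeasure μ
  have hlow : ∀ ω ω', X ω - a ≤ X ω' := fun ω ω' => by linarith [(abs_le.1 (hd ω ω')).2]
  have hbdd : BddBelow (Set.range X) := by
    obtain ⟨ω₀⟩ := hne
    exact ⟨X ω₀ - a, by rintro _ ⟨ω, rfl⟩; exact hlow ω₀ ω⟩
  have h := variance_le_sq_of_bounded (μ := μ) (X := X) (a := ⨅ ω, X ω) (b := (⨅ ω, X ω) + a)
    (Filter.Eventually.of_forall fun ω => ⟨ciInf_le hbdd ω, by
      linarith [le_ciInf (f := X) (hlow ω)]⟩) hX.aemeasurable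
  rw [variance_eq_integral hX.aemeasurable, h0] at h
  simp only [sub_zero, add_sub_cancel_left] at h
  linarith

/-- After a rotation by `u` the second moment is real and nonnegative. Then `Re (uD)² ≤ (Re uD)²`,
and the variance of a real variable of range length `a` is at most `a²/4`. -/
lemma norm_integral_sq_le {D : Ω → ℂ} {a : ℝ} (hD : Measurable D) (h0 : ∫ ω, D ω ∂μ = 0)
    (hd : ∀ ω ω', ‖D ω - D ω'‖ ≤ a) : ‖∫ ω, D ω ^ 2 ∂μ‖ ≤ a ^ 2 / 4 := by
  set N := ∫ ω, D ω ^ 2 ∂μ with hN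
  set u : ℂ := Complex.exp ((-N.arg / 2 : ℝ) * Complex.I) with hu
  have hu1 : ‖u‖ = 1 := Complex.norm_exp_ofReal_mul_I _
  have hd' : ∀ ω ω', ‖u * D ω - u * D ω'‖ ≤ a := fun ω ω' => by
    rw [← mul_sub, norm_mul, hu1, one_mul]; exact hd ω ω'
  have hm : Measurable fun ω => u * D ω := hD.const_mul _
  have hi : Integrable (fun ω => u * D ω) μ := integrable_of_diam_le hm hd'
  have h1 : ∫ ω, (u * D ω) ^ 2 ∂μ = ‖N‖ := by
    simp_rw [mul_pow]
    rw [integral_const_mul, ← hN]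
    nth_rewrite 1 [← Complex.norm_mul_exp_arg_mul_I N]
    rw [mul_left_comm, hu, ← Complex.exp_nat_mul, ← Complex.exp_add]
    push_cast
    rw [show 2 * (-(N.arg : ℂ) / 2 * Complex.I) + N.arg * Complex.I = 0 by ring]
    simp
  have hi2 : Integrable (fun ω => (u * D ω) ^ 2) μ := by
    simp_rw [sq]
    exact integrable_mul_of_forall_norm_sub_le hm.stronglyMeasurable hm.stronglyMeasurable hd' hd'
  have hre : Measurable fun ω => (u * D ω).re := Complex.measurable_re.comp hm
  have hred : ∀ ω ω', |(u * D ω).re - (u * D ω').re| ≤ a := fun ω ω' => by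
    rw [← Complex.sub_re]
    exact (Complex.abs_re_le_norm _).trans (hd' ω ω')
  have h2 : ‖N‖ = ∫ ω, ((u * D ω) ^ 2).re ∂μ := by
    have := integral_re hi2
    simp only [RCLike.re_eq_complex_re] at this
    rw [this, h1, Complex.ofReal_re]
  rw [h2]
  refine le_trans (integral_mono hi2.re ?_ fun ω => ?_) (integral_sq_le_of_diam_le hre
    (integral_re_eq_zero (by rw [integral_const_mul, h0, mul_zero]) hi) hred)
  · simp_rw [sq]
    exact integrable_mul_of_forall_norm_sub_le hre.stronglyMeasurable hre.stronglyMeasurable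
      hred hred
  · simp only [sq, Complex.mul_re (u * D ω)]
    nlinarith [mul_self_nonneg (u * D ω).im]

lemma norm_exp_sub_taylor_two_le {z : ℂ} (hz : ‖z‖ ≤ 1) :
    ‖Complex.exp z - (1 + z + z ^ 2 / 2)‖ ≤ 2 / 9 * ‖z‖ ^ 3 := by
  have h := Complex.exp_bound hz (n := 3) (by norm_num)
  simp only [Finset.sum_range_succ, Finset.sum_range_zero] at h
  norm_num [Nat.factorial] at h
  linarith

lemma exp_sub_one_bound {z : ℂ} {w : ℂ} {a b : ℝ} (hw : ‖w‖ ≤ a)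
    (hz : ‖z - 1‖ ≤ Real.exp b - 1) :
    ‖Complex.exp w * z - 1‖ ≤ Real.exp (a + b) - 1 := by
  have h1 : ‖Complex.exp w‖ ≤ Real.exp a := by
    rw [Complex.norm_exp]
    exact Real.exp_le_exp.2 ((Complex.re_le_norm w).trans hw)
  have h2 : ‖Complex.exp w - 1‖ ≤ Real.exp a - 1 := by
    have := Complex.norm_exp_sub_sum_le_exp_norm_sub_sum w 1
    simp only [Finset.sum_range_one, pow_zero, Nat.factorial_zero, Nat.cast_one, div_one] at this
    exact this.trans (by linarith [Real.exp_le_exp.2 hw])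
  have h3 : 0 ≤ Real.exp b - 1 := (norm_nonneg _).trans hz
  calc ‖Complex.exp w * z - 1‖ = ‖Complex.exp w * (z - 1) + (Complex.exp w - 1)‖ := by ring_nf
    _ ≤ Real.exp a * (Real.exp b - 1) + (Real.exp a - 1) :=
        (norm_add_le _ _).trans (add_le_add (by
          rw [norm_mul]
          exact mul_le_mul h1 hz (norm_nonneg _) (Real.exp_pos _).le) h2)
    _ = _ := by rw [Real.exp_add]; ring

variable {D T : Ω → ℂ} {α q : ℝ}

/-- The complex Hoeffding lemma is applied to `D + T/2`, and the factor `exp (-E D²/2)` is estimated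
separately. The cancellation of second order terms is lost, so this serves only when `α` or `q/α` is
not small. -/
lemma norm_integral_exp_quadratic_sub_one_le_crude (hD : Measurable D) (hT : Measurable T)
    (hD0 : ∫ ω, D ω ∂μ = 0) (hT0 : ∫ ω, T ω ∂μ = 0) (hDd : ∀ ω ω', ‖D ω - D ω'‖ ≤ α)
    (hTd : ∀ ω ω', ‖T ω - T ω'‖ ≤ q) :
    ‖∫ ω, Complex.exp (D ω + T ω / 2 - (∫ ω', D ω' ^ 2 ∂μ) / 2) ∂μ - 1‖ ≤
      Real.exp (α ^ 2 / 8 + (α + q / 2) ^ 2 / 8) - 1 := by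
  have hDi := integrable_of_diam_le (μ := μ) hD hDd
  have hTi := integrable_of_diam_le (μ := μ) hT hTd
  have h1 := norm_integral_exp_sub_one_le (μ := μ) (Z := fun ω => D ω + T ω / 2) (α := α + q / 2)
    (hD.add (hT.div_const 2)) (by rw [integral_add hDi (hTi.div_const 2), integral_div, hD0, hT0]; simp)
    (fun ω ω' => by
      calc ‖D ω + T ω / 2 - (D ω' + T ω' / 2)‖ = ‖(D ω - D ω') + (T ω - T ω') / 2‖ := by ring_nf
        _ ≤ α + q / 2 := by
          refine (norm_add_le _ _).trans (add_le_add (hDd ω ω') ?_)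
          rw [norm_div, Complex.norm_ofNat]
          linarith [hTd ω ω'])
  have h2 : ‖-((∫ ω', D ω' ^ 2 ∂μ) / 2)‖ ≤ α ^ 2 / 8 := by
    rw [norm_neg, norm_div, Complex.norm_ofNat]
    linarith [norm_integral_sq_le hD hD0 hDd]
  have h3 := exp_sub_one_bound h2 h1
  rw [← integral_const_mul] at h3
  simp_rw [← Complex.exp_add] at h3
  refine le_trans (le_of_eq ?_) h3
  congr 3
  funext ω
  congr 1
  ring

/-- In the second order Taylor expansion `-E D²/2` cancels the mean of `D²/2`. What remains is
`E(DT)/2 + E(T²)/8 + (E D²)²/8` and a cubic remainder, controlled by the second absolute moment of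
`D + T/2`. -/
lemma norm_integral_exp_quadratic_sub_one_le_fine (hD : Measurable D) (hT : Measurable T)
    (hD0 : ∫ ω, D ω ∂μ = 0) (hT0 : ∫ ω, T ω ∂μ = 0) (hDd : ∀ ω ω', ‖D ω - D ω'‖ ≤ α)
    (hTd : ∀ ω ω', ‖T ω - T ω'‖ ≤ q) (hα : α ≤ 0.52) (hq : q ≤ α / 2) :
    ‖∫ ω, Complex.exp (D ω + T ω / 2 - (∫ ω', D ω' ^ 2 ∂μ) / 2) ∂μ - 1‖ ≤
      α * q / 4 + q ^ 2 / 16 + α ^ 4 / 128 +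
        2 / 9 * (α + q / 2 + α ^ 2 / 8) * (5 / 8 * (α + q / 2) ^ 2 + 5 / 64 * α ^ 4) := by
  obtain ⟨ω₀⟩ := nonempty_of_isProbabilityMeasure μ
  have hα0 : 0 ≤ α := (norm_nonneg _).trans (hDd ω₀ ω₀)
  have hq0 : 0 ≤ q := (norm_nonneg _).trans (hTd ω₀ ω₀)
  have hDi := integrable_of_diam_le (μ := μ) hD hDd
  have hTi := integrable_of_diam_le (μ := μ) hT hTd
  have hDD := integrable_mul_of_forall_norm_sub_le (μ := μ) hD.stronglyMeasurable
    hD.stronglyMeasurable hDd hDd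
  have hDT := integrable_mul_of_forall_norm_sub_le (μ := μ) hD.stronglyMeasurable
    hT.stronglyMeasurable hDd hTd
  have hTT := integrable_mul_of_forall_norm_sub_le (μ := μ) hT.stronglyMeasurable
    hT.stronglyMeasurable hTd hTd
  set N := ∫ ω, D ω ^ 2 ∂μ with hN
  have hN1 : ‖N‖ ≤ α ^ 2 / 4 := norm_integral_sq_le hD hD0 hDd
  have hN' : ∫ ω, D ω * D ω ∂μ = N := by simp_rw [hN, sq]
  have hcDT : ‖∫ ω, D ω * T ω ∂μ‖ ≤ 1 / 2 * (α * q) := by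
    have := norm_crossCov_le (μ := μ) hD.stronglyMeasurable hT.stronglyMeasurable hDd hTd
    simpa [crossCov, hD0, hT0] using this
  have hcTT : ‖∫ ω, T ω * T ω ∂μ‖ ≤ 1 / 2 * (q * q) := by
    have := norm_crossCov_le (μ := μ) hT.stronglyMeasurable hT.stronglyMeasurable hTd hTd
    simpa [crossCov, hD0, hT0] using this
  set W0 : Ω → ℂ := fun ω => D ω + T ω / 2 with hW0
  have hW0m : Measurable W0 := hD.add (hT.div_const 2)
  have hW0i : Integrable W0 μ := hDi.add (hTi.div_const 2)
  have hW00 : ∫ ω, W0 ω ∂μ = 0 := by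
    rw [hW0, integral_add hDi (hTi.div_const 2), integral_div, hD0, hT0]; simp
  have hW0d : ∀ ω ω', ‖W0 ω - W0 ω'‖ ≤ α + q / 2 := fun ω ω' => by
    calc ‖D ω + T ω / 2 - (D ω' + T ω' / 2)‖ = ‖(D ω - D ω') + (T ω - T ω') / 2‖ := by ring_nf
      _ ≤ α + q / 2 := by
        refine (norm_add_le _ _).trans (add_le_add (hDd ω ω') ?_)
        rw [norm_div, Complex.norm_ofNat]
        linarith [hTd ω ω']
  have hW0b := norm_le_of_integral_eq_zero hW00 hW0d hW0i
  have hcc : ∀ ω ω', ‖(starRingEnd ℂ) (W0 ω) - (starRingEnd ℂ) (W0 ω')‖ ≤ α + q / 2 :=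
    fun ω ω' => by rw [← map_sub, Complex.norm_conj]; exact hW0d ω ω'
  have hcm : Measurable fun ω => (starRingEnd ℂ) (W0 ω) := Complex.continuous_conj.measurable.comp hW0m
  have hns : ∀ ω, W0 ω * (starRingEnd ℂ) (W0 ω) = ((‖W0 ω‖ ^ 2 : ℝ) : ℂ) := fun ω => by
    rw [Complex.mul_conj, Complex.normSq_eq_norm_sq]
  have hsqi : Integrable (fun ω => ‖W0 ω‖ ^ 2) μ := by
    refine Integrable.of_bound (hW0m.norm.pow_const 2).aestronglyMeasurable ((α + q / 2) ^ 2)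
      (Filter.Eventually.of_forall fun ω => ?_)
    rw [norm_pow, norm_norm]
    exact pow_le_pow_left₀ (norm_nonneg _) (hW0b ω) 2
  -- The second absolute moment is the covariance of `W0` with its conjugate.
  have hsq : ∫ ω, ‖W0 ω‖ ^ 2 ∂μ ≤ 1 / 2 * (α + q / 2) ^ 2 := by
    have := norm_crossCov_le (μ := μ) hW0m.stronglyMeasurable hcm.stronglyMeasurable hW0d hcc
    rw [crossCov, hW00, zero_mul, sub_zero] at this
    simp_rw [hns] at this
    rw [integral_complex_ofReal, Complex.norm_real] at this
    linarith [(Real.le_norm_self _).trans this]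
  set w := α + q / 2 + α ^ 2 / 8 with hw
  have hw1 : w ≤ 1 := by rw [hw]; nlinarith
  have hw0 : 0 ≤ w := by positivity
  have hNb : ‖N / 2‖ ≤ α ^ 2 / 8 := by rw [norm_div, Complex.norm_ofNat]; linarith
  have hWb : ∀ ω, ‖W0 ω - N / 2‖ ≤ w := fun ω =>
    (norm_sub_le _ _).trans (add_le_add (hW0b ω) hNb)
  have hrem : ∀ ω, ‖Complex.exp (W0 ω - N / 2) -
      (1 + (W0 ω - N / 2) + (W0 ω - N / 2) ^ 2 / 2)‖ ≤
        2 / 9 * w * (5 / 4 * ‖W0 ω‖ ^ 2 + 5 / 64 * α ^ 4) := fun ω => by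
    refine (norm_exp_sub_taylor_two_le ((hWb ω).trans hw1)).trans ?_
    -- The weights come from `2xy ≤ x²/4 + 4y²` with `x = ‖W0 ω‖` and `y = α²/8`.
    have h1 : ‖W0 ω - N / 2‖ ^ 2 ≤ 5 / 4 * ‖W0 ω‖ ^ 2 + 5 / 64 * α ^ 4 := by
      have h2 : ‖W0 ω - N / 2‖ ≤ ‖W0 ω‖ + α ^ 2 / 8 :=
        (norm_sub_le _ _).trans (add_le_add le_rfl hNb)
      have h3 := pow_le_pow_left₀ (norm_nonneg _) h2 2
      nlinarith [sq_nonneg (‖W0 ω‖ / 2 - α ^ 2 / 4)]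
    calc 2 / 9 * ‖W0 ω - N / 2‖ ^ 3 = 2 / 9 * (‖W0 ω - N / 2‖ * ‖W0 ω - N / 2‖ ^ 2) := by ring
      _ ≤ 2 / 9 * (w * (5 / 4 * ‖W0 ω‖ ^ 2 + 5 / 64 * α ^ 4)) := by
        refine mul_le_mul_of_nonneg_left ?_ (by norm_num)
        exact mul_le_mul (hWb ω) h1 (by positivity) hw0
      _ = _ := by ring
  have hbi : Integrable (fun ω => 2 / 9 * w * (5 / 4 * ‖W0 ω‖ ^ 2 + 5 / 64 * α ^ 4)) μ :=
    ((hsqi.const_mul _).add (integrable_const _)).const_mul _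
  have hbound := norm_integral_le_of_norm_le hbi (Filter.Eventually.of_forall hrem)
  rw [integral_const_mul, integral_add (hsqi.const_mul _) (integrable_const _),
    integral_const_mul] at hbound
  simp only [integral_const, probReal_univ, one_smul] at hbound
  have hpoly : ∀ ω, 1 + (W0 ω - N / 2) + (W0 ω - N / 2) ^ 2 / 2 =
      (1 - N / 2 + N ^ 2 / 8) + (1 - N / 2) * D ω + (1 - N / 2) / 2 * T ω +
        1 / 2 * (D ω * D ω) + 1 / 2 * (D ω * T ω) + 1 / 8 * (T ω * T ω) := fun ω => by
    simp only [hW0]; ring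
  have hpint : Integrable (fun ω => 1 + (W0 ω - N / 2) + (W0 ω - N / 2) ^ 2 / 2) μ ∧
      ∫ ω, (1 + (W0 ω - N / 2) + (W0 ω - N / 2) ^ 2 / 2) ∂μ =
        1 + (N ^ 2 / 8 + 1 / 2 * ∫ ω, D ω * T ω ∂μ + 1 / 8 * ∫ ω, T ω * T ω ∂μ) := by
    simp_rw [hpoly]
    have i1 := (integrable_const (μ := μ) (1 - N / 2 + N ^ 2 / 8)).add (hDi.const_mul (1 - N / 2))
    have i2 := i1.add (hTi.const_mul ((1 - N / 2) / 2))
    have i3 := i2.add (hDD.const_mul (1 / 2))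
    have i4 := i3.add (hDT.const_mul (1 / 2))
    have i5 := i4.add (hTT.const_mul (1 / 8))
    refine ⟨i5, ?_⟩
    refine (integral_add i4 (hTT.const_mul (1 / 8))).trans ?_
    refine (congrArg₂ (· + ·) (integral_add i3 (hDT.const_mul (1 / 2))) rfl).trans ?_
    refine (congrArg₂ (· + ·) (congrArg₂ (· + ·) (integral_add i2 (hDD.const_mul (1 / 2))) rfl)
      rfl).trans ?_
    refine (congrArg₂ (· + ·) (congrArg₂ (· + ·) (congrArg₂ (· + ·)
      (integral_add i1 (hTi.const_mul ((1 - N / 2) / 2))) rfl) rfl) rfl).trans ?_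
    refine (congrArg₂ (· + ·) (congrArg₂ (· + ·) (congrArg₂ (· + ·) (congrArg₂ (· + ·)
      (integral_add (integrable_const (μ := μ) (1 - N / 2 + N ^ 2 / 8))
        (hDi.const_mul (1 - N / 2))) rfl) rfl) rfl) rfl).trans ?_
    simp only [integral_const_mul, hD0, hT0, hN', integral_const, probReal_univ, one_smul]
    ring
  have hexpi : Integrable (fun ω => Complex.exp (W0 ω - N / 2)) μ :=
    integrable_exp_of_norm_le (hW0m.sub_const _) hWb
  rw [integral_sub hexpi hpint.1, hpint.2] at hbound
  set c := N ^ 2 / 8 + 1 / 2 * ∫ ω, D ω * T ω ∂μ + 1 / 8 * ∫ ω, T ω * T ω ∂μ with hc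
  have hcb : ‖c‖ ≤ α ^ 4 / 128 + 1 / 4 * (α * q) + 1 / 16 * (q * q) := by
    refine (norm_add₃_le).trans ?_
    rw [norm_div, norm_pow, norm_mul, norm_mul, norm_div, norm_div, norm_one, Complex.norm_ofNat,
      Complex.norm_ofNat]
    have : ‖N‖ ^ 2 ≤ (α ^ 2 / 4) ^ 2 := pow_le_pow_left₀ (norm_nonneg _) hN1 2
    linarith
  have hfin : ‖∫ ω, Complex.exp (W0 ω - N / 2) ∂μ - 1‖ ≤
      ‖∫ ω, Complex.exp (W0 ω - N / 2) ∂μ - (1 + c)‖ + ‖c‖ := by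
    refine le_trans (le_of_eq (congrArg norm ?_)) (norm_add_le _ _)
    exact (show ∀ a c : ℂ, a - 1 = a - (1 + c) + c from fun a c => by ring) _ _
  have hmono : 2 / 9 * w * (5 / 4 * ∫ ω, ‖W0 ω‖ ^ 2 ∂μ + 5 / 64 * α ^ 4) ≤
      2 / 9 * w * (5 / 8 * (α + q / 2) ^ 2 + 5 / 64 * α ^ 4) :=
    mul_le_mul_of_nonneg_left (by linarith) (by positivity)
  linarith

/-- The purely quadratic part of the crude exponent is `α²/4`. For `α ≥ 0.52` it is at most `α³/6 +
5α⁴/8`, and for `q ≥ α/2` it is absorbed by the spare multiples of `αq` and `q²`. -/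
lemma step_exponent_crude_le (hα0 : 0 ≤ α) (hq0 : 0 ≤ q) (h : 0.52 ≤ α ∨ α / 2 ≤ q) :
    α ^ 2 / 8 + (α + q / 2) ^ 2 / 8 ≤
      α ^ 3 / 6 + α * q / 3 + 5 / 8 * α ^ 4 + 5 / 8 * q ^ 2 := by
  have h3 : 0 ≤ α ^ 3 := by positivity
  have h4 : 0 ≤ α ^ 4 := by positivity
  rcases h with h | h
  · have h5 : α ^ 2 / 4 ≤ α ^ 3 / 6 + 5 / 8 * α ^ 4 := by
      have : 1 / 4 ≤ α / 6 + 5 / 8 * α ^ 2 := by nlinarith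
      nlinarith [sq_nonneg α]
    nlinarith [mul_nonneg hα0 hq0, sq_nonneg q]
  · nlinarith [mul_nonneg hα0 hq0, sq_nonneg q]

lemma step_exponent_fine_le (hα0 : 0 ≤ α) (hq0 : 0 ≤ q) (hα : α ≤ 0.52) (hq : q ≤ α / 2) :
    α * q / 4 + q ^ 2 / 16 + α ^ 4 / 128 +
        2 / 9 * (α + q / 2 + α ^ 2 / 8) * (5 / 8 * (α + q / 2) ^ 2 + 5 / 64 * α ^ 4) ≤
      α ^ 3 / 6 + α * q / 3 + 5 / 8 * α ^ 4 + 5 / 8 * q ^ 2 := by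
  have hαq := mul_nonneg hα0 hq0
  have e1 : (α + q / 2) ^ 2 ≤ α ^ 2 + 9 / 8 * (α * q) := by nlinarith
  have e2 : α ^ 2 ≤ 0.28 := by nlinarith
  have e3 : 5 / 8 * (α + q / 2) ^ 2 + 5 / 64 * α ^ 4 ≤
      5 / 8 * α ^ 2 + 5 / 64 * α ^ 4 + 45 / 64 * (α * q) := by linarith
  have e4 : α + q / 2 + α ^ 2 / 8 ≤ 1.065 * α + q / 2 := by nlinarith
  have e5 : (α + q / 2 + α ^ 2 / 8) * (5 / 8 * (α + q / 2) ^ 2 + 5 / 64 * α ^ 4) ≤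
      (α + α ^ 2 / 8 + q / 2) * (5 / 8 * α ^ 2 + 5 / 64 * α ^ 4 + 45 / 64 * (α * q)) :=
    (mul_le_mul_of_nonneg_left e3 (by positivity)).trans (le_of_eq (by ring))
  have e6 : α ^ 5 ≤ 0.52 * α ^ 4 := by nlinarith [pow_nonneg hα0 4]
  have e7 : α ^ 6 ≤ 0.28 * α ^ 4 := by nlinarith [pow_nonneg hα0 4]
  have e8 : α ^ 2 * q ≤ 1 / 2 * α ^ 4 + 1 / 2 * q ^ 2 := by nlinarith [sq_nonneg (α ^ 2 - q)]
  have e9 : α ^ 3 * q ≤ 0.52 * (α ^ 2 * q) := by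
    nlinarith [mul_nonneg (mul_nonneg hα0 hα0) hq0]
  have e10 : α ^ 4 * q ≤ 0.28 * (α ^ 2 * q) := by
    nlinarith [mul_nonneg (mul_nonneg hα0 hα0) hq0]
  have e11 : α * q ^ 2 ≤ 0.52 * q ^ 2 := by nlinarith [sq_nonneg q]
  have e12 : 0 ≤ α ^ 4 := by positivity
  have e13 : 0 ≤ α ^ 3 := by positivity
  nlinarith

lemma norm_integral_exp_quadratic_sub_one_le (hD : Measurable D) (hT : Measurable T)
    (hD0 : ∫ ω, D ω ∂μ = 0) (hT0 : ∫ ω, T ω ∂μ = 0) (hDd : ∀ ω ω', ‖D ω - D ω'‖ ≤ α)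
    (hTd : ∀ ω ω', ‖T ω - T ω'‖ ≤ q) :
    ‖∫ ω, Complex.exp (D ω + T ω / 2 - (∫ ω', D ω' ^ 2 ∂μ) / 2) ∂μ - 1‖ ≤
      Real.exp (α ^ 3 / 6 + α * q / 3 + 5 / 8 * α ^ 4 + 5 / 8 * q ^ 2) - 1 := by
  obtain ⟨ω₀⟩ := nonempty_of_isProbabilityMeasure μ
  have hα0 : 0 ≤ α := (norm_nonneg _).trans (hDd ω₀ ω₀)
  have hq0 : 0 ≤ q := (norm_nonneg _).trans (hTd ω₀ ω₀)
  by_cases h : 0.52 ≤ α ∨ α / 2 ≤ q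
  · refine (norm_integral_exp_quadratic_sub_one_le_crude hD hT hD0 hT0 hDd hTd).trans ?_
    linarith [Real.exp_le_exp.2 (step_exponent_crude_le hα0 hq0 h)]
  · push Not at h
    refine (norm_integral_exp_quadratic_sub_one_le_fine hD hT hD0 hT0 hDd hTd h.1.le h.2.le).trans ?_
    refine (step_exponent_fine_le hα0 hq0 h.1.le h.2.le).trans ?_
    linarith [Real.add_one_le_exp (α ^ 3 / 6 + α * q / 3 + 5 / 8 * α ^ 4 + 5 / 8 * q ^ 2)]

lemma integral_exp_quadratic_le {D T : Ω → ℝ} (hD : Measurable D) (hT : Measurable T)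
    (hD0 : ∫ ω, D ω ∂μ = 0) (hT0 : ∫ ω, T ω ∂μ = 0) (hDd : ∀ ω ω', |D ω - D ω'| ≤ α)
    (hTd : ∀ ω ω', |T ω - T ω'| ≤ q) :
    ∫ ω, Real.exp (D ω + T ω / 2 - (∫ ω', D ω' ^ 2 ∂μ) / 2) ∂μ ≤
      Real.exp (α ^ 3 / 6 + α * q / 3 + 5 / 8 * α ^ 4 + 5 / 8 * q ^ 2) := by
  have h := norm_integral_exp_quadratic_sub_one_le (μ := μ) (D := fun ω => (D ω : ℂ))
    (T := fun ω => (T ω : ℂ)) (α := α) (q := q) (Complex.measurable_ofReal.comp hD)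
    (Complex.measurable_ofReal.comp hT)
    (by rw [integral_complex_ofReal, hD0, Complex.ofReal_zero])
    (by rw [integral_complex_ofReal, hT0, Complex.ofReal_zero])
    (fun ω ω' => by rw [← Complex.ofReal_sub, Complex.norm_real]; exact hDd ω ω')
    (fun ω ω' => by rw [← Complex.ofReal_sub, Complex.norm_real]; exact hTd ω ω')
  simp only [← Complex.ofReal_pow, integral_complex_ofReal] at h
  have e : ∀ ω, Complex.exp ((D ω : ℂ) + T ω / 2 - ((∫ ω', D ω' ^ 2 ∂μ : ℝ) : ℂ) / 2) =
      ((Real.exp (D ω + T ω / 2 - (∫ ω', D ω' ^ 2 ∂μ) / 2) : ℝ) : ℂ) := fun ω => by push_cast; rfl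
  simp_rw [e] at h
  rw [integral_complex_ofReal, ← Complex.ofReal_one, ← Complex.ofReal_sub, Complex.norm_real] at h
  linarith [(Real.le_norm_self _).trans h]

end Step

/-! ### One integration step, conditionally on a coordinate -/

section

variable {S : Type*} [MeasurableSpace S] {ν : Measure S} [IsProbabilityMeasure ν]

/-- Split the error into the mean of `h - e^E` and the error of replacing `E` by `E₀`. The two add
up exactly, since `e^δ (e^B - 1) + (e^δ - 1) = e^{B+δ} - 1`. The real exponent `e` is kept separate
because the weight `e^e` may exceed `|e^E|`. -/
lemma norm_integral_sub_exp_le {h E : S → ℂ} {e : S → ℝ} {E₀ : ℂ} {e₀ B δ : ℝ}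
    (hh : Integrable h ν) (hE : Integrable (fun s => Complex.exp (E s)) ν)
    (he : Integrable (fun s => Real.exp (e s)) ν)
    (hB : ∀ s, ‖h s - Complex.exp (E s)‖ ≤ Real.exp (e s) * (Real.exp B - 1))
    (h1 : ‖∫ s, Complex.exp (E s - E₀) ∂ν - 1‖ ≤ Real.exp δ - 1)
    (h2 : ∫ s, Real.exp (e s - e₀) ∂ν ≤ Real.exp δ) (h3 : E₀.re ≤ e₀) :
    ‖∫ s, h s ∂ν - Complex.exp E₀‖ ≤ Real.exp e₀ * (Real.exp (B + δ) - 1) := by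
  obtain ⟨s₀⟩ := nonempty_of_isProbabilityMeasure ν
  have hB1 : 0 ≤ Real.exp B - 1 :=
    (mul_nonneg_iff_of_pos_left (Real.exp_pos _)).1 ((norm_nonneg _).trans (hB s₀))
  have e1 : ∫ s, h s ∂ν - Complex.exp E₀ =
      ∫ s, (h s - Complex.exp (E s)) ∂ν +
        Complex.exp E₀ * (∫ s, Complex.exp (E s - E₀) ∂ν - 1) := by
    simp_rw [Complex.exp_sub]
    rw [integral_sub hh hE, integral_div]
    have := Complex.exp_ne_zero E₀
    field_simp
    ring
  have b1 : ‖∫ s, (h s - Complex.exp (E s)) ∂ν‖ ≤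
      Real.exp e₀ * Real.exp δ * (Real.exp B - 1) := by
    refine (norm_integral_le_of_norm_le (he.mul_const _) (Filter.Eventually.of_forall hB)).trans ?_
    rw [integral_mul_const]
    refine mul_le_mul_of_nonneg_right ?_ hB1
    simp_rw [Real.exp_sub] at h2
    rwa [integral_div, div_le_iff₀' (Real.exp_pos _)] at h2
  have b2 : ‖Complex.exp E₀ * (∫ s, Complex.exp (E s - E₀) ∂ν - 1)‖ ≤
      Real.exp e₀ * (Real.exp δ - 1) := by
    rw [norm_mul, Complex.norm_exp]
    exact mul_le_mul (Real.exp_le_exp.2 h3) h1 (norm_nonneg _) (Real.exp_pos _).le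
  rw [e1]
  refine (norm_add_le _ _).trans ((add_le_add b1 b2).trans (le_of_eq ?_))
  rw [Real.exp_add]
  ring

lemma integral_exp_le_exp_sq {X : S → ℝ} {α : ℝ} (hX : Measurable X) (h0 : ∫ ω, X ω ∂ν = 0)
    (hd : ∀ ω ω', |X ω - X ω'| ≤ α) : ∫ ω, Real.exp (X ω) ∂ν ≤ Real.exp (α ^ 2 / 8) := by
  have h := norm_integral_exp_sub_one_le (μ := ν) (Z := fun ω => (X ω : ℂ)) (α := α)
    (Complex.measurable_ofReal.comp hX)
    (by rw [integral_complex_ofReal, h0, Complex.ofReal_zero])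
    (fun ω ω' => by rw [← Complex.ofReal_sub, Complex.norm_real]; exact hd ω ω')
  simp_rw [← Complex.ofReal_exp] at h
  rw [integral_complex_ofReal, ← Complex.ofReal_one, ← Complex.ofReal_sub, Complex.norm_real] at h
  linarith [(Real.le_norm_self _).trans h]

lemma integrable_exp_of_forall_norm_sub_le {E : S → ℂ} {a : ℝ} (hE : Measurable E)
    (hd : ∀ s s', ‖E s - E s'‖ ≤ a) : Integrable (fun s => Complex.exp (E s)) ν := by
  obtain ⟨C, hC⟩ := exists_norm_le_of_diam_le hd
  exact integrable_exp_of_norm_le hE hC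

lemma integrable_real_exp_of_forall_abs_sub_le {e : S → ℝ} {a : ℝ} (he : Measurable e)
    (hd : ∀ s s', |e s - e s'| ≤ a) : Integrable (fun s => Real.exp (e s)) ν := by
  obtain ⟨C, hC⟩ := exists_norm_le_of_diam_le (𝕜 := ℝ) (f := e) hd
  refine Integrable.of_bound (Real.measurable_exp.comp he).aestronglyMeasurable (Real.exp C)
    (Filter.Eventually.of_forall fun s => ?_)
  rw [Real.norm_eq_abs, Real.abs_exp]
  exact Real.exp_le_exp.2 ((Real.le_norm_self _).trans (hC s))

lemma integral_sub_integral_eq_zero {𝕜 : Type*} [RCLike 𝕜] {m : S → 𝕜} (hm : Integrable m ν) :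
    ∫ s, (m s - ∫ s', m s' ∂ν) ∂ν = 0 := by
  rw [integral_sub hm (integrable_const _), integral_const]
  simp

lemma integral_sub_integral_sq {𝕜 : Type*} [RCLike 𝕜] {m : S → 𝕜} (hm : Integrable m ν)
    (hmm : Integrable (fun s => m s * m s) ν) :
    ∫ s, (m s - ∫ s', m s' ∂ν) ^ 2 ∂ν = crossCov m m ν := by
  set M := ∫ s', m s' ∂ν with hM
  have e : ∀ s, (m s - M) ^ 2 = m s * m s - 2 * M * m s + M * M := fun s => by ring
  simp_rw [e]
  have h2 := hm.const_mul (2 * M)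
  rw [integral_add (f := fun s => m s * m s - 2 * M * m s) (hmm.sub h2) (integrable_const _),
    integral_sub hmm h2, integral_const_mul, integral_const, crossCov, ← hM]
  simp
  ring

/-- One step of the first order estimate. -/
lemma norm_integral_sub_exp_mean_le {h m : S → ℂ} {α A : ℝ}
    (hh : Integrable h ν) (hm : Measurable m) (hmd : ∀ s s', ‖m s - m s'‖ ≤ α)
    (hA : ∀ s, ‖h s - Complex.exp (m s)‖ ≤ Real.exp (m s).re * (Real.exp A - 1)) :
    ‖∫ s, h s ∂ν - Complex.exp (∫ s, m s ∂ν)‖ ≤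
      Real.exp (∫ s, m s ∂ν).re * (Real.exp (A + α ^ 2 / 8) - 1) := by
  have hmi := integrable_of_diam_le (μ := ν) hm hmd
  have hred : ∀ s s', |(m s).re - (m s').re| ≤ α := fun s s' => by
    rw [← Complex.sub_re]; exact (Complex.abs_re_le_norm _).trans (hmd s s')
  have hrem : Measurable fun s => (m s).re := Complex.measurable_re.comp hm
  have hre : (∫ s, m s ∂ν).re = ∫ s, (m s).re ∂ν := (integral_re hmi).symm
  refine norm_integral_sub_exp_le hh (integrable_exp_of_forall_norm_sub_le hm hmd)
    (integrable_real_exp_of_forall_abs_sub_le hrem hred) hA ?_ ?_ le_rfl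
  · exact norm_integral_exp_sub_one_le (hm.sub_const _) (integral_sub_integral_eq_zero hmi)
      (fun s s' => by rw [sub_sub_sub_cancel_right]; exact hmd s s')
  · rw [hre]
    exact integral_exp_le_exp_sq (hrem.sub_const _) (integral_sub_integral_eq_zero hmi.re)
      (fun s s' => by rw [sub_sub_sub_cancel_right]; exact hred s s')

/-- One step of the second order estimate. -/
lemma norm_integral_sub_exp_mean_add_le {h m V : S → ℂ} {v : S → ℝ} {α q B : ℝ}
    (hh : Integrable h ν) (hm : Measurable m) (hV : Measurable V) (hv : Measurable v)
    (hmd : ∀ s s', ‖m s - m s'‖ ≤ α) (hVd : ∀ s s', ‖V s - V s'‖ ≤ q)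
    (hvd : ∀ s s', |v s - v s'| ≤ q)
    (hB : ∀ s, ‖h s - Complex.exp (m s + V s / 2)‖ ≤
      Real.exp ((m s).re + v s / 2) * (Real.exp B - 1))
    (hre : (∫ s, V s ∂ν + crossCov m m ν).re ≤
      ∫ s, v s ∂ν + crossCov (fun s => (m s).re) (fun s => (m s).re) ν) :
    ‖∫ s, h s ∂ν - Complex.exp (∫ s, m s ∂ν + (∫ s, V s ∂ν + crossCov m m ν) / 2)‖ ≤
      Real.exp ((∫ s, m s ∂ν).re +
        (∫ s, v s ∂ν + crossCov (fun s => (m s).re) (fun s => (m s).re) ν) / 2) *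
      (Real.exp (B + (α ^ 3 / 6 + α * q / 3 + 5 / 8 * α ^ 4 + 5 / 8 * q ^ 2)) - 1) := by
  have hmi := integrable_of_diam_le (μ := ν) hm hmd
  have hVi := integrable_of_diam_le (μ := ν) hV hVd
  have hvi := integrable_of_forall_norm_sub_le (μ := ν) hv.stronglyMeasurable hvd
  have hred : ∀ s s', |(m s).re - (m s').re| ≤ α := fun s s' => by
    rw [← Complex.sub_re]; exact (Complex.abs_re_le_norm _).trans (hmd s s')
  have hrem : Measurable fun s => (m s).re := Complex.measurable_re.comp hm
  have hmre : (∫ s, m s ∂ν).re = ∫ s, (m s).re ∂ν := (integral_re hmi).symm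
  have hmm := integrable_mul_of_forall_norm_sub_le (μ := ν) hm.stronglyMeasurable
    hm.stronglyMeasurable hmd hmd
  have hri : Integrable (fun s => (m s).re) ν := hmi.re
  have hrr := integrable_mul_of_forall_norm_sub_le (μ := ν) hrem.stronglyMeasurable
    hrem.stronglyMeasurable hred hred
  refine norm_integral_sub_exp_le (E := fun s => m s + V s / 2)
    (e := fun s => (m s).re + v s / 2) hh (integrable_exp_of_forall_norm_sub_le
      (a := α + q / 2) (hm.add (hV.div_const 2)) fun s s' => ?_)
    (integrable_real_exp_of_forall_abs_sub_le (a := α + q / 2) (hrem.add (hv.div_const 2))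
      fun s s' => ?_) hB ?_ ?_ ?_
  · calc ‖m s + V s / 2 - (m s' + V s' / 2)‖ = ‖(m s - m s') + (V s - V s') / 2‖ := by ring_nf
      _ ≤ α + q / 2 := by
        refine (norm_add_le _ _).trans (add_le_add (hmd s s') ?_)
        rw [norm_div, Complex.norm_ofNat]
        linarith [hVd s s']
  · have h1 := abs_le.1 (hred s s')
    have h2 := abs_le.1 (hvd s s')
    exact abs_le.2 ⟨by linarith [h1.1, h2.1], by linarith [h1.2, h2.2]⟩
  · have := norm_integral_exp_quadratic_sub_one_le (μ := ν) (hm.sub_const (∫ s, m s ∂ν))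
      (hV.sub_const (∫ s, V s ∂ν)) (integral_sub_integral_eq_zero hmi)
      (integral_sub_integral_eq_zero hVi)
      (fun s s' => by rw [sub_sub_sub_cancel_right]; exact hmd s s')
      (fun s s' => by rw [sub_sub_sub_cancel_right]; exact hVd s s')
    rw [integral_sub_integral_sq hmi hmm] at this
    refine le_trans (le_of_eq ?_) this
    congr 3
    funext s
    congr 1
    ring
  · have := integral_exp_quadratic_le (μ := ν) (hrem.sub_const (∫ s, (m s).re ∂ν))
      (hv.sub_const (∫ s, v s ∂ν)) (integral_sub_integral_eq_zero hri)
      (integral_sub_integral_eq_zero hvi)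
      (fun s s' => by rw [sub_sub_sub_cancel_right]; exact hred s s')
      (fun s s' => by rw [sub_sub_sub_cancel_right]; exact hvd s s')
    rw [integral_sub_integral_sq hri hrr] at this
    refine le_trans (le_of_eq ?_) this
    congr 1
    funext s
    rw [hmre]
    congr 1
    ring
  · rw [Complex.add_re, Complex.div_ofNat_re]
    linarith

variable {Y : Type*} [MeasurableSpace Y] {π : Measure Y} [IsProbabilityMeasure π]
  {𝕜 : Type*} [RCLike 𝕜]

lemma norm_integral_sub_integral_le {f g : Y → 𝕜} {a : ℝ} (hf : Integrable f π)
    (hg : Integrable g π) (h : ∀ y, ‖f y - g y‖ ≤ a) :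
    ‖∫ y, f y ∂π - ∫ y, g y ∂π‖ ≤ a := by
  rw [← integral_sub hf hg]
  simpa using norm_integral_le_of_norm_le_const (μ := π) (Filter.Eventually.of_forall h)

lemma integrable_integral_of_norm_le {f : S → Y → 𝕜} {C : ℝ}
    (hf : StronglyMeasurable (Function.uncurry f)) (hC : ∀ s y, ‖f s y‖ ≤ C) :
    Integrable (fun s => ∫ y, f s y ∂π) ν :=
  Integrable.of_bound hf.integral_prod_right.aestronglyMeasurable C
    (Filter.Eventually.of_forall fun s => by
      simpa using norm_integral_le_of_norm_le_const (μ := π) (Filter.Eventually.of_forall (hC s)))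

/-- Decomposition of a covariance by conditioning on the first coordinate. -/
lemma crossCov_disintegrate {f g : S → Y → 𝕜} {C C' : ℝ}
    (hf : StronglyMeasurable (Function.uncurry f)) (hg : StronglyMeasurable (Function.uncurry g))
    (hC : ∀ s y, ‖f s y‖ ≤ C) (hC' : ∀ s y, ‖g s y‖ ≤ C') :
    ∫ s, ∫ y, f s y * g s y ∂π ∂ν - (∫ s, ∫ y, f s y ∂π ∂ν) * ∫ s, ∫ y, g s y ∂π ∂ν =
      ∫ s, crossCov (f s) (g s) π ∂ν +
        crossCov (fun s => ∫ y, f s y ∂π) (fun s => ∫ y, g s y ∂π) ν := by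
  have h1 : Integrable (fun s => ∫ y, f s y * g s y ∂π) ν :=
    integrable_integral_of_norm_le (C := C * C') (hf.mul hg) fun s y => by
      rw [norm_mul]
      exact mul_le_mul (hC s y) (hC' s y) (norm_nonneg _) ((norm_nonneg _).trans (hC s y))
  have h2 : Integrable (fun s => (∫ y, f s y ∂π) * ∫ y, g s y ∂π) ν :=
    (integrable_integral_of_norm_le hg hC').bdd_mul hf.integral_prod_right.aestronglyMeasurable
      (c := C) (Filter.Eventually.of_forall fun s => by
        simpa using norm_integral_le_of_norm_le_const (μ := π)
          (Filter.Eventually.of_forall (hC s)))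
  simp only [crossCov]
  rw [integral_sub h1 h2]
  ring

lemma stronglyMeasurable_crossCov {f g : S → Y → 𝕜}
    (hf : StronglyMeasurable (Function.uncurry f)) (hg : StronglyMeasurable (Function.uncurry g)) :
    StronglyMeasurable fun s => crossCov (f s) (g s) π :=
  ((hf.mul hg).integral_prod_right (f := fun s y => f s y * g s y)).sub
    (hf.integral_prod_right.mul hg.integral_prod_right)

end

-- Oscillation bounds and covariances on finite products

universe u

section Coordinates

variable {E : Type*} [NormedAddCommGroup E]

/-- Changing the `k`-th coordinate changes `F` by at most `a k`. -/
def CoordBound {n : ℕ} {S : Fin n → Type*} (F : (∀ i, S i) → E) (a : Fin n → ℝ) : Prop :=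
  ∀ k, ∀ x y : ∀ i, S i, (∀ i, i ≠ k → y i = x i) → ‖F y - F x‖ ≤ a k

/-- The mixed second differences of `F` in the coordinates `j`, `k` are at most `D j k`. -/
def MixedBound {n : ℕ} {S : Fin n → Type*} (F : (∀ i, S i) → E) (D : Fin n → Fin n → ℝ) : Prop :=
  ∀ j k, j ≠ k → ∀ x xj xk xjk : ∀ i, S i,
    (∀ i, i ≠ k → xk i = x i) → (∀ i, i ≠ j → xj i = x i) →
    (∀ i, i ≠ k → xjk i = xj i) → (∀ i, i ≠ j → xjk i = xk i) →
    ‖F x - F xj - F xk + F xjk‖ ≤ D j k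

variable {n : ℕ} {S : Fin (n + 1) → Type*} {F : (∀ i, S i) → E} {p : Fin (n + 1)}

lemma insertNth_eq_of_ne_succAbove {s : S p} {y y' : ∀ j, S (p.succAbove j)} {k : Fin n}
    (h : ∀ i, i ≠ k → y' i = y i) (i : Fin (n + 1)) (hi : i ≠ p.succAbove k) :
    p.insertNth (α := S) s y' i = p.insertNth (α := S) s y i := by
  induction i using p.succAboveCases with
  | x => simp
  | p j =>
    rw [Fin.insertNth_apply_succAbove, Fin.insertNth_apply_succAbove]
    exact h j fun e => hi (by rw [e])

lemma insertNth_eq_of_ne {s s' : S p} {y : ∀ j, S (p.succAbove j)} (i : Fin (n + 1))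
    (hi : i ≠ p) : p.insertNth (α := S) s' y i = p.insertNth (α := S) s y i := by
  induction i using p.succAboveCases with
  | x => exact (hi rfl).elim
  | p j => rw [Fin.insertNth_apply_succAbove, Fin.insertNth_apply_succAbove]

lemma CoordBound.comp_insertNth {a : Fin (n + 1) → ℝ} (h : CoordBound F a) (s : S p) :
    CoordBound (fun y => F (p.insertNth s y)) (fun j => a (p.succAbove j)) :=
  fun _ _ _ hxy => h _ _ _ (insertNth_eq_of_ne_succAbove hxy)

lemma CoordBound.norm_insertNth_sub_le {a : Fin (n + 1) → ℝ} (h : CoordBound F a) (s s' : S p)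
    (y : ∀ j, S (p.succAbove j)) :
    ‖F (p.insertNth s y) - F (p.insertNth s' y)‖ ≤ a p :=
  h _ _ _ insertNth_eq_of_ne

lemma CoordBound.norm_sub_le : ∀ {n : ℕ} {S : Fin n → Type u} {F : (∀ i, S i) → E}
    {a : Fin n → ℝ}, CoordBound F a → ∀ x y, ‖F x - F y‖ ≤ ∑ k, a k
  | 0, S, F, a, _, x, y => by simp [Subsingleton.elim x y]
  | n + 1, S, F, a, h, x, y => by
    have h1 := (h.comp_insertNth (p := 0) (x 0)).norm_sub_le ((0 : Fin (n + 1)).removeNth x)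
      ((0 : Fin (n + 1)).removeNth y)
    have h2 := h.norm_insertNth_sub_le (p := 0) (x 0) (y 0) ((0 : Fin (n + 1)).removeNth y)
    simp only [Fin.insertNth_self_removeNth] at h1 h2
    rw [Fin.sum_univ_succAbove _ 0]
    set w := (0 : Fin (n + 1)).insertNth (α := S) (x 0) ((0 : Fin (n + 1)).removeNth y)
    calc ‖F x - F y‖ = ‖(F x - F w) + (F w - F y)‖ := by rw [sub_add_sub_cancel]
      _ ≤ _ := (norm_add_le _ _).trans (by linarith)

lemma MixedBound.comp_insertNth {D : Fin (n + 1) → Fin (n + 1) → ℝ} (h : MixedBound F D)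
    (s : S p) :
    MixedBound (fun y => F (p.insertNth s y)) (fun j k => D (p.succAbove j) (p.succAbove k)) :=
  fun _ _ hjk _ _ _ _ h1 h2 h3 h4 => h _ _ (fun e => hjk (Fin.succAbove_right_injective e)) _ _ _ _
    (insertNth_eq_of_ne_succAbove h1) (insertNth_eq_of_ne_succAbove h2)
    (insertNth_eq_of_ne_succAbove h3) (insertNth_eq_of_ne_succAbove h4)

/-- An increment in coordinate `j` of the difference of two slices is, up to sign, a mixed
difference in `j` and `p`. -/
lemma MixedBound.coordBound_sub {D : Fin (n + 1) → Fin (n + 1) → ℝ} (h : MixedBound F D)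
    (s s' : S p) :
    CoordBound (fun y => F (p.insertNth s y) - F (p.insertNth s' y))
      (fun j => D (p.succAbove j) p) := by
  intro j y y' hy
  have := h (p.succAbove j) p (Fin.succAbove_ne p j) (p.insertNth s y) (p.insertNth s y')
    (p.insertNth s' y) (p.insertNth s' y') insertNth_eq_of_ne (insertNth_eq_of_ne_succAbove hy)
    insertNth_eq_of_ne (insertNth_eq_of_ne_succAbove hy)
  rw [← norm_neg] at this
  refine le_trans (le_of_eq (congrArg norm ?_)) this
  exact (show ∀ a b c d : E, a - b - (c - d) = -(c - a - d + b) from fun a b c d => by abel) _ _ _ _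

end Coordinates

section PiMeasure

variable {𝕜 : Type*} [RCLike 𝕜]

lemma measurable_insertNth {n : ℕ} {S : Fin (n + 1) → Type u} [∀ i, MeasurableSpace (S i)]
    (p : Fin (n + 1)) :
    Measurable fun z : S p × (∀ j, S (p.succAbove j)) => p.insertNth (α := S) z.1 z.2 := by
  have h := (MeasurableEquiv.piFinSuccAbove S p).symm.measurable
  rw [MeasurableEquiv.piFinSuccAbove_symm_apply] at h
  exact h

lemma stronglyMeasurable_uncurry_insertNth {n : ℕ} {S : Fin (n + 1) → Type u}
    [∀ i, MeasurableSpace (S i)] {F : (∀ i, S i) → 𝕜} (hF : StronglyMeasurable F)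
    (p : Fin (n + 1)) :
    StronglyMeasurable (Function.uncurry fun (s : S p) (y : ∀ j, S (p.succAbove j)) =>
      F (p.insertNth s y)) :=
  hF.comp_measurable (measurable_insertNth p)

lemma stronglyMeasurable_comp_insertNth {n : ℕ} {S : Fin (n + 1) → Type u}
    [∀ i, MeasurableSpace (S i)] {F : (∀ i, S i) → 𝕜} (hF : StronglyMeasurable F)
    {p : Fin (n + 1)} (s : S p) : StronglyMeasurable fun y => F (p.insertNth s y) :=
  hF.comp_measurable ((measurable_insertNth p).comp measurable_prodMk_left)

lemma integral_pi_insertNth {n : ℕ} {S : Fin (n + 1) → Type u} [∀ i, MeasurableSpace (S i)]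
    (μ : ∀ i, Measure (S i)) [∀ i, IsProbabilityMeasure (μ i)] {F : (∀ i, S i) → 𝕜}
    (hF : Integrable F (Measure.pi μ)) (p : Fin (n + 1)) :
    ∫ x, F x ∂Measure.pi μ =
      ∫ s, ∫ y, F (p.insertNth s y) ∂Measure.pi (fun j => μ (p.succAbove j)) ∂μ p := by
  have h := (measurePreserving_piFinSuccAbove μ p).symm
  rw [← h.integral_comp', integral_prod]
  · rfl
  · exact h.integrable_comp_of_integrable hF

/-- By induction: a covariance is the mean conditional covariance plus the covariance of the
conditional means, and the latter depends on one coordinate only, which contributes `½ a₀ b₀`. -/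
lemma norm_crossCov_pi_le : ∀ {n : ℕ} {S : Fin n → Type u} [∀ i, MeasurableSpace (S i)]
    (μ : ∀ i, Measure (S i)) [∀ i, IsProbabilityMeasure (μ i)] {F G : (∀ i, S i) → 𝕜}
    {a b : Fin n → ℝ}, StronglyMeasurable F → StronglyMeasurable G → CoordBound F a →
    CoordBound G b → ‖crossCov F G (Measure.pi μ)‖ ≤ 1 / 2 * ∑ k, a k * b k
  | 0, S, _, μ, _, F, G, a, b, _, _, _, _ => by
    have hc : ∀ H : (∀ i, S i) → 𝕜, ∫ x, H x ∂Measure.pi μ = H (fun i => i.elim0) := fun H => by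
      rw [show H = fun _ => H (fun i => i.elim0) from
        funext fun x => congrArg H (Subsingleton.elim _ _), integral_const]
      simp
    simp [crossCov, hc]
  | n + 1, S, _, μ, _, F, G, a, b, hF, hG, ha, hb => by
    obtain ⟨C, hC⟩ := exists_norm_le_of_diam_le ha.norm_sub_le
    obtain ⟨C', hC'⟩ := exists_norm_le_of_diam_le hb.norm_sub_le
    have e := crossCov_disintegrate (ν := μ 0) (π := Measure.pi fun j => μ (Fin.succAbove 0 j))
      (stronglyMeasurable_uncurry_insertNth hF 0) (stronglyMeasurable_uncurry_insertNth hG 0)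
      (fun s y => hC _) (fun s y => hC' _)
    rw [crossCov, integral_pi_insertNth μ (integrable_of_forall_norm_sub_le hF ha.norm_sub_le) 0,
      integral_pi_insertNth μ (integrable_of_forall_norm_sub_le hG hb.norm_sub_le) 0,
      integral_pi_insertNth μ (integrable_mul_of_forall_norm_sub_le hF hG ha.norm_sub_le
        hb.norm_sub_le) 0, e, Fin.sum_univ_succAbove _ 0, mul_add, add_comm]
    refine (norm_add_le _ _).trans (add_le_add ?_ ?_)
    · refine norm_crossCov_le
        (stronglyMeasurable_uncurry_insertNth hF 0).integral_prod_right
        (stronglyMeasurable_uncurry_insertNth hG 0).integral_prod_right (fun s s' => ?_)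
        (fun s s' => ?_)
      · exact norm_integral_sub_integral_le
          (integrable_of_forall_norm_sub_le (stronglyMeasurable_comp_insertNth hF s)
            (ha.comp_insertNth s).norm_sub_le)
          (integrable_of_forall_norm_sub_le (stronglyMeasurable_comp_insertNth hF s')
            (ha.comp_insertNth s').norm_sub_le) (ha.norm_insertNth_sub_le s s')
      · exact norm_integral_sub_integral_le
          (integrable_of_forall_norm_sub_le (stronglyMeasurable_comp_insertNth hG s)
            (hb.comp_insertNth s).norm_sub_le)
          (integrable_of_forall_norm_sub_le (stronglyMeasurable_comp_insertNth hG s')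
            (hb.comp_insertNth s').norm_sub_le) (hb.norm_insertNth_sub_le s s')
    · simpa using norm_integral_le_of_norm_le_const (μ := μ 0) (Filter.Eventually.of_forall fun s =>
        norm_crossCov_pi_le (fun j => μ (Fin.succAbove 0 j)) (stronglyMeasurable_comp_insertNth hF s)
          (stronglyMeasurable_comp_insertNth hG s) (ha.comp_insertNth s) (hb.comp_insertNth s))

end PiMeasure

/-! ### Induction over the coordinates -/

section

variable {Ω : Type*} [MeasurableSpace Ω] {μ : Measure Ω} [IsProbabilityMeasure μ]

lemma re_crossCov_self_eq {F : Ω → ℂ} {a : ℝ} (hF : Measurable F)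
    (hd : ∀ x y, ‖F x - F y‖ ≤ a) :
    (crossCov F F μ).re =
      crossCov (fun x => (F x).re) (fun x => (F x).re) μ -
        crossCov (fun x => (F x).im) (fun x => (F x).im) μ := by
  have hi := integrable_of_diam_le (μ := μ) hF hd
  have hred : ∀ x y, ‖(F x).re - (F y).re‖ ≤ a := fun x y => by
    rw [← Complex.sub_re]; exact (Complex.abs_re_le_norm _).trans (hd x y)
  have himd : ∀ x y, ‖(F x).im - (F y).im‖ ≤ a := fun x y => by
    rw [← Complex.sub_im]; exact (Complex.abs_im_le_norm _).trans (hd x y)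
  have hrm : Measurable fun x => (F x).re := Complex.measurable_re.comp hF
  have him : Measurable fun x => (F x).im := Complex.measurable_im.comp hF
  have hFF := integrable_mul_of_forall_norm_sub_le (μ := μ) hF.stronglyMeasurable
    hF.stronglyMeasurable hd hd
  have hrr := integrable_mul_of_forall_norm_sub_le (μ := μ) hrm.stronglyMeasurable
    hrm.stronglyMeasurable hred hred
  have hii := integrable_mul_of_forall_norm_sub_le (μ := μ) him.stronglyMeasurable
    him.stronglyMeasurable himd himd
  have e1 : (∫ x, F x * F x ∂μ).re =
      ∫ x, (F x).re * (F x).re ∂μ - ∫ x, (F x).im * (F x).im ∂μ := by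
    rw [← integral_sub hrr hii]
    exact (integral_re hFF).symm
  have e2 : (∫ x, F x ∂μ).re = ∫ x, (F x).re ∂μ := (integral_re hi).symm
  have e3 : (∫ x, F x ∂μ).im = ∫ x, (F x).im ∂μ := (integral_im hi).symm
  simp only [crossCov]
  rw [Complex.sub_re, e1, Complex.mul_re, e2, e3]
  ring

lemma crossCov_self_nonneg {f : Ω → ℝ} {a : ℝ} (hf : Measurable f)
    (hd : ∀ x y, ‖f x - f y‖ ≤ a) : 0 ≤ crossCov f f μ := by
  rw [← integral_sub_integral_sq (integrable_of_forall_norm_sub_le hf.stronglyMeasurable hd)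
    (integrable_mul_of_forall_norm_sub_le hf.stronglyMeasurable hf.stronglyMeasurable hd hd)]
  exact integral_nonneg fun x => sq_nonneg _

end

lemma CoordBound.re {n : ℕ} {S : Fin n → Type*} {F : (∀ i, S i) → ℂ} {a : Fin n → ℝ}
    (h : CoordBound F a) : CoordBound (fun x => (F x).re) a := fun k x y hxy => by
  rw [← Complex.sub_re]; exact (Complex.abs_re_le_norm _).trans (h k x y hxy)

lemma MixedBound.re {n : ℕ} {S : Fin n → Type*} {F : (∀ i, S i) → ℂ} {D : Fin n → Fin n → ℝ}
    (h : MixedBound F D) : MixedBound (fun x => (F x).re) D :=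
  fun j k hjk x xj xk xjk h1 h2 h3 h4 => by
    rw [← Complex.sub_re, ← Complex.sub_re, ← Complex.add_re]
    exact (Complex.abs_re_le_norm _).trans (h j k hjk x xj xk xjk h1 h2 h3 h4)

/-- First order estimate for the exponential of a function of independent variables. -/
theorem norm_integral_pi_exp_sub_le : ∀ {n : ℕ} {S : Fin n → Type u} [∀ i, MeasurableSpace (S i)]
    (μ : ∀ i, Measure (S i)) [∀ i, IsProbabilityMeasure (μ i)] {F : (∀ i, S i) → ℂ}
    {a : Fin n → ℝ}, Measurable F → CoordBound F a →
    ‖∫ x, Complex.exp (F x) ∂Measure.pi μ - Complex.exp (∫ x, F x ∂Measure.pi μ)‖ ≤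
      Real.exp (∫ x, F x ∂Measure.pi μ).re * (Real.exp (∑ k, a k ^ 2 / 8) - 1)
  | 0, S, _, μ, _, F, a, _, _ => by
    have hc : ∀ H : (∀ i, S i) → ℂ, ∫ x, H x ∂Measure.pi μ = H (fun i => i.elim0) := fun H => by
      rw [show H = fun _ => H (fun i => i.elim0) from
        funext fun x => congrArg H (Subsingleton.elim _ _), integral_const]
      simp
    simp [hc]
  | n + 1, S, _, μ, _, F, a, hF, ha => by
    have hd := ha.norm_sub_le
    have hexpi := integrable_exp_of_forall_norm_sub_le (ν := Measure.pi μ) hF hd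
    have hexpm : StronglyMeasurable fun x => Complex.exp (F x) :=
      (Complex.continuous_exp.measurable.comp hF).stronglyMeasurable
    obtain ⟨C, hC⟩ := exists_norm_le_of_diam_le hd
    have hFs : ∀ s : S 0, Measurable fun y => F ((0 : Fin (n + 1)).insertNth s y) := fun s =>
      (stronglyMeasurable_comp_insertNth hF.stronglyMeasurable s).measurable
    rw [integral_pi_insertNth μ hexpi 0, integral_pi_insertNth μ (integrable_of_diam_le hF hd) 0,
      Fin.sum_univ_succAbove _ 0, add_comm (a 0 ^ 2 / 8)]
    refine norm_integral_sub_exp_mean_le (ν := μ 0)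
      (h := fun s => ∫ y, Complex.exp (F ((0 : Fin (n + 1)).insertNth s y))
        ∂Measure.pi fun j => μ (Fin.succAbove 0 j))
      (m := fun s => ∫ y, F ((0 : Fin (n + 1)).insertNth s y)
        ∂Measure.pi fun j => μ (Fin.succAbove 0 j)) ?_ ?_ (fun s s' => ?_) (fun s => ?_)
    · refine integrable_integral_of_norm_le (C := Real.exp C)
        (stronglyMeasurable_uncurry_insertNth hexpm 0) fun s y => ?_
      rw [Complex.norm_exp]
      exact Real.exp_le_exp.2 ((Complex.re_le_norm _).trans (hC _))
    · exact (stronglyMeasurable_uncurry_insertNth hF.stronglyMeasurable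
        0).integral_prod_right.measurable
    · exact norm_integral_sub_integral_le
        (integrable_of_diam_le (hFs s) (ha.comp_insertNth s).norm_sub_le)
        (integrable_of_diam_le (hFs s') (ha.comp_insertNth s').norm_sub_le)
        (ha.norm_insertNth_sub_le s s')
    · exact norm_integral_pi_exp_sub_le (fun j => μ (Fin.succAbove 0 j)) (hFs s)
        (ha.comp_insertNth s)

/-- The total influence on the `k`-th oscillation of the coordinates that `ρ` ranks after `k`. -/
noncomputable def laterInfluence {n : ℕ} (ρ : Fin n → ℕ) (D : Fin n → Fin n → ℝ)
    (a : Fin n → ℝ) (k : Fin n) : ℝ :=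
  ∑ j, if ρ k < ρ j then D j k * a j else 0

lemma laterInfluence_succAbove {n : ℕ} {ρ : Fin (n + 1) → ℕ} {p : Fin (n + 1)}
    (hp : ∀ i, ρ p ≤ ρ i) (D : Fin (n + 1) → Fin (n + 1) → ℝ) (a : Fin (n + 1) → ℝ) (k : Fin n) :
    laterInfluence ρ D a (p.succAbove k) =
      laterInfluence (fun j => ρ (p.succAbove j))
        (fun j k => D (p.succAbove j) (p.succAbove k)) (fun j => a (p.succAbove j)) k := by
  rw [laterInfluence, Fin.sum_univ_succAbove _ p, if_neg (not_lt.2 (hp _)), zero_add]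
  rfl

lemma laterInfluence_self {n : ℕ} {ρ : Fin (n + 1) → ℕ} {p : Fin (n + 1)}
    (hρ : Function.Injective ρ) (hp : ∀ i, ρ p ≤ ρ i) (D : Fin (n + 1) → Fin (n + 1) → ℝ)
    (a : Fin (n + 1) → ℝ) :
    laterInfluence ρ D a p = ∑ j, D (p.succAbove j) p * a (p.succAbove j) := by
  rw [laterInfluence, Fin.sum_univ_succAbove _ p, if_neg (lt_irrefl _), zero_add]
  refine Finset.sum_congr rfl fun j _ => if_pos (lt_of_le_of_ne (hp _) fun e => ?_)
  exact Fin.succAbove_ne p j (hρ e).symm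

/-- Polarisation turns this into the covariance of the difference and the sum of two slices, with
oscillations `D_{jp}` and `2 a_j`; the `2` cancels the `½` of the covariance bound. -/
lemma norm_crossCov_self_insertNth_sub_le {𝕜 : Type*} [RCLike 𝕜] {n : ℕ} {S : Fin (n + 1) → Type u}
    [∀ i, MeasurableSpace (S i)] (μ : ∀ i, Measure (S i)) [∀ i, IsProbabilityMeasure (μ i)]
    {F : (∀ i, S i) → 𝕜} {a : Fin (n + 1) → ℝ} {D : Fin (n + 1) → Fin (n + 1) → ℝ}
    (hF : StronglyMeasurable F) (ha : CoordBound F a) (hD : MixedBound F D) (p : Fin (n + 1))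
    (s s' : S p) :
    ‖crossCov (fun y => F (p.insertNth s y)) (fun y => F (p.insertNth s y))
        (Measure.pi fun j => μ (p.succAbove j)) -
      crossCov (fun y => F (p.insertNth s' y)) (fun y => F (p.insertNth s' y))
        (Measure.pi fun j => μ (p.succAbove j))‖ ≤
      ∑ j, D (p.succAbove j) p * a (p.succAbove j) := by
  have hs := stronglyMeasurable_comp_insertNth hF s
  have hs' := stronglyMeasurable_comp_insertNth hF s'
  rw [crossCov_sub_crossCov hs hs' (ha.comp_insertNth s).norm_sub_le
    (ha.comp_insertNth s').norm_sub_le]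
  have hadd : CoordBound (fun y => F (p.insertNth s y) + F (p.insertNth s' y))
      (fun j => a (p.succAbove j) + a (p.succAbove j)) := by
    intro k y y' h
    rw [add_sub_add_comm]
    exact (norm_add_le _ _).trans (add_le_add (ha.comp_insertNth s k y y' h)
      (ha.comp_insertNth s' k y y' h))
  refine (norm_crossCov_pi_le (fun j => μ (p.succAbove j)) (hs.sub hs') (hs.add hs')
    (hD.coordBound_sub s s') hadd).trans (le_of_eq ?_)
  rw [Finset.mul_sum]
  exact Finset.sum_congr rfl fun j _ => by ring

/-- Second order estimate for the exponential of a function of independent variables. -/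
theorem norm_integral_pi_exp_sub_exp_le : ∀ {n : ℕ} {S : Fin n → Type u}
    [∀ i, MeasurableSpace (S i)] (μ : ∀ i, Measure (S i)) [∀ i, IsProbabilityMeasure (μ i)]
    {F : (∀ i, S i) → ℂ} {a : Fin n → ℝ} {D : Fin n → Fin n → ℝ} {ρ : Fin n → ℕ},
    Measurable F → CoordBound F a → MixedBound F D → Function.Injective ρ →
    ‖∫ x, Complex.exp (F x) ∂Measure.pi μ -
        Complex.exp (∫ x, F x ∂Measure.pi μ + crossCov F F (Measure.pi μ) / 2)‖ ≤
      Real.exp ((∫ x, F x ∂Measure.pi μ).re +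
        crossCov (fun x => (F x).re) (fun x => (F x).re) (Measure.pi μ) / 2) *
      (Real.exp (∑ k, (a k ^ 3 / 6 + a k * laterInfluence ρ D a k / 3 + 5 / 8 * a k ^ 4 +
        5 / 8 * laterInfluence ρ D a k ^ 2)) - 1)
  | 0, S, _, μ, _, F, a, D, ρ, _, _, _, _ => by
    have hc : ∀ H : (∀ i, S i) → ℂ, ∫ x, H x ∂Measure.pi μ = H (fun i => i.elim0) := fun H => by
      rw [show H = fun _ => H (fun i => i.elim0) from
        funext fun x => congrArg H (Subsingleton.elim _ _), integral_const]
      simp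
    simp [crossCov, hc]
  | n + 1, S, _, μ, _, F, a, D, ρ, hF, ha, hD, hρ => by
    -- The coordinate of least rank is integrated last. All others are then ranked after it, so its
    -- later influence is the whole sum `Σ D_{jp} a_j`.
    obtain ⟨p, hp⟩ := Finite.exists_min ρ
    have hd := ha.norm_sub_le
    have hRm : Measurable fun x => (F x).re := Complex.measurable_re.comp hF
    have hexpi := integrable_exp_of_forall_norm_sub_le (ν := Measure.pi μ) hF hd
    have hexpm : StronglyMeasurable fun x => Complex.exp (F x) :=
      (Complex.continuous_exp.measurable.comp hF).stronglyMeasurable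
    obtain ⟨C, hC⟩ := exists_norm_le_of_diam_le hd
    obtain ⟨C', hC'⟩ := exists_norm_le_of_diam_le ha.re.norm_sub_le
    have hFs : ∀ s : S p, Measurable fun y => F (p.insertNth s y) := fun s =>
      (stronglyMeasurable_comp_insertNth hF.stronglyMeasurable s).measurable
    have huF := stronglyMeasurable_uncurry_insertNth hF.stronglyMeasurable p
    have huR := stronglyMeasurable_uncurry_insertNth hRm.stronglyMeasurable p
    set π := Measure.pi fun j => μ (p.succAbove j) with hπ
    have hmre : ∀ s, (∫ y, F (p.insertNth s y) ∂π).re = ∫ y, (F (p.insertNth s y)).re ∂π :=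
      fun s => (integral_re (integrable_of_diam_le (hFs s) (ha.comp_insertNth s).norm_sub_le)).symm
    have hcF : crossCov F F (Measure.pi μ) =
        ∫ s, crossCov (fun y => F (p.insertNth s y)) (fun y => F (p.insertNth s y)) π ∂μ p +
          crossCov (fun s => ∫ y, F (p.insertNth s y) ∂π) (fun s => ∫ y, F (p.insertNth s y) ∂π)
            (μ p) := by
      rw [← crossCov_disintegrate huF huF (fun s y => hC _) (fun s y => hC _), crossCov,
        integral_pi_insertNth μ (integrable_of_diam_le hF hd) p,
        integral_pi_insertNth μ (integrable_mul_of_forall_norm_sub_le hF.stronglyMeasurable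
          hF.stronglyMeasurable hd hd) p]
    have hcR : crossCov (fun x => (F x).re) (fun x => (F x).re) (Measure.pi μ) =
        ∫ s, crossCov (fun y => (F (p.insertNth s y)).re) (fun y => (F (p.insertNth s y)).re) π
            ∂μ p +
          crossCov (fun s => (∫ y, F (p.insertNth s y) ∂π).re)
            (fun s => (∫ y, F (p.insertNth s y) ∂π).re) (μ p) := by
      simp_rw [hmre]
      rw [← crossCov_disintegrate huR huR (fun s y => hC' _) (fun s y => hC' _), crossCov,
        integral_pi_insertNth μ
          (integrable_of_forall_norm_sub_le hRm.stronglyMeasurable ha.re.norm_sub_le) p,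
        integral_pi_insertNth μ (integrable_mul_of_forall_norm_sub_le hRm.stronglyMeasurable
          hRm.stronglyMeasurable ha.re.norm_sub_le ha.re.norm_sub_le) p]
    -- The real part of the pseudovariance is `Var Re - Var Im`, so the real weight dominates the
    -- modulus of the complex approximation.
    have hre : (crossCov F F (Measure.pi μ)).re ≤
        crossCov (fun x => (F x).re) (fun x => (F x).re) (Measure.pi μ) := by
      rw [re_crossCov_self_eq hF hd]
      have : 0 ≤ crossCov (fun x => (F x).im) (fun x => (F x).im) (Measure.pi μ) :=
        crossCov_self_nonneg (Complex.measurable_im.comp hF) fun x y => by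
          rw [← Complex.sub_im]; exact (Complex.abs_im_le_norm _).trans (hd x y)
      linarith
    rw [hcF, hcR] at hre ⊢
    rw [integral_pi_insertNth μ hexpi p, integral_pi_insertNth μ (integrable_of_diam_le hF hd) p,
      Fin.sum_univ_succAbove _ p, add_comm (a p ^ 3 / 6 + _ + _ + _)]
    refine norm_integral_sub_exp_mean_add_le (ν := μ p)
      (h := fun s => ∫ y, Complex.exp (F (p.insertNth s y)) ∂π)
      (m := fun s => ∫ y, F (p.insertNth s y) ∂π)
      (V := fun s => crossCov (fun y => F (p.insertNth s y)) (fun y => F (p.insertNth s y)) π)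
      (v := fun s => crossCov (fun y => (F (p.insertNth s y)).re)
        (fun y => (F (p.insertNth s y)).re) π) ?_ ?_ ?_ ?_ (fun s s' => ?_) (fun s s' => ?_)
      (fun s s' => ?_) (fun s => ?_) hre
    · refine integrable_integral_of_norm_le (C := Real.exp C)
        (stronglyMeasurable_uncurry_insertNth hexpm p) fun s y => ?_
      rw [Complex.norm_exp]
      exact Real.exp_le_exp.2 ((Complex.re_le_norm _).trans (hC _))
    · exact huF.integral_prod_right.measurable
    · exact (stronglyMeasurable_crossCov huF huF).measurable
    · exact (stronglyMeasurable_crossCov huR huR).measurable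
    · exact norm_integral_sub_integral_le
        (integrable_of_diam_le (hFs s) (ha.comp_insertNth s).norm_sub_le)
        (integrable_of_diam_le (hFs s') (ha.comp_insertNth s').norm_sub_le)
        (ha.norm_insertNth_sub_le s s')
    · rw [laterInfluence_self hρ hp]
      exact norm_crossCov_self_insertNth_sub_le μ hF.stronglyMeasurable ha hD p s s'
    · rw [laterInfluence_self hρ hp]
      exact norm_crossCov_self_insertNth_sub_le μ hRm.stronglyMeasurable ha.re hD.re p s s'
    · simp_rw [laterInfluence_succAbove hp]
      exact norm_integral_pi_exp_sub_exp_le (fun j => μ (p.succAbove j)) (hFs s)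
        (ha.comp_insertNth s) (hD.comp_insertNth s)
        (hρ.comp Fin.succAbove_right_injective)

/-! ### The oscillation vector and the mixed oscillation matrix -/

section Oscillations

variable {n : ℕ} {S : Fin n → Type*} {f : (∀ i, S i) → ℂ}

lemma coordBound_coordOsc (hfin : ∀ k, BddAbove (coordDiffs f k)) : CoordBound f (coordOsc f) :=
  fun k x y h => le_csSup (hfin k) ⟨x, y, h, rfl⟩

/-- A mixed difference is a difference of two increments in coordinate `k`. Boundedness ensures that
the `sSup` in `mixedOsc` is a supremum and not the default value `0`. -/
lemma bddAbove_mixedDiffs (hfin : ∀ k, BddAbove (coordDiffs f k)) (j k : Fin n) :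
    BddAbove (mixedDiffs f j k) := by
  refine ⟨coordOsc f k + coordOsc f k, ?_⟩
  rintro _ ⟨x, xj, xk, xjk, h1, _, h3, _, rfl⟩
  have h5 := coordBound_coordOsc hfin k x xk h1
  have h6 := coordBound_coordOsc hfin k xj xjk h3
  rw [norm_sub_rev] at h5
  calc ‖f x - f xj - f xk + f xjk‖ = ‖(f x - f xk) + (f xjk - f xj)‖ := by ring_nf
    _ ≤ _ := (norm_add_le _ _).trans (add_le_add h5 h6)

lemma mixedBound_mixedOsc (hfin : ∀ k, BddAbove (coordDiffs f k)) :
    MixedBound f (fun j k => mixedOsc f j k) := by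
  intro j k hjk x xj xk xjk h1 h2 h3 h4
  simp only [mixedOsc, Matrix.of_apply, if_neg hjk]
  exact le_csSup (bddAbove_mixedDiffs hfin j k) ⟨x, xj, xk, xjk, h1, h2, h3, h4, rfl⟩

lemma coordOsc_nonneg (k : Fin n) : 0 ≤ coordOsc f k :=
  Real.sSup_nonneg fun _ ⟨_, _, _, h⟩ => h ▸ norm_nonneg _

lemma mixedOsc_nonneg (j k : Fin n) : 0 ≤ mixedOsc f j k := by
  simp only [mixedOsc, Matrix.of_apply]
  split_ifs
  · exact le_rfl
  · exact Real.sSup_nonneg fun _ ⟨_, _, _, _, _, _, _, _, h⟩ => h ▸ norm_nonneg _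

lemma mixedOsc_self (k : Fin n) : mixedOsc f k k = 0 := by
  simp [mixedOsc]

lemma mixedDiffs_subset (j k : Fin n) : mixedDiffs f j k ⊆ mixedDiffs f k j := by
  rintro _ ⟨x, xj, xk, xjk, h1, h2, h3, h4, rfl⟩
  exact ⟨x, xk, xj, xjk, h2, h1, h4, h3, by ring_nf⟩

lemma mixedOsc_isSymm : (mixedOsc f).IsSymm := by
  ext j k
  simp only [mixedOsc, Matrix.transpose_apply, Matrix.of_apply, eq_comm (a := k)]
  rw [(mixedDiffs_subset k j).antisymm (mixedDiffs_subset j k)]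

end Oscillations

/-! ### Choice of the order of integration -/

section Ranking

variable {n : ℕ} {D : Matrix (Fin n) (Fin n) ℝ} {a : Fin n → ℝ}

lemma laterInfluence_add_rev (hs : D.IsSymm) (h0 : ∀ k, D k k = 0) (k : Fin n) :
    laterInfluence (fun i => (i : ℕ)) (fun i j => D i j) a k +
      laterInfluence (fun i => (i.rev : ℕ)) (fun i j => D i j) a k = (D *ᵥ a) k := by
  rw [laterInfluence, laterInfluence, ← Finset.sum_add_distrib, Matrix.mulVec, dotProduct]
  refine Finset.sum_congr rfl fun j _ => ?_
  simp only [Fin.val_fin_lt, Fin.rev_lt_rev, hs.apply k j]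
  rcases lt_trichotomy k j with h | h | h
  · rw [if_pos h, if_neg h.not_gt, add_zero]
  · subst h; simp [h0]
  · rw [if_neg h.not_gt, if_pos h, zero_add]

lemma sum_mul_laterInfluence_eq_rev (hs : D.IsSymm) :
    ∑ k, a k * laterInfluence (fun i => (i : ℕ)) (fun i j => D i j) a k =
      ∑ k, a k * laterInfluence (fun i => (i.rev : ℕ)) (fun i j => D i j) a k := by
  simp only [laterInfluence, Finset.mul_sum, Fin.val_fin_lt, Fin.rev_lt_rev]
  rw [Finset.sum_comm]
  refine Finset.sum_congr rfl fun k _ => Finset.sum_congr rfl fun j _ => ?_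
  rw [hs.apply j k]
  split_ifs
  · ring
  · simp

lemma laterInfluence_nonneg {ρ : Fin n → ℕ} (hD : ∀ j k, 0 ≤ D j k) (ha : ∀ k, 0 ≤ a k)
    (k : Fin n) : 0 ≤ laterInfluence ρ (fun i j => D i j) a k :=
  Finset.sum_nonneg fun j _ => by
    split_ifs
    · exact mul_nonneg (hD j k) (ha j)
    · exact le_rfl

/-- One of the two natural orders of the coordinates has small later influences. -/
lemma exists_rank_sum_laterInfluence_le (hs : D.IsSymm) (h0 : ∀ k, D k k = 0)
    (hD : ∀ j k, 0 ≤ D j k) (ha : ∀ k, 0 ≤ a k) :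
    ∃ ρ : Fin n → ℕ, Function.Injective ρ ∧
      ∑ k, a k * laterInfluence ρ (fun i j => D i j) a k = 1 / 2 * (a ⬝ᵥ (D *ᵥ a)) ∧
      ∑ k, laterInfluence ρ (fun i j => D i j) a k ^ 2 ≤ 1 / 2 * (a ⬝ᵥ ((D ^ 2) *ᵥ a)) := by
  set q₁ := laterInfluence (fun i => (i : ℕ)) (fun i j => D i j) a with hq₁
  set q₂ := laterInfluence (fun i => (i.rev : ℕ)) (fun i j => D i j) a with hq₂
  have hsum : ∀ k, q₁ k + q₂ k = (D *ᵥ a) k := laterInfluence_add_rev hs h0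
  -- Exchanging the two summation indices reverses the order, and `D` is symmetric.
  have heq : ∑ k, a k * q₁ k = ∑ k, a k * q₂ k := sum_mul_laterInfluence_eq_rev hs
  have hlin : ∑ k, a k * q₁ k + ∑ k, a k * q₂ k = a ⬝ᵥ (D *ᵥ a) := by
    rw [← Finset.sum_add_distrib, dotProduct]
    exact Finset.sum_congr rfl fun k _ => by rw [← mul_add, hsum]
  -- By symmetry `aᵀD²a = Σ (D a)_k² = Σ (q₁ + q₂)²`, and the cross terms are nonnegative.
  have hsq : ∑ k, q₁ k ^ 2 + ∑ k, q₂ k ^ 2 ≤ a ⬝ᵥ ((D ^ 2) *ᵥ a) := by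
    rw [sq D, ← Matrix.mulVec_mulVec, Matrix.dotProduct_mulVec, ← Matrix.mulVec_transpose, hs.eq,
      dotProduct, ← Finset.sum_add_distrib]
    refine Finset.sum_le_sum fun k _ => ?_
    rw [← hsum]
    nlinarith [mul_nonneg (laterInfluence_nonneg (ρ := fun i => (i : ℕ)) hD ha k)
      (laterInfluence_nonneg (ρ := fun i => (i.rev : ℕ)) hD ha k)]
  rcases le_total (∑ k, q₁ k ^ 2) (∑ k, q₂ k ^ 2) with h | h
  · exact ⟨_, Fin.val_injective, by linarith, by linarith⟩
  · exact ⟨_, Fin.val_injective.comp Fin.rev_injective, by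
      change ∑ k, a k * q₂ k = _
      linarith, by
      change ∑ k, q₂ k ^ 2 ≤ _
      linarith⟩

end Ranking

/-! ### Transfer to the law of the random vector, and the theorem -/

section Law

variable {n : ℕ} {Ω : Type*} [MeasurableSpace Ω] {P : Measure Ω} [IsProbabilityMeasure P]
  {E : Fin n → Type*} [∀ k, MeasurableSpace (E k)] {X : ∀ k, Ω → E k}

lemma measurable_rangeVector (hX : ∀ k, Measurable (X k)) : Measurable (rangeVector X) :=
  measurable_pi_lambda _ fun k => (hX k).subtype_mk

/-- Restricting the codomain to the range with its trace σ-field leaves the generated σ-algebra on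
`Ω` unchanged, so independence is preserved. -/
lemma map_rangeVector (hX : ∀ k, Measurable (X k)) (hindep : iIndepFun X P) :
    P.map (rangeVector X) = Measure.pi fun k => P.map fun ω => rangeVector X ω k := by
  have hm : ∀ k, Measurable fun ω => rangeVector X ω k := fun k => (hX k).subtype_mk
  have hi : iIndepFun (fun k ω => rangeVector X ω k) P := by
    rw [iIndepFun_iff_iIndep] at hindep ⊢
    convert hindep using 2 with k
    exact MeasurableSpace.comap_comp
  exact (iIndepFun_iff_map_fun_eq_pi_map fun k => (hm k).aemeasurable).1 hi

end Law

theorem mainTheorem3 {n : ℕ} {Ω : Type*} [MeasurableSpace Ω] (P : Measure Ω)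
    [IsProbabilityMeasure P] {E : Fin n → Type*} [∀ k, MeasurableSpace (E k)]
    (X : ∀ k, Ω → E k) (hX : ∀ k, Measurable (X k)) (hindep : iIndepFun X P)
    (f : (∀ k, Set.range (X k)) → ℂ) (hf : Measurable f)
    (hfin : ∀ k, BddAbove (coordDiffs f k))
    (α : Fin n → ℝ) (hα : α = coordOsc f)
    (Δ : Matrix (Fin n) (Fin n) ℝ) (hΔ : Δ = mixedOsc f)
    (Z : Ω → ℂ) (hZ : Z = fun ω => f (rangeVector X ω)) :
    (MemLp Z 2 P ∧ Integrable (fun ω => Complex.exp (Z ω)) P) ∧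
    (∃ K : ℂ,
      ∫ ω, Complex.exp (Z ω) ∂P = Complex.exp (∫ ω, Z ω ∂P) * (1 + K) ∧
      ‖K‖ ≤ Real.exp ((1 / 8) * (α ⬝ᵥ α)) - 1) ∧
    (∃ L L' : ℂ,
      ∫ ω, Complex.exp (Z ω) ∂P =
        Complex.exp ((∫ ω, Z ω ∂P) + (1 / 2) * pseudovariance Z P)
          + L * (Real.exp ((∫ ω, (Z ω).re ∂P)
              + (1 / 2) * variance (fun ω => (Z ω).re) P) : ℂ) ∧
      ∫ ω, Complex.exp (Z ω) ∂P =
        Complex.exp ((∫ ω, Z ω ∂P) + (1 / 2) * pseudovariance Z P)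
          * (1 + L' * (Real.exp ((1 / 2) * variance (fun ω => (Z ω).im) P) : ℂ)) ∧
      ‖L‖ = ‖L'‖ ∧
      ‖L'‖ ≤ Real.exp ((1 / 6) * ∑ k, α k ^ 3
          + (1 / 6) * (α ⬝ᵥ (Δ *ᵥ α))
          + (5 / 8) * ∑ k, α k ^ 4
          + (5 / 16) * (α ⬝ᵥ ((Δ ^ 2) *ᵥ α))) - 1) := by
  have hca : CoordBound f α := hα ▸ coordBound_coordOsc hfin
  have hmD : MixedBound f (fun j k => Δ j k) := hΔ ▸ mixedBound_mixedOsc hfin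
  have hrv := measurable_rangeVector hX
  have hZm : Measurable Z := hZ ▸ hf.comp hrv
  have hZd : ∀ ω ω', ‖Z ω - Z ω'‖ ≤ ∑ k, α k := fun ω ω' => by rw [hZ]; exact hca.norm_sub_le _ _
  have hred : ∀ ω ω', ‖(Z ω).re - (Z ω').re‖ ≤ ∑ k, α k := fun ω ω' => by
    rw [← Complex.sub_re]; exact (Complex.abs_re_le_norm _).trans (hZd ω ω')
  have himd : ∀ ω ω', ‖(Z ω).im - (Z ω').im‖ ≤ ∑ k, α k := fun ω ω' => by
    rw [← Complex.sub_im]; exact (Complex.abs_im_le_norm _).trans (hZd ω ω')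
  have hrm : Measurable fun ω => (Z ω).re := Complex.measurable_re.comp hZm
  have him : Measurable fun ω => (Z ω).im := Complex.measurable_im.comp hZm
  have hZi := integrable_of_diam_le (μ := P) hZm hZd
  have hexpi := integrable_exp_of_forall_norm_sub_le (ν := P) hZm hZd
  have hpv : pseudovariance Z P = crossCov Z Z P :=
    integral_sub_integral_sq hZi (integrable_mul_of_forall_norm_sub_le hZm.stronglyMeasurable
      hZm.stronglyMeasurable hZd hZd)
  have hvr : variance (fun ω => (Z ω).re) P =
      crossCov (fun ω => (Z ω).re) (fun ω => (Z ω).re) P := by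
    rw [variance_eq_integral hrm.aemeasurable]
    exact integral_sub_integral_sq (integrable_of_forall_norm_sub_le hrm.stronglyMeasurable hred)
      (integrable_mul_of_forall_norm_sub_le hrm.stronglyMeasurable hrm.stronglyMeasurable hred hred)
  have hvi : variance (fun ω => (Z ω).im) P =
      crossCov (fun ω => (Z ω).im) (fun ω => (Z ω).im) P := by
    rw [variance_eq_integral him.aemeasurable]
    exact integral_sub_integral_sq (integrable_of_forall_norm_sub_le him.stronglyMeasurable himd)
      (integrable_mul_of_forall_norm_sub_le him.stronglyMeasurable him.stronglyMeasurable himd himd)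
  set ν : ∀ k, Measure (Set.range (X k)) := fun k => P.map fun ω => rangeVector X ω k with hν
  have hprob : ∀ k, IsProbabilityMeasure (ν k) := fun k =>
    Measure.isProbabilityMeasure_map (hX k).subtype_mk.aemeasurable
  have hlawC : ∀ H : (∀ k, Set.range (X k)) → ℂ, Measurable H →
      ∫ x, H x ∂Measure.pi ν = ∫ ω, H (rangeVector X ω) ∂P := fun H hH => by
    rw [← map_rangeVector hX hindep, integral_map hrv.aemeasurable hH.aestronglyMeasurable]
  have hlawR : ∀ H : (∀ k, Set.range (X k)) → ℝ, Measurable H →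
      ∫ x, H x ∂Measure.pi ν = ∫ ω, H (rangeVector X ω) ∂P := fun H hH => by
    rw [← map_rangeVector hX hindep, integral_map hrv.aemeasurable hH.aestronglyMeasurable]
  have hfre : Measurable fun x => (f x).re := Complex.measurable_re.comp hf
  have hmean : ∫ x, f x ∂Measure.pi ν = ∫ ω, Z ω ∂P := by rw [hlawC f hf, hZ]
  have hexp : ∫ x, Complex.exp (f x) ∂Measure.pi ν = ∫ ω, Complex.exp (Z ω) ∂P := by
    rw [hlawC (fun x => Complex.exp (f x)) (Complex.continuous_exp.measurable.comp hf), hZ]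
  have hcovC : crossCov f f (Measure.pi ν) = crossCov Z Z P := by
    rw [crossCov, crossCov, hmean, hlawC (fun x => f x * f x) (hf.mul hf), hZ]
  have hcovR : crossCov (fun x => (f x).re) (fun x => (f x).re) (Measure.pi ν) =
      crossCov (fun ω => (Z ω).re) (fun ω => (Z ω).re) P := by
    rw [crossCov, crossCov, hlawR _ hfre,
      hlawR (fun x => (f x).re * (f x).re) (hfre.mul hfre), hZ]
  refine ⟨⟨?_, hexpi⟩, ?_, ?_⟩
  · obtain ⟨C, hC⟩ := exists_norm_le_of_diam_le hZd
    exact MemLp.of_bound hZm.aestronglyMeasurable C (Filter.Eventually.of_forall hC)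
  · have h := norm_integral_pi_exp_sub_le ν hf hca
    rw [hmean, hexp] at h
    have hne := Complex.exp_ne_zero (∫ ω, Z ω ∂P)
    refine ⟨(∫ ω, Complex.exp (Z ω) ∂P - Complex.exp (∫ ω, Z ω ∂P)) /
      Complex.exp (∫ ω, Z ω ∂P), by field_simp; ring, ?_⟩
    rw [norm_div, Complex.norm_exp (∫ ω, Z ω ∂P), div_le_iff₀' (Real.exp_pos _)]
    have e : ∑ k, α k ^ 2 / 8 = 1 / 8 * (α ⬝ᵥ α) := by
      rw [dotProduct, Finset.mul_sum]
      exact Finset.sum_congr rfl fun k _ => by ring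
    rwa [e] at h
  · obtain ⟨ρ, hρ, hlin, hsq⟩ := exists_rank_sum_laterInfluence_le (D := Δ) (a := α)
      (hΔ ▸ mixedOsc_isSymm) (fun k => hΔ ▸ mixedOsc_self k) (fun j k => hΔ ▸ mixedOsc_nonneg j k)
      (fun k => hα ▸ coordOsc_nonneg k)
    have h := norm_integral_pi_exp_sub_exp_le ν hf hca hmD hρ
    -- The chosen order turns `1/3` into `1/6` exactly and `5/8` into at most `5/16`.
    have hsum : ∑ k, (α k ^ 3 / 6 + α k * laterInfluence ρ (fun j k => Δ j k) α k / 3 +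
        5 / 8 * α k ^ 4 + 5 / 8 * laterInfluence ρ (fun j k => Δ j k) α k ^ 2) ≤
        (1 / 6) * ∑ k, α k ^ 3 + (1 / 6) * (α ⬝ᵥ (Δ *ᵥ α)) + (5 / 8) * ∑ k, α k ^ 4
          + (5 / 16) * (α ⬝ᵥ ((Δ ^ 2) *ᵥ α)) := by
      simp only [Finset.sum_add_distrib, ← Finset.sum_div, ← Finset.mul_sum]
      rw [hlin]
      linarith
    have hmre : (∫ ω, Z ω ∂P).re = ∫ ω, (Z ω).re ∂P := (integral_re hZi).symm
    rw [hmean, hexp, hcovC, hcovR, ← hpv, ← hvr, hmre] at h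
    have hWre : ((∫ ω, Z ω ∂P) + (1 / 2) * pseudovariance Z P).re =
        ∫ ω, (Z ω).re ∂P + 1 / 2 * variance (fun ω => (Z ω).re) P -
          1 / 2 * variance (fun ω => (Z ω).im) P := by
      rw [Complex.add_re, hmre, show (1 / 2 : ℂ) = ((1 / 2 : ℝ) : ℂ) by norm_num,
        Complex.re_ofReal_mul, hpv, re_crossCov_self_eq hZm hZd, hvr, hvi]
      ring
    rw [show (∫ ω, Z ω ∂P) + pseudovariance Z P / 2 =
      (∫ ω, Z ω ∂P) + (1 / 2) * pseudovariance Z P by ring,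
      show ∫ ω, (Z ω).re ∂P + variance (fun ω => (Z ω).re) P / 2 =
        ∫ ω, (Z ω).re ∂P + 1 / 2 * variance (fun ω => (Z ω).re) P by ring] at h
    set W := (∫ ω, Z ω ∂P) + (1 / 2) * pseudovariance Z P with hW
    set r := ∫ ω, (Z ω).re ∂P + 1 / 2 * variance (fun ω => (Z ω).re) P with hr
    set i := 1 / 2 * variance (fun ω => (Z ω).im) P with hi
    have hne := Complex.exp_ne_zero W
    have hr0 : ((Real.exp r : ℝ) : ℂ) ≠ 0 := Complex.ofReal_ne_zero.2 (Real.exp_pos r).ne'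
    have hi0 : ((Real.exp i : ℝ) : ℂ) ≠ 0 := Complex.ofReal_ne_zero.2 (Real.exp_pos i).ne'
    -- The norms agree because `|e^W| = e^{r - i}`, by `Re 𝕍 Z = Var Re Z - Var Im Z`.
    have hLL : ‖(∫ ω, Complex.exp (Z ω) ∂P - Complex.exp W) / ((Real.exp r : ℝ) : ℂ)‖ =
        ‖(∫ ω, Complex.exp (Z ω) ∂P - Complex.exp W) /
          (Complex.exp W * ((Real.exp i : ℝ) : ℂ))‖ := by
      rw [norm_div, norm_div, norm_mul, Complex.norm_exp, hWre, Complex.norm_real,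
        Complex.norm_real, Real.norm_eq_abs, Real.norm_eq_abs, Real.abs_exp, Real.abs_exp,
        ← Real.exp_add, sub_add_cancel]
    refine ⟨(∫ ω, Complex.exp (Z ω) ∂P - Complex.exp W) / ((Real.exp r : ℝ) : ℂ),
      (∫ ω, Complex.exp (Z ω) ∂P - Complex.exp W) / (Complex.exp W * ((Real.exp i : ℝ) : ℂ)),
      ?_, ?_, hLL, ?_⟩
    · rw [div_mul_cancel₀ _ hr0]; ring
    · field_simp; ring
    · rw [← hLL, norm_div, Complex.norm_real, Real.norm_eq_abs, Real.abs_exp,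
        div_le_iff₀' (Real.exp_pos _)]
      refine h.trans (mul_le_mul_of_nonneg_left ?_ (Real.exp_pos _).le)
      linarith [Real.exp_le_exp.2 hsum]
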